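/- Let $k$ be an algebraically closed field of characteristic $0$. A variety is an integral separated scheme of finite type over $k$. Let $X$ be a normal projective variety of dimension $1$ over $k$ with canonical divisor $K_X$, let $B\ge 0$ be an effective $\mathbb{R}$-divisor on $X$, and let $\pi\colon X\to Z$ be a contraction of varieties over $k$, that is, a surjective projective morphism with connected fibres. Let $m$ be a positive integer such that $m(K_X+B)$ is Cartier, and assume that $K_X+B\equiv_Z 0$, that is, $(K_X+B)\cdot C=0$ for every curve $C\subseteq X$ which $\pi$ maps to a point. Then there is a Cartier divisor $D_Z$ on $Z$ such that $$m(K_X+B)\sim \pi^*D_Z .$$ -/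

import Mathlib

open CategoryTheory CategoryTheory.Limits AlgebraicGeometry

universe u

noncomputable section

namespace CurvePair

/-! ### Varieties and projective morphisms -/

/-- A variety over a field `k`: an integral (irreducible and reduced) scheme, separated and of
finite type over `k`. -/
structure Variety (k : Type u) [Field k] where
  /-- the underlying scheme -/
  scheme : Scheme.{u}
  /-- the structure morphism -/
  str : scheme ⟶ Spec (.of k)
  integral : AlgebraicGeometry.IsIntegral scheme
  separated : IsSeparated str
  locallyOfFiniteType : LocallyOfFiniteType str
  quasiCompact : QuasiCompact str

variable {k : Type u} [Field k]

instance (X : Variety k) : AlgebraicGeometry.IsIntegral X.scheme := X.integral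

instance (X : Variety k) : IsLocallyNoetherian X.scheme :=
  haveI := X.locallyOfFiniteType
  LocallyOfFiniteType.isLocallyNoetherian X.str

/-- The function field `k(X)` of a variety. -/
abbrev Variety.functionField (X : Variety k) : Type u := X.scheme.functionField

/-- The `k`-algebra structure on the function field induced by the structure morphism. -/
instance (X : Variety k) : Algebra k X.functionField :=
  RingHom.toAlgebra ((Scheme.ΓSpecIso (.of k)).inv ≫ X.str.appTop ≫
    X.scheme.presheaf.germ ⊤ (genericPoint X.scheme) trivial).hom

attribute [local instance] MvPolynomial.gradedAlgebra in
/-- Projective space `ℙⁿ` over `k`, as `Proj k[x₀, …, xₙ]`. -/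
def projectiveSpace (k : Type u) [Field k] (n : ℕ) : Scheme.{u} :=
  Proj (MvPolynomial.homogeneousSubmodule (Fin (n + 1)) k)

attribute [local instance] MvPolynomial.gradedAlgebra in
/-- The structure morphism `ℙⁿ ⟶ Spec k`. -/
def projectiveSpaceStr (k : Type u) [Field k] (n : ℕ) : projectiveSpace k n ⟶ Spec (.of k) :=
  Proj.toSpecZero (MvPolynomial.homogeneousSubmodule (Fin (n + 1)) k) ≫
    Spec.map (CommRingCat.ofHom
      (algebraMap k (MvPolynomial.homogeneousSubmodule (Fin (n + 1)) k 0)))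

/-- A morphism `f : X ⟶ S`, where `S` lies over `k` via `s`, is projective if it factors as a closed
immersion into `S ×ₖ ℙⁿ` followed by the projection to `S`. -/
def IsProjectiveMorphism {X S : Scheme.{u}} (f : X ⟶ S) (s : S ⟶ Spec (.of k)) : Prop :=
  ∃ (n : ℕ) (i : X ⟶ pullback s (projectiveSpaceStr k n)),
    IsClosedImmersion i ∧ i ≫ pullback.fst s (projectiveSpaceStr k n) = f

/-- A variety is projective if it is projective over `Spec k`. -/
def Variety.IsProjective (X : Variety k) : Prop :=
  IsProjectiveMorphism X.str (𝟙 (Spec (.of k)))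

/-- A variety is normal if all its local rings are integrally closed domains. -/
def Variety.IsNormal (X : Variety k) : Prop :=
  ∀ x : X.scheme, IsIntegrallyClosed (X.scheme.presheaf.stalk x)

/-- A contraction `X → Z` of varieties over `k`: a surjective projective morphism
with connected fibres. -/
structure Contraction (X Z : Variety k) where
  /-- the underlying morphism of schemes -/
  hom : X.scheme ⟶ Z.scheme
  comm : hom ≫ Z.str = X.str
  surjective : Function.Surjective hom
  projective : IsProjectiveMorphism hom Z.str
  connected_fibres : ∀ z : Z.scheme, _root_.IsConnected (hom ⁻¹' {z})

lemma Contraction.map_genericPoint {X Z : Variety k} (π : Contraction X Z) :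
    π.hom (genericPoint X.scheme) = genericPoint Z.scheme := by
  have h := (genericPoint_spec X.scheme).image π.hom.continuous
  rw [Set.image_univ, π.surjective.range_eq, closure_univ] at h
  exact h.eq (genericPoint_spec Z.scheme)

/-- The inclusion of function fields `k(Z) → k(X)`, pull-back of rational functions along a
contraction. -/
def Contraction.functionFieldMap {X Z : Variety k} (π : Contraction X Z) :
    Z.functionField →+* X.functionField :=
  (Z.scheme.presheaf.stalkSpecializes (specializes_of_eq π.map_genericPoint) ≫
    π.hom.stalkMap (genericPoint X.scheme)).hom

/-! ### Divisors -/

/-- A prime divisor, represented by its generic point, a point of codimension one. -/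
abbrev PrimeDivisor (X : Variety k) : Type u := {x : X.scheme // Order.coheight x = 1}

/-- Divisors: finite formal sums of prime divisors with integer coefficients. -/
abbrev Divisor (X : Variety k) : Type u := PrimeDivisor X →₀ ℤ

/-- `ℝ`-divisors: finite formal sums of prime divisors with real coefficients. -/
abbrev RDivisor (X : Variety k) : Type u := PrimeDivisor X →₀ ℝ

/-- A divisor regarded as an `ℝ`-divisor. -/
def Divisor.toReal {X : Variety k} (D : Divisor X) : RDivisor X :=
  D.mapRange (fun n : ℤ => (n : ℝ)) Int.cast_zero

/-- The order `ord_x φ` of a rational function along a prime divisor. -/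
def ordAt {X : Variety k} (φ : X.functionField) (x : PrimeDivisor X) : ℤ :=
  Scheme.ord φ x.1

/-- An `ℝ`-divisor (on a normal variety) is Cartier if it is locally the divisor of
a nonzero rational function; in particular its coefficients are then integers. -/
def RDivisor.IsCartier {X : Variety k} (D : RDivisor X) : Prop :=
  ∀ p : X.scheme, ∃ U : X.scheme.Opens, p ∈ U ∧ ∃ φ : X.functionField, φ ≠ 0 ∧
    ∀ x : PrimeDivisor X, x.1 ∈ U → D x = (ordAt φ x : ℝ)

/-- A Cartier divisor on a variety, not necessarily normal: a global section of the sheaf `𝒦*/𝒪*`,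
where `𝒦` is the constant sheaf of rational functions. It is given by representatives
`eqn z ∈ k(Z)*` of its germs in `k(Z)*/𝒪_{Z,z}*`, such that near each point `z` the one function
`eqn z` represents all the germs. -/
structure CartierDivisor (Z : Variety k) where
  /-- a local equation at each point -/
  eqn : Z.scheme → Z.functionField
  eqn_ne_zero : ∀ z, eqn z ≠ 0
  locally_eq : ∀ z, ∃ U : Z.scheme.Opens, z ∈ U ∧ ∀ y ∈ U,
    ∃ u : (Z.scheme.presheaf.stalk y)ˣ,
      eqn y = algebraMap (Z.scheme.presheaf.stalk y) Z.scheme.functionField u * eqn z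

lemma Contraction.functionFieldMap_algebraMap {X Z : Variety k} (π : Contraction X Z)
    (x : X.scheme) (a : Z.scheme.presheaf.stalk (π.hom x)) :
    π.functionFieldMap
        (algebraMap (Z.scheme.presheaf.stalk (π.hom x)) Z.scheme.functionField a) =
      algebraMap (X.scheme.presheaf.stalk x) X.scheme.functionField (π.hom.stalkMap x a) := by
  simp only [Contraction.functionFieldMap, RingHom.algebraMap_toAlgebra]
  rw [← Scheme.Hom.stalkSpecializes_stalkMap_apply π.hom]
  simp only [CommRingCat.hom_comp, RingHom.comp_apply]
  congr 1
  exact DFunLike.congr_fun (CommRingCat.hom_ext_iff.mp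
    (Z.scheme.presheaf.stalkSpecializes_comp _ _)) a

/-- The pull-back `π^* D` of a Cartier divisor along a contraction, by pulling back
local equations. -/
def CartierDivisor.pullback {X Z : Variety k} (π : Contraction X Z) (D : CartierDivisor Z) :
    CartierDivisor X where
  eqn x := π.functionFieldMap (D.eqn (π.hom x))
  eqn_ne_zero x := (map_ne_zero π.functionFieldMap).2 (D.eqn_ne_zero _)
  locally_eq x := by
    obtain ⟨U, hU, h⟩ := D.locally_eq (π.hom x)
    refine ⟨π.hom ⁻¹ᵁ U, hU, fun y hy => ?_⟩
    obtain ⟨u, hu⟩ := h (π.hom y) hy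
    refine ⟨Units.map (π.hom.stalkMap y).hom u, ?_⟩
    rw [hu, map_mul, π.functionFieldMap_algebraMap]
    rfl

/-- The coefficient at a prime divisor of the Weil divisor of a Cartier divisor. -/
def CartierDivisor.coeff {X : Variety k} (D : CartierDivisor X) (x : PrimeDivisor X) : ℤ :=
  ordAt (D.eqn x.1) x

/-- Linear equivalence on a normal variety of an `ℝ`-divisor `D` and a Cartier divisor `E`:
their difference is the divisor of a nonzero rational function. -/
def LinearlyEquivalent {X : Variety k} (D : RDivisor X) (E : CartierDivisor X) : Prop :=
  ∃ φ : X.functionField, φ ≠ 0 ∧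
    ∀ x : PrimeDivisor X, D x = (E.coeff x : ℝ) + (ordAt φ x : ℝ)

/-! ### Canonical divisors and numerical triviality on curves -/

/-- On a normal curve `X`, the divisor `K` is a canonical divisor if it is the divisor of a nonzero
rational differential form `ω`: at every prime divisor (closed point) `x` one has `ω = φ dt` with
`t` a uniformizer of `𝒪_{X,x}` and `ord_x φ` the coefficient of `K` at `x`. -/
def IsCanonicalDivisor {X : Variety k} (K : Divisor X) : Prop :=
  ∃ ω : Ω[X.functionField⁄k], ω ≠ 0 ∧ ∀ x : PrimeDivisor X,
    ∃ t : X.scheme.presheaf.stalk x.1, Irreducible t ∧ ∃ φ : X.functionField,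
      ω = φ • KaehlerDifferential.D k X.functionField
        (algebraMap (X.scheme.presheaf.stalk x.1) X.scheme.functionField t) ∧
      K x = ordAt φ x

/-- The degree of an `ℝ`-divisor on a curve over an algebraically closed field (where every closed
point has degree one): the sum of its coefficients. -/
def RDivisor.degree {X : Variety k} (D : RDivisor X) : ℝ := D.sum fun _ r => r

/-- For a contraction `π : X → Z` from a projective normal curve `X`, the relation `D ≡_Z 0`: one has
`D · C = 0` for every curve `C ⊆ X` (irreducible closed subset of dimension one) that `π` maps to a
point. As `X` is itself an irreducible curve, such a `C` is all of `X`, and `D · C` is the degree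
of `D`. -/
def NumericallyTrivialOver {X Z : Variety k} (π : Contraction X Z) (D : RDivisor X) : Prop :=
  ∀ C : Set X.scheme, IsClosed C → IsIrreducible C → topologicalKrullDim C = 1 →
    (∃ z : Z.scheme, ∀ x ∈ C, π.hom x = z) → D.degree = 0

end CurvePair

end

/-! If `π` contracts `X` to a point, the hypothesis gives deg (K + B) = 0. Since B is effective, deg
K ≤ 0, and it remains to see that m(K + B) is principal. When deg K < 0, every divisor of degree
zero is principal. When deg K = 0, effectivity forces B = 0, and K itself is principal. Both facts
follow from Riemann–Roch (`exists_ordAt_eq`).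

If `π` is not constant, its fibres over closed points are finite and connected, so `π` is injective
(`Contraction.injOn`). In characteristic zero this makes it birational
(`Contraction.functionFieldMap_surjective`). Every integral divisor D on `X` is then a pull-back on
the nose: at the images of the points of D, functions in k(Z) with the prescribed orders serve as
local equations, and 1 serves elsewhere. No normality of `Z` is needed (`exists_coeff_pullback_eq`).

Riemann–Roch is proved for a finite extension F of k(x) together with all its places. The places
split into those over k[x] and those over x = ∞. Let A and A' be the spaces of functions with poles
bounded by D on the two halves. Then A ∩ A' = L(D), and F/(A + A') plays the role of H¹(D). Taking
the coefficient of x⁻¹ in the expansion of Tr(fg) at infinity, which is a residue up to sign,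
identifies the dual of F/(A + A') with L(K₀ - D), where K₀ is the order of dx (`serreDuality`).
Locally this is trace duality together with the exponent e - 1 of the different in the tame case. A
new point enlarges exactly one of A, A' by one dimension, so ell(D) - ell(K - D) grows by one
(`eulerChar_add_single`). This is Riemann–Roch in a form that avoids the genus.

The geometric input is that the closed points of the curve are all the places of its function field
(`isPlaceSystem_placeValuation`, by the valuative criteria), that this field is finite over k(x)
(`finiteDimensional_functionField`), and that K differs from K₀ by a principal divisor
(`exists_isDifferentialOrder`). -/

section

open WithZero IsDedekindDomain
open scoped nonZeroDivisors

/-! ### Normalized discrete valuations and systems of places. -/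

section Valuations

variable {F : Type*} [Field F]

/-- Equal valuation rings give only equivalent valuations. Surjectivity makes a uniformizer of `v`
one of `w`, and every nonzero element is a power of it times an element of value 1 for both. -/
lemma Valuation.eq_of_valuationSubring_eq {v w : Valuation F ℤᵐ⁰}
    (hv : Function.Surjective v) (hw : Function.Surjective w)
    (h : v.valuationSubring = w.valuationSubring) : v = w := by
  have le_one_iff : ∀ x, v x ≤ 1 ↔ w x ≤ 1 := fun x => by
    simpa [Valuation.mem_valuationSubring_iff] using SetLike.ext_iff.mp h x
  have hequiv : v.IsEquiv w := Valuation.isEquiv_iff_val_le_one.mpr fun {x} => le_one_iff x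
  obtain ⟨t, ht⟩ := hv (exp (-1))
  obtain ⟨s, hs⟩ := hw (exp (-1))
  have lt1 : (exp (-1) : ℤᵐ⁰) < 1 := by
    rw [← exp_zero]; exact exp_lt_exp.mpr (by norm_num)
  have aux : ∀ y : ℤᵐ⁰, y < 1 → y ≤ exp (-1) := by
    intro y hy
    rcases eq_or_ne y 0 with rfl | hy0
    · exact zero_le
    · rw [← exp_log hy0, ← exp_zero, exp_lt_exp] at hy
      rw [← exp_log hy0, exp_le_exp]
      omega
  have hwt : w t = exp (-1) := by
    apply le_antisymm
    · exact aux _ ((Valuation.isEquiv_iff_val_lt_one.mp hequiv).mp (ht ▸ lt1))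
    · have : v s ≤ v t := ht ▸ aux _ ((Valuation.isEquiv_iff_val_lt_one.mp hequiv).mpr (hs ▸ lt1))
      exact hs ▸ (hequiv s t).mp this
  ext x
  rcases eq_or_ne x 0 with rfl | hx
  · simp
  have hvx : v x ≠ 0 := (Valuation.ne_zero_iff v).mpr hx
  set n := log (v x) with hn
  have h1 : v (x * t ^ n) = 1 := by
    rw [map_mul, map_zpow₀, ht, ← exp_log hvx, ← hn, ← exp_zsmul, ← exp_add]
    simp
  have h2 : w (x * t ^ n) = 1 := (Valuation.isEquiv_iff_val_eq_one.mp hequiv).mp h1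
  have h3 : w (t ^ n) = v (t ^ n) := by rw [map_zpow₀, map_zpow₀, ht, hwt]
  have h4 : v (t ^ n) ≠ 0 := by
    rw [map_zpow₀, ht]; exact zpow_ne_zero _ (by simp)
  rw [map_mul] at h1 h2
  rw [h3] at h2
  exact mul_right_cancel₀ h4 (h1.trans h2.symm)

variable (k : Type*) [Field k] [Algebra k F]

/-- The complete collection of places of a one-dimensional function field `F` over `k`, all of
degree one. -/
structure IsPlaceSystem {ι : Type*} (v : ι → Valuation F ℤᵐ⁰) : Prop where
  surjective : ∀ P, Function.Surjective (v P)
  algebraMap_le_one : ∀ P (c : k), v P (algebraMap k F c) ≤ 1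
  exists_residue : ∀ P f, v P f ≤ 1 → ∃ c : k, v P (f - algebraMap k F c) < 1
  exists_eq : ∀ A : ValuationSubring F, A ≠ ⊤ → (∀ c : k, algebraMap k F c ∈ A) →
    ∃ P, (v P).valuationSubring = A
  injective : ∀ P Q, (v P).valuationSubring = (v Q).valuationSubring → P = Q

lemma WithZero.lt_exp_iff_le_exp_sub_one {x : ℤᵐ⁰} {n : ℤ} : x < exp n ↔ x ≤ exp (n - 1) := by
  rcases eq_or_ne x 0 with rfl | hx
  · simp [exp_pos]
  · rw [← exp_log hx, exp_lt_exp, exp_le_exp]; omega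

end Valuations

/-! ### Places over a base ring and primes of its integral closure. -/

section Local

set_option linter.unusedSectionVars false

variable {k F : Type*} [Field k] [Field F] [Algebra k F]
variable {ι : Type*} {v : ι → Valuation F ℤᵐ⁰}

/-- The places at which all elements of `R` are regular. -/
def placesOver (R : Type*) [CommRing R] [Algebra R F] (v : ι → Valuation F ℤᵐ⁰) : Set ι :=
  {P | ∀ r : R, v P (algebraMap R F r) ≤ 1}

/-- The space of elements of `F` whose poles at the places in `S` are bounded by `d`. -/
def boundedPoles (hv : IsPlaceSystem k v) (S : Set ι) (d : ι → ℤ) : Submodule k F where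
  carrier := {f | ∀ P ∈ S, v P f ≤ exp (d P)}
  zero_mem' := by intro P _; simp
  add_mem' := fun ha hb P hP => (Valuation.map_add (v P) _ _).trans (max_le (ha P hP) (hb P hP))
  smul_mem' := fun c x hx P hP => by
    rw [Algebra.smul_def, map_mul]
    exact (mul_le_mul_left (hv.algebraMap_le_one P c) _).trans (by simpa using hx P hP)

lemma mem_boundedPoles {hv : IsPlaceSystem k v} {S : Set ι} {d : ι → ℤ} {f : F} :
    f ∈ boundedPoles hv S d ↔ ∀ P ∈ S, v P f ≤ exp (d P) := Iff.rfl

variable (R B : Type*) [CommRing R] [Algebra R F] [CommRing B] [IsDedekindDomain B]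
  [Algebra B F] [IsFractionRing B F] [Algebra R B] [IsScalarTower R B F]
  [IsIntegralClosure B R F] [Algebra k R] [IsScalarTower k R F]

lemma IsPlaceSystem.exists_place (hv : IsPlaceSystem k v) (w : HeightOneSpectrum B) :
    ∃ P ∈ placesOver R v, v P = w.valuation F := by
  obtain ⟨P, hP⟩ := hv.exists_eq (w.valuation F).valuationSubring
    (by rw [ne_eq, Valuation.valuationSubring_eq_top_iff, not_not]; infer_instance)
    (fun c => by
      rw [Valuation.mem_valuationSubring_iff, IsScalarTower.algebraMap_apply k R F,
        IsScalarTower.algebraMap_apply R B F]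
      exact w.valuation_le_one _)
  have h := Valuation.eq_of_valuationSubring_eq (hv.surjective P) (w.valuation_surjective F) hP
  refine ⟨P, fun r => ?_, h⟩
  rw [h, IsScalarTower.algebraMap_apply R B F]
  exact w.valuation_le_one _

lemma IsPlaceSystem.algebraMap_le_one_of_isIntegral
    {P : ι} (hP : P ∈ placesOver R v) (b : B) : v P (algebraMap B F b) ≤ 1 := by
  have h : IsIntegral R (algebraMap B F b) :=
    (IsIntegralClosure.isIntegral_iff (A := B)).mpr ⟨b, rfl⟩
  obtain ⟨p, hp, h0⟩ := h
  have h1 : IsIntegral (v P).valuationSubring (algebraMap B F b) := by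
    let g : R →+* (v P).valuationSubring :=
      (algebraMap R F).codRestrict (v P).valuationSubring.toSubring fun r => hP r
    refine ⟨p.map g, hp.map g, ?_⟩
    rw [Polynomial.eval₂_map]
    exact h0
  obtain ⟨y, hy⟩ := IsIntegrallyClosed.isIntegral_iff.mp h1
  rw [← hy]
  exact y.2

/-- The prime is the centre of the place on `B`, consisting of the elements of value less than 1.
Its local ring is a discrete valuation ring inside the ring of `P`, and there is no room between
such a ring and `F`. -/
lemma IsPlaceSystem.exists_heightOneSpectrum (hv : IsPlaceSystem k v) {P : ι}
    (hP : P ∈ placesOver R v) : ∃ w : HeightOneSpectrum B, w.valuation F = v P := by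
  have hB : ∀ b : B, v P (algebraMap B F b) ≤ 1 :=
    IsPlaceSystem.algebraMap_le_one_of_isIntegral R B hP
  let p : Ideal B :=
    { carrier := {b | v P (algebraMap B F b) < 1}
      zero_mem' := by simp
      add_mem' := fun {a b} ha hb => by
        simp only [Set.mem_ofPred_eq, map_add] at *
        exact Valuation.map_add_lt _ ha hb
      smul_mem' := fun c x hx => by
        simp only [Set.mem_ofPred_eq, smul_eq_mul, map_mul] at *
        exact lt_of_le_of_lt (mul_le_of_le_one_left' (hB c)) hx }
  have mem_p : ∀ b, b ∈ p ↔ v P (algebraMap B F b) < 1 := fun b => Iff.rfl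
  have hp : p.IsPrime := by
    constructor
    · rw [Ideal.ne_top_iff_one, mem_p]; simp
    · intro a b hab
      rw [mem_p, mem_p]
      rw [mem_p, map_mul, map_mul] at hab
      by_contra! hcon
      exact absurd (mul_le_mul' hcon.1 hcon.2) (by simpa using hab)
  -- With centre zero all nonzero elements of `B` would have value 1, so no fraction could have a
  -- pole at `P`.
  have hp0 : p ≠ ⊥ := by
    intro h0
    obtain ⟨t, ht⟩ := hv.surjective P (exp 1)
    obtain ⟨a, b, hb, rfl⟩ := IsFractionRing.div_surjective (A := B) t
    have hb1 : ¬ v P (algebraMap B F b) < 1 := by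
      rw [← mem_p, h0, Ideal.mem_bot]
      exact nonZeroDivisors.ne_zero hb
    have hb2 : v P (algebraMap B F b) = 1 := le_antisymm (hB b) (not_lt.mp hb1)
    rw [map_div₀, hb2, div_one] at ht
    have := hB a
    rw [ht, ← exp_zero, exp_le_exp] at this
    omega
  let w : HeightOneSpectrum B := ⟨p, hp, hp0⟩
  refine ⟨w, Valuation.eq_of_valuationSubring_eq (w.valuation_surjective F) (hv.surjective P) ?_⟩
  rw [← HeightOneSpectrum.valuationSubringAtPrime_eq_valuationSubring]
  apply ValuationSubring.eq_of_le_of_ne_top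
  · rw [HeightOneSpectrum.valuationSubringAtPrime_eq_valuationSubring]
    intro x hx
    obtain ⟨n, d, hnd⟩ := w.exists_primeCompl_mul_eq_of_integer x hx
    have hd : v P (algebraMap B F d) = 1 := le_antisymm (hB _) (not_lt.mp d.2)
    rw [Valuation.mem_valuationSubring_iff, ← mul_one (v P x), ← hd, ← map_mul, hnd]
    exact (hB n).trans hd.ge
  · rw [ne_eq, Valuation.valuationSubring_eq_top_iff, not_not]
    obtain ⟨t, ht⟩ := hv.surjective P (exp 1)
    exact ⟨t, by rw [ht]; simp, by rw [ht, ← exp_zero]; simp⟩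

end Local

/-! ### Fractional ideals described by their exponents. -/

section FractionalIdeals

variable {B : Type*} [CommRing B] [IsDedekindDomain B] (F : Type*) [Field F] [Algebra B F]
  [IsFractionRing B F]

lemma FractionalIdeal.exp_neg_count_spanSingleton (w : HeightOneSpectrum B) {f : F} (hf : f ≠ 0) :
    exp (-FractionalIdeal.count F w (FractionalIdeal.spanSingleton B⁰ f)) = w.valuation F f := by
  classical
  have main : ∀ b : B, b ≠ 0 → exp (-FractionalIdeal.count F w
      (FractionalIdeal.spanSingleton B⁰ (algebraMap B F b))) = w.valuation F (algebraMap B F b) := by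
    intro b hb
    rw [← FractionalIdeal.coeIdeal_span_singleton, FractionalIdeal.count_coe F w (by simpa using hb),
      HeightOneSpectrum.valuation_of_algebraMap, HeightOneSpectrum.intValuation_if_neg _ hb]
  obtain ⟨a, b, hb, rfl⟩ := IsFractionRing.div_surjective (A := B) f
  have hb0 := nonZeroDivisors.ne_zero hb
  have ha0 : a ≠ 0 := by rintro rfl; simp at hf
  have hb0' : algebraMap B F b ≠ 0 := by simpa using hb0
  have ha0' : algebraMap B F a ≠ 0 := by simpa using ha0
  rw [map_div₀, ← main a ha0, ← main b hb0, div_eq_mul_inv,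
    ← FractionalIdeal.spanSingleton_mul_spanSingleton,
    FractionalIdeal.count_mul F w (FractionalIdeal.spanSingleton_ne_zero_iff.mpr ha0')
      (FractionalIdeal.spanSingleton_ne_zero_iff.mpr (inv_ne_zero hb0')),
    ← FractionalIdeal.spanSingleton_inv, FractionalIdeal.count_inv, ← exp_sub]
  congr 1
  ring

lemma FractionalIdeal.le_one_iff_count_nonneg {I : FractionalIdeal B⁰ F} (hI : I ≠ 0) :
    I ≤ 1 ↔ ∀ w : HeightOneSpectrum B, 0 ≤ FractionalIdeal.count F w I := by
  constructor
  · intro h w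
    have := FractionalIdeal.count_mono F w hI h
    rwa [FractionalIdeal.count_one] at this
  · intro h
    rw [← FractionalIdeal.finprod_heightOneSpectrum_factorization' F hI]
    apply finprod_induction (fun J : FractionalIdeal B⁰ F => J ≤ 1) le_rfl
    · intro a b ha hb
      simpa using mul_le_mul' ha hb
    · intro w
      obtain ⟨n, hn⟩ := Int.eq_ofNat_of_zero_le (h w)
      rw [hn, zpow_natCast, ← FractionalIdeal.coeIdeal_pow]
      exact FractionalIdeal.coeIdeal_le_one

/-- Membership means that (f)I⁻¹ is an integral ideal, which can be tested one prime at a time by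
unique factorization. -/
lemma FractionalIdeal.mem_iff_valuation_le {I : FractionalIdeal B⁰ F} (hI : I ≠ 0) (f : F) :
    f ∈ I ↔ ∀ w : HeightOneSpectrum B,
      w.valuation F f ≤ exp (-FractionalIdeal.count F w I) := by
  rcases eq_or_ne f 0 with rfl | hf
  · simp [FractionalIdeal.zero_mem]
  have hs : FractionalIdeal.spanSingleton B⁰ f ≠ 0 := FractionalIdeal.spanSingleton_ne_zero_iff.mpr hf
  rw [← FractionalIdeal.spanSingleton_le_iff_mem]
  have : FractionalIdeal.spanSingleton B⁰ f ≤ I ↔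
      FractionalIdeal.spanSingleton B⁰ f * I⁻¹ ≤ 1 := by
    constructor
    · intro h
      calc _ ≤ I * I⁻¹ := mul_le_mul_left h _
        _ = 1 := mul_inv_cancel₀ hI
    · intro h
      calc _ = FractionalIdeal.spanSingleton B⁰ f * I⁻¹ * I := by
            rw [inv_mul_cancel_right₀ hI]
        _ ≤ 1 * I := mul_le_mul_left h _
        _ = I := one_mul I
  rw [this, FractionalIdeal.le_one_iff_count_nonneg F (mul_ne_zero hs (inv_ne_zero hI))]
  refine forall_congr' fun w => ?_
  rw [FractionalIdeal.count_mul F w hs (inv_ne_zero hI), FractionalIdeal.count_inv,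
    ← FractionalIdeal.exp_neg_count_spanSingleton F w hf, exp_le_exp]
  constructor <;> intro h <;> linarith

end FractionalIdeals

end

section

open WithZero IsDedekindDomain
open scoped nonZeroDivisors

/-! ### The different in residue characteristic zero. -/

section Different

attribute [local instance] FractionRing.liftAlgebra FractionRing.isScalarTower_liftAlgebra

variable {A B : Type*} [CommRing A] [IsDedekindDomain A] [CommRing B] [IsDedekindDomain B]
  [Algebra A B] [Module.IsTorsionFree A B] [Module.Finite A B]
  [Algebra.IsSeparable (FractionRing A) (FractionRing B)]

/-- An element congruent to 1 modulo `P` and to 0 modulo `Q` has trace congruent to dim B/P modulo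
`p`. This positive integer is nonzero in A/p, so a trace outside `p` excludes `P` from the
different. Here `P` need not be prime; it is applied to a full prime power. -/
theorem not_dvd_differentIdeal_of_isCoprime_of_charZero
    {p : Ideal A} [p.IsMaximal] [CharZero (A ⧸ p)] (P Q : Ideal B) (hPtop : P ≠ ⊤)
    (hPQ : IsCoprime P Q) (hP : P * Q = Ideal.map (algebraMap A B) p) :
    ¬ P ∣ differentIdeal A B := by
  let _ : Field (A ⧸ p) := Ideal.Quotient.field p
  let : Algebra (A ⧸ p) (B ⧸ Q) := Ideal.Quotient.algebraQuotientOfLEComap (by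
      rw [← Ideal.map_le_iff_le_comap, ← hP]
      exact Ideal.mul_le_right (I := P))
  have : IsScalarTower A (A ⧸ p) (B ⧸ Q) := .of_algebraMap_eq' rfl
  have : Module.Finite (A ⧸ p) (B ⧸ Q) :=
    Module.Finite.of_restrictScalars_finite A (A ⧸ p) (B ⧸ Q)
  let : Algebra (A ⧸ p) (B ⧸ P) := Ideal.Quotient.algebraQuotientOfLEComap (by
      rw [← Ideal.map_le_iff_le_comap, ← hP]
      exact Ideal.mul_le_left (I := P))
  have : IsScalarTower A (A ⧸ p) (B ⧸ P) := .of_algebraMap_eq' rfl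
  have : Module.Finite (A ⧸ p) (B ⧸ P) :=
    Module.Finite.of_restrictScalars_finite A (A ⧸ p) (B ⧸ P)
  have : Nontrivial (B ⧸ P) := Ideal.Quotient.nontrivial_iff.mpr hPtop
  let e : (B ⧸ p.map (algebraMap A B)) ≃ₐ[A ⧸ p] ((B ⧸ P) × B ⧸ Q) :=
    { __ := (Ideal.quotEquivOfEq hP.symm).trans (Ideal.quotientMulEquivQuotientProd P Q hPQ),
      commutes' := Quotient.ind fun _ ↦ rfl }
  have hx : Algebra.trace (A ⧸ p) (B ⧸ P) 1 ≠ 0 := by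
    rw [← map_one (algebraMap (A ⧸ p) (B ⧸ P)), Algebra.trace_algebraMap, nsmul_one]
    exact_mod_cast (Module.finrank_pos (R := A ⧸ p) (M := B ⧸ P)).ne'
  obtain ⟨y, hy⟩ := Ideal.Quotient.mk_surjective (e.symm (1, 0))
  refine not_dvd_differentIdeal_of_intTrace_not_mem A P Q hP y ?_ ?_
  · have := congr((e $hy).2)
    simp at this
    simpa [e, Ideal.Quotient.eq_zero_iff_mem] using this
  · rw [← Ideal.Quotient.eq_zero_iff_mem, ← Algebra.trace_quotient_eq_of_isDedekindDomain,
      hy, Algebra.trace_eq_of_algEquiv, Algebra.trace_prod_apply]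
    simpa

/-- The tame case of Dedekind's different theorem. -/
theorem count_differentIdeal_of_charZero (F : Type*) [Field F] [Algebra B F] [IsFractionRing B F]
    (w : HeightOneSpectrum B) {π : A} (hπ : π ≠ 0) [hmax : (Ideal.span {π}).IsMaximal]
    [CharZero (A ⧸ Ideal.span {π})] (hw : algebraMap A B π ∈ w.asIdeal) :
    w.valuation F (algebraMap B F (algebraMap A B π)) =
      exp (-(FractionalIdeal.count F w (differentIdeal A B : FractionalIdeal B⁰ F) + 1)) := by
  classical
  have hπB : algebraMap A B π ≠ 0 := by
    simpa using hπ
  have hpB : (Ideal.span {π}).map (algebraMap A B) ≠ ⊥ := by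
    rw [Ideal.map_span, Set.image_singleton]; simpa using hπB
  have hdiff : differentIdeal A B ≠ ⊥ := differentIdeal_ne_bot
  have hwirr := w.associates_irreducible
  -- The ramification index of `w` over (π).
  set e := (Associates.mk w.asIdeal).count
    (Associates.mk ((Ideal.span {π}).map (algebraMap A B))).factors with he
  have dvd_iff : ∀ (I : Ideal B) (_ : I ≠ ⊥) (n : ℕ),
      w.asIdeal ^ n ∣ I ↔ n ≤ (Associates.mk w.asIdeal).count (Associates.mk I).factors := by
    intro I hI n
    rw [← Associates.mk_le_mk_iff_dvd, Associates.mk_pow,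
      Associates.prime_pow_dvd_iff_le (Associates.mk_ne_zero.mpr hI) hwirr]
  obtain ⟨Q, hQ⟩ := (dvd_iff _ hpB e).mpr le_rfl
  have hQw : ¬ Q ≤ w.asIdeal := by
    intro hle
    have : w.asIdeal ^ (e + 1) ∣ (Ideal.span {π}).map (algebraMap A B) := by
      rw [hQ, pow_succ]
      exact mul_dvd_mul_left _ (Ideal.dvd_iff_le.mpr hle)
    have := (dvd_iff _ hpB _).mp this
    omega
  have hmaxw : w.asIdeal.IsMaximal := w.isMaximal
  have hcop : IsCoprime (w.asIdeal ^ e) Q := by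
    apply IsCoprime.pow_left
    rw [Ideal.isCoprime_iff_sup_eq]
    by_contra hne
    have h1 := hmaxw.eq_of_le hne le_sup_left
    exact hQw (h1 ▸ le_sup_right)
  have he1 : 1 ≤ e := by
    rw [he, ← dvd_iff _ hpB, pow_one, Ideal.dvd_iff_le, Ideal.map_span, Set.image_singleton,
      Ideal.span_singleton_le_iff_mem]
    exact hw
  -- The exponent of `w` in the different is squeezed to e - 1. Characteristic zero of the residue
  -- field enters only in the upper bound `h2`.
  have h1 : w.asIdeal ^ (e - 1) ∣ differentIdeal A B :=
    pow_sub_one_dvd_differentIdeal (A := A) (p := Ideal.span {π}) w.asIdeal e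
      (by simpa using hπ) ⟨Q, hQ⟩
  have h2 : ¬ w.asIdeal ^ e ∣ differentIdeal A B :=
    not_dvd_differentIdeal_of_isCoprime_of_charZero (p := Ideal.span {π}) (w.asIdeal ^ e) Q
      (fun h => by
        have := Ideal.pow_le_self (I := w.asIdeal) (n := e) (by omega)
        rw [h, top_le_iff] at this
        exact hmaxw.ne_top this)
      hcop hQ.symm
  rw [dvd_iff _ hdiff] at h1 h2
  rw [FractionalIdeal.count_coe F w hdiff, HeightOneSpectrum.valuation_of_algebraMap,
    HeightOneSpectrum.intValuation_if_neg _ hπB]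
  rw [Ideal.map_span, Set.image_singleton] at he
  rw [← he]
  congr 2
  omega

end Different

/-! ### From divisors to fractional ideals. -/

section DivisorIdeal

set_option linter.unusedSectionVars false

variable {k F : Type*} [Field k] [Field F] [Algebra k F]
variable {ι : Type*} {v : ι → Valuation F ℤᵐ⁰} (hv : IsPlaceSystem k v)
variable (R B : Type*) [CommRing R] [Algebra R F] [CommRing B] [IsDedekindDomain B]
  [Algebra B F] [IsFractionRing B F] [Algebra R B] [IsScalarTower R B F]
  [IsIntegralClosure B R F] [Algebra k R] [IsScalarTower k R F]

/-- The place of `F` attached to a prime of `B`. -/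
noncomputable def placeOfPrime (w : HeightOneSpectrum B) : ι := (hv.exists_place R B w).choose

lemma placeOfPrime_mem (w : HeightOneSpectrum B) : placeOfPrime hv R B w ∈ placesOver R v :=
  (hv.exists_place R B w).choose_spec.1

lemma valuation_placeOfPrime (w : HeightOneSpectrum B) :
    v (placeOfPrime hv R B w) = w.valuation F :=
  (hv.exists_place R B w).choose_spec.2

lemma placeOfPrime_injective : Function.Injective (placeOfPrime hv R B) := by
  intro w w' h
  apply HeightOneSpectrum.eq_of_valuation_isEquiv_valuation (K := F)
  rw [← valuation_placeOfPrime hv R B w, ← valuation_placeOfPrime hv R B w', h]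

lemma forall_placesOver_iff {p : ι → Prop} :
    (∀ P ∈ placesOver R v, p P) ↔ ∀ w : HeightOneSpectrum B, p (placeOfPrime hv R B w) := by
  refine ⟨fun h w => h _ (placeOfPrime_mem hv R B w), fun h P hP => ?_⟩
  obtain ⟨w, hw⟩ := hv.exists_heightOneSpectrum R B hP
  have : placeOfPrime hv R B w = P := by
    apply hv.injective
    rw [valuation_placeOfPrime hv R B, hw]
  exact this ▸ h w

lemma mem_boundedPoles_placesOver_iff {d : ι → ℤ} {f : F} :
    f ∈ boundedPoles hv (placesOver R v) d ↔
      ∀ w : HeightOneSpectrum B, w.valuation F f ≤ exp (d (placeOfPrime hv R B w)) := by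
  rw [mem_boundedPoles, forall_placesOver_iff hv R B (p := fun P => v P f ≤ exp (d P))]
  simp_rw [valuation_placeOfPrime]

/-- The fractional ideal of functions with poles bounded by a divisor. -/
noncomputable def divisorIdeal (D : ι →₀ ℤ) : FractionalIdeal B⁰ F :=
  -- Poles bounded by `D` mean exponents at least `-D`, hence the sign. Places not lying over `R`
  -- are dropped.
  ((-D).comapDomain (placeOfPrime hv R B) (placeOfPrime_injective hv R B).injOn).prod
    fun w n => (w.asIdeal : FractionalIdeal B⁰ F) ^ n

lemma divisorIdeal_ne_zero (D : ι →₀ ℤ) : divisorIdeal hv R B D ≠ 0 := by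
  rw [divisorIdeal, Finsupp.prod]
  exact Finset.prod_ne_zero_iff.mpr fun w _ =>
    zpow_ne_zero _ (FractionalIdeal.coeIdeal_ne_zero.mpr w.ne_bot)

lemma count_divisorIdeal (D : ι →₀ ℤ) (w : HeightOneSpectrum B) :
    FractionalIdeal.count F w (divisorIdeal hv R B D) = -D (placeOfPrime hv R B w) := by
  rw [divisorIdeal, FractionalIdeal.count_finsuppProd]
  simp

lemma mem_divisorIdeal {D : ι →₀ ℤ} {f : F} :
    f ∈ divisorIdeal hv R B D ↔ f ∈ boundedPoles hv (placesOver R v) D := by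
  rw [FractionalIdeal.mem_iff_valuation_le F (divisorIdeal_ne_zero hv R B D),
    mem_boundedPoles_placesOver_iff hv R B]
  simp_rw [count_divisorIdeal, neg_neg]

end DivisorIdeal

/-! ### Trace duality for functions with bounded poles. -/

section Dual

attribute [local instance] FractionRing.liftAlgebra FractionRing.isScalarTower_liftAlgebra

variable {k F : Type*} [Field k] [Field F] [Algebra k F]
variable {ι : Type*} {v : ι → Valuation F ℤᵐ⁰} (hv : IsPlaceSystem k v)
variable (R E : Type*) [CommRing R] [IsDedekindDomain R] [Algebra R F] [Algebra k R]
  [IsScalarTower k R F] [Field E] [Algebra R E] [IsFractionRing R E]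
  [Algebra E F] [IsScalarTower R E F] [FiniteDimensional E F] [CharZero E]

/-- Otherwise the fractional ideal of D + P would lie in that of D, although its exponent at the
prime of P is smaller by one. -/
lemma exists_mem_boundedPoles_single [Algebra.IsSeparable E F] (D : ι →₀ ℤ) {P : ι}
    (hP : P ∈ placesOver R v) :
    ∃ f ∈ boundedPoles hv (placesOver R v) (D + Finsupp.single P 1 : ι →₀ ℤ),
      f ∉ boundedPoles hv (placesOver R v) D := by
  have : IsDedekindDomain (integralClosure R F) := integralClosure.isDedekindDomain R E F
  have : IsFractionRing (integralClosure R F) F :=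
    integralClosure.isFractionRing_of_finite_extension E F
  let B := integralClosure R F
  by_contra! h
  have hle : divisorIdeal hv R B (D + Finsupp.single P 1) ≤ divisorIdeal hv R B D := by
    intro f hf
    exact (mem_divisorIdeal hv R B).mpr (h f ((mem_divisorIdeal hv R B).mp hf))
  obtain ⟨w, hw⟩ := hv.exists_heightOneSpectrum R B hP
  have hwP : placeOfPrime hv R B w = P := by
    apply hv.injective
    rw [valuation_placeOfPrime hv R B, hw]
  have := FractionalIdeal.count_mono F w (divisorIdeal_ne_zero hv R B _) hle
  rw [count_divisorIdeal, count_divisorIdeal, hwP] at this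
  simp at this

/-- The trace dual of the functions with poles bounded by `D`. -/
theorem forall_trace_mem_range_iff {δ : ι → ℤ}
    (hδ : ∀ P ∈ placesOver R v, ∃ π : R, π ≠ 0 ∧ (Ideal.span {π}).IsMaximal ∧
      v P (algebraMap R F π) = exp (-(δ P + 1)) ∧ v P (algebraMap R F π) < 1)
    [CharZero k] (D : ι →₀ ℤ) (f : F) :
    f ∈ boundedPoles hv (placesOver R v) (δ - D) ↔
      ∀ g ∈ boundedPoles hv (placesOver R v) D,
        Algebra.trace E F (f * g) ∈ (algebraMap R E).range := by
  have : IsDedekindDomain (integralClosure R F) := integralClosure.isDedekindDomain R E F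
  have : IsFractionRing (integralClosure R F) F :=
    integralClosure.isFractionRing_of_finite_extension E F
  let B := integralClosure R F
  have : Module.Finite R B := IsIntegralClosure.finite R E F B
  have hinjRE := IsFractionRing.injective R E
  have hRF : Function.Injective (algebraMap R F) := by
    rw [IsScalarTower.algebraMap_eq R E F]
    exact (algebraMap E F).injective.comp hinjRE
  have hRB : Function.Injective (algebraMap R B) := by
    rw [IsScalarTower.algebraMap_eq R B F, RingHom.coe_comp] at hRF
    exact Function.Injective.of_comp hRF
  have : Module.IsTorsionFree R B := Module.isTorsionFree_iff_algebraMap_injective.mpr hRB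
  have : CharZero (FractionRing R) := by
    have : CharZero R := ⟨fun a b hab => by
      have : (algebraMap R E) a = algebraMap R E b := by simpa using congrArg (algebraMap R E) hab
      simpa using this⟩
    exact charZero_of_injective_algebraMap (IsFractionRing.injective R (FractionRing R))
  have : Algebra.IsSeparable (FractionRing R) (FractionRing B) := inferInstance
  have h1 : f ∈ FractionalIdeal.dual R E (divisorIdeal hv R B D) ↔
      ∀ g ∈ boundedPoles hv (placesOver R v) D,
        Algebra.trace E F (f * g) ∈ (algebraMap R E).range := by
    rw [FractionalIdeal.mem_dual (divisorIdeal_ne_zero hv R B D)]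
    simp_rw [mem_divisorIdeal hv R B]
    rfl
  rw [← h1, FractionalIdeal.mem_iff_valuation_le F
      (FractionalIdeal.dual_ne_zero R E (divisorIdeal_ne_zero hv R B D)),
    mem_boundedPoles_placesOver_iff hv R B]
  refine forall_congr' fun w => ?_
  have hd : FractionalIdeal.dual R E (1 : FractionalIdeal B⁰ F) ≠ 0 :=
    FractionalIdeal.dual_ne_zero R E one_ne_zero
  obtain ⟨π, hπ0, hπmax, hπ, hlt⟩ := hδ _ (placeOfPrime_mem hv R B w)
  rw [valuation_placeOfPrime hv R B, IsScalarTower.algebraMap_apply R B F] at hπ hlt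
  have hπw : algebraMap R B π ∈ w.asIdeal := by
    rwa [HeightOneSpectrum.valuation_lt_one_iff_mem] at hlt
  have : CharZero (R ⧸ Ideal.span {π}) := by
    have : Nontrivial (R ⧸ Ideal.span {π}) := Ideal.Quotient.nontrivial_iff.mpr hπmax.ne_top
    exact charZero_of_injective_algebraMap (algebraMap k (R ⧸ Ideal.span {π})).injective
  -- The hypothesis gives `π` the order δ + 1 at `w`, so the tame formula makes δ the exponent of
  -- `w` in the different.
  have hcount := count_differentIdeal_of_charZero F w hπ0 hπw
  rw [hcount, exp_inj, neg_inj, add_left_inj] at hπ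
  -- The dual of I is I⁻¹ times the inverse different; with I of exponent -D, its exponent is D - δ.
  rw [FractionalIdeal.dual_eq_mul_inv, FractionalIdeal.count_mul F w hd
    (inv_ne_zero (divisorIdeal_ne_zero hv R B D)), FractionalIdeal.count_inv, count_divisorIdeal,
    ← inv_inv (FractionalIdeal.dual R E (1 : FractionalIdeal B⁰ F)),
    ← coeIdeal_differentIdeal R E F B, FractionalIdeal.count_inv, hπ]
  simp only [Pi.sub_apply]
  rw [show -(-δ (placeOfPrime hv R B w) + - -D (placeOfPrime hv R B w)) =
    δ (placeOfPrime hv R B w) - D (placeOfPrime hv R B w) by ring]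

end Dual

end

section

open WithZero IsDedekindDomain Polynomial
open scoped nonZeroDivisors LaurentSeries

/-! ### Expansions and residues at infinity on the projective line. -/

section Infinity

variable (k : Type*) [Field k]

lemma aeval_single_neg_one_coeff (p : k[X]) (n : ℤ) :
    (aeval (HahnSeries.single (-1 : ℤ) (1 : k)) p).coeff n =
      if n ≤ 0 then p.coeff (-n).toNat else 0 := by
  induction p using Polynomial.induction_on' with
  | add p q hp hq =>
    rw [map_add, HahnSeries.coeff_add, hp, hq]
    split_ifs <;> simp
  | monomial i a =>
    rw [aeval_monomial, HahnSeries.single_pow, one_pow, LaurentSeries.algebraMap_apply,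
      HahnSeries.C_apply, HahnSeries.single_mul_single, HahnSeries.coeff_single, coeff_monomial]
    split_ifs with h1 h2 h3 h3 <;> simp at * <;> omega

lemma aeval_single_neg_one_injective :
    Function.Injective (aeval (R := k) (HahnSeries.single (-1 : ℤ) (1 : k))) := by
  rw [injective_iff_map_eq_zero]
  intro p hp
  ext n
  have := aeval_single_neg_one_coeff k p (-n)
  rw [hp] at this
  simpa using this.symm

/-- Expansion of a rational function at infinity as a Laurent series in `X⁻¹`. -/
noncomputable def expandInfty : RatFunc k →ₐ[k] k⸨X⸩ :=
  IsFractionRing.liftAlgHom (A := k[X]) (aeval_single_neg_one_injective k)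

lemma expandInfty_algebraMap (p : k[X]) :
    expandInfty k (algebraMap k[X] (RatFunc k) p) = aeval (HahnSeries.single (-1 : ℤ) (1 : k)) p := by
  simp [expandInfty]

/-- The coefficient of `X⁻ⁿ` in the expansion of a rational function at infinity. -/
noncomputable def coeffInfty (n : ℤ) : RatFunc k →ₗ[k] k where
  toFun f := (expandInfty k f).coeff n
  map_add' := by simp
  map_smul' c f := by
    rw [Algebra.smul_def, map_mul, AlgHom.commutes, LaurentSeries.algebraMap_apply,
      HahnSeries.C_apply, HahnSeries.coeff_single_zero_mul]
    rfl

variable {k}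

lemma coeffInfty_algebraMap (p : k[X]) (n : ℤ) :
    coeffInfty k n (algebraMap k[X] (RatFunc k) p) = if n ≤ 0 then p.coeff (-n).toNat else 0 := by
  rw [← aeval_single_neg_one_coeff, ← expandInfty_algebraMap]
  rfl

lemma expandInfty_X_zpow (i : ℤ) :
    expandInfty k (RatFunc.X ^ i) = HahnSeries.single (-i) 1 := by
  have h1 : expandInfty k RatFunc.X = HahnSeries.single (-1 : ℤ) (1 : k) := by
    rw [← RatFunc.algebraMap_X, expandInfty_algebraMap, aeval_X]
  have h2 : HahnSeries.single (-1 : ℤ) (1 : k) = (HahnSeries.single (1 : ℤ) (1 : k))⁻¹ := by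
    rw [eq_comm]
    apply inv_eq_of_mul_eq_one_left
    rw [HahnSeries.single_mul_single]
    simp
  rw [map_zpow₀, h1, h2, inv_zpow', ← RatFunc.single_zpow]

lemma coeffInfty_X_zpow_mul (n i : ℤ) (f : RatFunc k) :
    coeffInfty k n (RatFunc.X ^ i * f) = coeffInfty k (n + i) f := by
  change (expandInfty k (RatFunc.X ^ i * f)).coeff n = (expandInfty k f).coeff (n + i)
  rw [map_mul, expandInfty_X_zpow, HahnSeries.coeff_single_mul, one_mul, sub_neg_eq_add]

lemma eq_zero_of_coeffInfty {f : RatFunc k} (h : ∀ n, coeffInfty k n f = 0) : f = 0 := by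
  apply (expandInfty k).injective
  rw [map_zero]
  ext n
  exact h n

variable (k)

/-- The valuation of `k(X)` at infinity. -/
noncomputable def valInfty : Valuation (RatFunc k) ℤᵐ⁰ :=
  (Valued.v : Valuation k⸨X⸩ ℤᵐ⁰).comap (expandInfty k : RatFunc k →+* k⸨X⸩)

variable {k}

lemma valInfty_le_exp_iff {f : RatFunc k} {D : ℤ} :
    valInfty k f ≤ exp (-D) ↔ ∀ n < D, coeffInfty k n f = 0 :=
  LaurentSeries.valuation_le_iff_coeff_lt_eq_zero k

lemma valInfty_X_zpow (i : ℤ) : valInfty k (RatFunc.X ^ i) = exp i := by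
  change Valued.v (expandInfty k (RatFunc.X ^ i)) = _
  have := LaurentSeries.valuation_single_zpow k (-i)
  rw [neg_neg] at this
  rw [expandInfty_X_zpow, this]

lemma valInfty_X : valInfty k RatFunc.X = exp 1 := by
  simpa using valInfty_X_zpow (k := k) 1

lemma valInfty_surjective : Function.Surjective (valInfty k) := by
  intro x
  rcases eq_or_ne x 0 with rfl | hx
  · exact ⟨0, map_zero _⟩
  · exact ⟨RatFunc.X ^ log x, by rw [valInfty_X_zpow, exp_log hx]⟩

instance : (valInfty k).IsNontrivial := by
  obtain ⟨x, hx⟩ := valInfty_surjective (k := k) (exp 1)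
  exact ⟨x, by rw [hx]; simp, by rw [hx, ← exp_zero]; simp⟩

lemma valInfty_algebraMap_le_one (c : k) : valInfty k (algebraMap k (RatFunc k) c) ≤ 1 := by
  have h : algebraMap k (RatFunc k) c = algebraMap k[X] (RatFunc k) (C c) := by
    rw [IsScalarTower.algebraMap_apply k k[X] (RatFunc k)]; rfl
  rw [← exp_zero, ← neg_zero, valInfty_le_exp_iff]
  intro n hn
  rw [h, coeffInfty_algebraMap, if_pos hn.le, coeff_C, if_neg (by omega)]

variable (k) in
/-- The local ring of the projective line at infinity. -/
abbrev RegularInfty : Type _ := (valInfty k).valuationSubring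

noncomputable instance : Algebra k (RegularInfty k) :=
  RingHom.toAlgebra ((algebraMap k (RatFunc k)).codRestrict (valInfty k).valuationSubring.toSubring
    valInfty_algebraMap_le_one)

instance : IsScalarTower k (RegularInfty k) (RatFunc k) := IsScalarTower.of_algebraMap_eq' rfl

instance : IsDiscreteValuationRing (RegularInfty k) := inferInstance

lemma isTrivialOn_of_le_one {F : Type*} [Field F] [Algebra k F] {v : Valuation F ℤᵐ⁰}
    (h : ∀ c : k, v (algebraMap k F c) ≤ 1) : v.IsTrivialOn k := by
  constructor
  intro c hc
  apply le_antisymm (h c)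
  have := h c⁻¹
  rw [map_inv₀, map_inv₀] at this
  have h0 : v (algebraMap k F c) ≠ 0 := by simpa using hc
  exact (inv_le_one₀ (zero_lt_iff.mpr h0)).mp this

instance : (valInfty k).IsTrivialOn k := isTrivialOn_of_le_one valInfty_algebraMap_le_one

lemma exists_valInfty_lt (f : RatFunc k) : ∃ N : ℕ, valInfty k f ≤ exp (N : ℤ) := by
  rcases eq_or_ne (valInfty k f) 0 with h | h
  · exact ⟨0, by simp [h]⟩
  · refine ⟨(log (valInfty k f)).toNat, ?_⟩
    rw [← exp_log h, exp_le_exp, log_exp]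
    exact Int.self_le_toNat _

/-- A rational function is determined up to order `N` by finitely many coefficients. -/
lemma valInfty_sub_sum_le (f : RatFunc k) (M N : ℕ) (hf : valInfty k f ≤ exp (M : ℤ)) :
    valInfty k (f - ∑ i ∈ Finset.Ico (-M : ℤ) N,
      algebraMap k (RatFunc k) (coeffInfty k i f) * RatFunc.X ^ (-i)) ≤ exp (-N : ℤ) := by
  rw [valInfty_le_exp_iff]
  intro n hn
  have h1 : ∀ i : ℤ, coeffInfty k n (algebraMap k (RatFunc k) (coeffInfty k i f) *
      RatFunc.X ^ (-i)) = if i = n then coeffInfty k n f else 0 := by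
    intro i
    rw [← Algebra.smul_def, map_smul, ← mul_one (RatFunc.X ^ (-i)), coeffInfty_X_zpow_mul,
      ← map_one (algebraMap k[X] (RatFunc k)), coeffInfty_algebraMap, coeff_one, smul_eq_mul]
    split_ifs <;> first | omega | simp_all
  rw [map_sub, map_sum, Finset.sum_congr rfl fun i _ => h1 i, Finset.sum_ite_eq']
  split_ifs with h2
  · simp
  · rw [sub_zero]
    rw [← neg_neg (M : ℤ), valInfty_le_exp_iff] at hf
    apply hf
    simp at h2
    omega

lemma coeffInfty_one_algebraMap (p : k[X]) :
    coeffInfty k 1 (algebraMap k[X] (RatFunc k) p) = 0 := by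
  rw [coeffInfty_algebraMap, if_neg (by norm_num)]

lemma sum_mul_X_zpow_mem_range (c : ℤ → k) (s : Finset ℤ) (hs : ∀ i ∈ s, 0 ≤ i) :
    ∑ i ∈ s, algebraMap k (RatFunc k) (c i) * RatFunc.X ^ i ∈ (algebraMap k[X] (RatFunc k)).range := by
  refine Subring.sum_mem _ fun i hi => ?_
  obtain ⟨j, rfl⟩ := Int.eq_ofNat_of_zero_le (hs i hi)
  refine ⟨C (c j) * X ^ j, ?_⟩
  rw [map_mul, map_pow, RatFunc.algebraMap_X, RatFunc.algebraMap_C, zpow_natCast]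
  rfl

/-- The polynomials are the annihilator of the polynomials under the residue pairing. -/
lemma mem_range_of_coeffInfty_mul {y : RatFunc k}
    (h : ∀ p : k[X], coeffInfty k 1 (y * algebraMap k[X] (RatFunc k) p) = 0) :
    y ∈ (algebraMap k[X] (RatFunc k)).range := by
  -- Pairing with X^(n-1) reads off the coefficient of X⁻ⁿ, so the expansion of `y` contains no
  -- negative power of X.
  have h1 : ∀ n : ℤ, 0 < n → coeffInfty k n y = 0 := by
    intro n hn
    have := h (X ^ (n - 1).toNat)
    rw [map_pow, RatFunc.algebraMap_X, mul_comm, ← zpow_natCast, coeffInfty_X_zpow_mul] at this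
    rwa [show (1 : ℤ) + ((n - 1).toNat : ℤ) = n by omega] at this
  obtain ⟨M, hM⟩ := exists_valInfty_lt y
  have h2 : y = ∑ i ∈ Finset.Ico (-M : ℤ) 1,
      algebraMap k (RatFunc k) (coeffInfty k i y) * RatFunc.X ^ (-i) := by
    rw [← sub_eq_zero]
    apply eq_zero_of_coeffInfty
    intro n
    -- The cut-off exceeds n, so that coefficient n is controlled, and is at least 1, so that the
    -- sum contains every term that can be nonzero.
    have hle := valInfty_sub_sum_le y M (max 1 (n + 1).toNat) hM
    have hs : ∑ i ∈ Finset.Ico (-M : ℤ) (max 1 (n + 1).toNat : ℕ),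
          algebraMap k (RatFunc k) (coeffInfty k i y) * RatFunc.X ^ (-i) =
        ∑ i ∈ Finset.Ico (-M : ℤ) 1,
          algebraMap k (RatFunc k) (coeffInfty k i y) * RatFunc.X ^ (-i) := by
      symm
      apply Finset.sum_subset
      · intro i hi
        simp only [Finset.mem_Ico] at hi ⊢
        omega
      · intro i hi hi'
        simp only [Finset.mem_Ico] at hi hi'
        rw [h1 i (by omega)]
        simp
    rw [hs, valInfty_le_exp_iff] at hle
    apply hle
    omega
  rw [h2]
  have := sum_mul_X_zpow_mem_range (fun i => coeffInfty k (-i) y)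
    ((Finset.Ico (-M : ℤ) 1).image Neg.neg) (by intro i hi; simp at hi; omega)
  rw [Finset.sum_image (by intro a _ b _ hab; simpa using hab)] at this
  simpa using this

/-- With s = X⁻¹ one has dX = -s⁻² ds, so the hypothesis says that y dX is regular at infinity, and
a regular differential has no residue. -/
lemma coeffInfty_one_of_valInfty_le {y : RatFunc k} (h : valInfty k (RatFunc.X ^ (2 : ℤ) * y) ≤ 1) :
    coeffInfty k 1 y = 0 := by
  rw [← exp_zero, ← neg_zero, valInfty_le_exp_iff] at h
  have := h (-1) (by norm_num)
  rwa [coeffInfty_X_zpow_mul] at this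

lemma valInfty_le_of_coeffInfty_mul {y : RatFunc k}
    (h : ∀ g, valInfty k g ≤ 1 → coeffInfty k 1 (y * g) = 0) :
    valInfty k (RatFunc.X ^ (2 : ℤ) * y) ≤ 1 := by
  rw [← exp_zero, ← neg_zero, valInfty_le_exp_iff]
  intro n hn
  rw [coeffInfty_X_zpow_mul]
  have := h (RatFunc.X ^ (n + 1)) (by rw [valInfty_X_zpow, ← exp_zero, exp_le_exp]; omega)
  rw [mul_comm, coeffInfty_X_zpow_mul] at this
  rwa [show (1 : ℤ) + (n + 1) = n + 2 by ring] at this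

/-- Functionals on `k(X)` vanishing on polynomials and near infinity are given by the residue
pairing with a polynomial. -/
lemma exists_polynomial_of_functional (μ : RatFunc k →ₗ[k] k) (N : ℕ)
    (h1 : ∀ p : k[X], μ (algebraMap k[X] (RatFunc k) p) = 0)
    (h2 : ∀ f, valInfty k f ≤ exp (-N : ℤ) → μ f = 0) :
    ∃ p : RatFunc k, ∀ f, μ f = coeffInfty k 1 (p * f) := by
  -- The functional is determined by its values on X⁻ⁱ for 1 ≤ i < N: lower i give polynomials, and
  -- the tail of the expansion is killed. Multiplying f by X^(i-1) moves its coefficient of X⁻ⁱ to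
  -- the residue position.
  refine ⟨∑ i ∈ Finset.Ico (1 : ℤ) N,
    algebraMap k (RatFunc k) (μ (RatFunc.X ^ (-i))) * RatFunc.X ^ (i - 1), fun f => ?_⟩
  obtain ⟨M, hM⟩ := exists_valInfty_lt f
  have h3 := h2 _ (valInfty_sub_sum_le f M N hM)
  rw [map_sub, sub_eq_zero, map_sum] at h3
  rw [h3, Finset.sum_mul, map_sum]
  symm
  trans ∑ i ∈ Finset.Ico (1 : ℤ) N, coeffInfty k i f * μ (RatFunc.X ^ (-i))
  · refine Finset.sum_congr rfl fun i _ => ?_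
    rw [mul_assoc, ← Algebra.smul_def, map_smul, coeffInfty_X_zpow_mul, smul_eq_mul, mul_comm,
      add_sub_cancel]
  · simp_rw [← Algebra.smul_def, map_smul, smul_eq_mul]
    apply Finset.sum_subset
    · intro i hi
      simp only [Finset.mem_Ico] at hi ⊢
      omega
    · intro i hi hi'
      simp only [Finset.mem_Ico] at hi hi'
      have : (RatFunc.X : RatFunc k) ^ (-i) =
          algebraMap k[X] (RatFunc k) (X ^ (-i).toNat) := by
        rw [map_pow, RatFunc.algebraMap_X, ← zpow_natCast]
        congr 1
        omega
      rw [this, h1, mul_zero]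

end Infinity

end

section

open WithZero IsDedekindDomain Polynomial
open scoped nonZeroDivisors

/-! ### Euler characteristics of pairs of subspaces. -/

section LinearAlgebra

variable {k V : Type*} [Field k] [AddCommGroup V] [Module k V]

lemma Submodule.finrank_sup_span_singleton_of_finite {A : Submodule k V} [FiniteDimensional k A]
    {f : V} (hf : f ∉ A) : Module.finrank k ↥(A ⊔ k ∙ f) = Module.finrank k A + 1 := by
  have h0 : f ≠ 0 := by rintro rfl; exact hf A.zero_mem
  have h := Submodule.finrank_sup_add_finrank_inf_eq A (k ∙ f)
  have hinf : A ⊓ k ∙ f = ⊥ := by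
    rw [← disjoint_iff, Submodule.disjoint_span_singleton]
    intro hA
    exact absurd hA hf
  rw [hinf, finrank_bot, finrank_span_singleton h0] at h
  omega

lemma Submodule.finrank_quotient_sup_span_singleton {U : Submodule k V}
    [FiniteDimensional k (V ⧸ U)] {f : V} (hf : f ∉ U) :
    Module.finrank k (V ⧸ U) = Module.finrank k (V ⧸ (U ⊔ k ∙ f)) + 1 := by
  rw [← (Submodule.quotientQuotientEquivQuotientSup U (k ∙ f)).finrank_eq,
    ← Submodule.finrank_quotient_add_finrank ((k ∙ f).map U.mkQ), Submodule.map_span,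
    Set.image_singleton, finrank_span_singleton]
  simpa using hf

/-- Enlarging one of two subspaces by one dimension changes the Euler characteristic by one. -/
lemma Submodule.finrank_inf_add_finrank_quotient {A B : Submodule k V} {f : V} (hf : f ∉ A)
    [FiniteDimensional k ↥(A ⊓ B)] [FiniteDimensional k (V ⧸ (A ⊔ B))] :
    Module.finrank k ↥((A ⊔ k ∙ f) ⊓ B) + Module.finrank k (V ⧸ (A ⊔ B)) =
      Module.finrank k ↥(A ⊓ B) + Module.finrank k (V ⧸ ((A ⊔ k ∙ f) ⊔ B)) + 1 := by
  -- If f = a + b, the intersection gains b and the sum is unchanged; otherwise the intersection is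
  -- unchanged and the quotient loses one dimension.
  by_cases h : f ∈ A ⊔ B
  · obtain ⟨a, ha, b, hb, rfl⟩ := Submodule.mem_sup.mp h
    have hbA : b ∉ A := fun hbA => hf (A.add_mem ha hbA)
    have h1 : (A ⊔ k ∙ (a + b)) ⊓ B = (A ⊓ B) ⊔ k ∙ b := by
      apply le_antisymm
      · rintro x ⟨hx, hxB⟩
        obtain ⟨a', ha', y, hy, rfl⟩ := Submodule.mem_sup.mp hx
        obtain ⟨c, rfl⟩ := Submodule.mem_span_singleton.mp hy
        refine Submodule.mem_sup.mpr ⟨a' + c • a, ⟨A.add_mem ha' (A.smul_mem c ha), ?_⟩, c • b,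
          Submodule.mem_span_singleton.mpr ⟨c, rfl⟩, by module⟩
        have := B.sub_mem hxB (B.smul_mem c hb)
        convert! this using 1
        module
      · refine sup_le (inf_le_inf_right _ le_sup_left) ?_
        rw [Submodule.span_singleton_le_iff_mem]
        refine ⟨?_, hb⟩
        have h2 : b = -a + (a + b) := by abel
        have h3 := Submodule.add_mem_sup (A.neg_mem ha) (Submodule.mem_span_singleton_self (R := k) (a + b))
        rwa [← h2] at h3
    have h2 : (A ⊔ k ∙ (a + b)) ⊔ B = A ⊔ B := by
      rw [sup_right_comm]
      exact sup_eq_left.mpr ((Submodule.span_singleton_le_iff_mem _ _).mpr h)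
    rw [h1, h2, Submodule.finrank_sup_span_singleton_of_finite (fun hb' => hbA (Submodule.mem_inf.mp hb').1)]
    omega
  · have h1 : (A ⊔ k ∙ f) ⊓ B = A ⊓ B := by
      apply le_antisymm
      · rintro x ⟨hx, hxB⟩
        obtain ⟨a', ha', y, hy, rfl⟩ := Submodule.mem_sup.mp hx
        obtain ⟨c, rfl⟩ := Submodule.mem_span_singleton.mp hy
        rcases eq_or_ne c 0 with rfl | hc
        · simp only [zero_smul, add_zero] at hxB ⊢
          exact ⟨ha', hxB⟩
        · exfalso
          apply h
          have h2 : f = c⁻¹ • (-a') + c⁻¹ • (a' + c • f) := by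
            rw [← smul_add, neg_add_cancel_left, inv_smul_smul₀ hc]
          rw [h2]
          exact Submodule.add_mem_sup (A.smul_mem _ (A.neg_mem ha')) (B.smul_mem _ hxB)
      · exact inf_le_inf_right _ le_sup_left
    rw [h1, sup_right_comm, Submodule.finrank_quotient_sup_span_singleton h]
    omega

lemma Finsupp.int_induction {ι : Type*} {p : (ι →₀ ℤ) → Prop} (D : ι →₀ ℤ) (h0 : p 0)
    (hadd : ∀ D P, p D → p (D + Finsupp.single P 1))
    (hsub : ∀ D P, p (D + Finsupp.single P 1) → p D) : p D := by
  have key : ∀ (D : ι →₀ ℤ) (P : ι) (n : ℤ), p D → p (D + Finsupp.single P n) := by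
    intro D P n hD
    induction n using Int.induction_on with
    | zero => simpa using hD
    | succ n ihn =>
      rw [Finsupp.single_add, ← add_assoc]
      exact hadd _ _ ihn
    | pred n ihn =>
      apply hsub _ P
      rwa [add_assoc, ← Finsupp.single_add, sub_add_cancel]
  induction D using Finsupp.induction with
  | zero => exact h0
  | single_add P n D _ _ ih =>
    rw [add_comm]
    exact key D P n ih

end LinearAlgebra

/-! ### Adding one point to a divisor. -/

section RiemannRoch

variable {k F : Type*} [Field k] [Field F] [Algebra k F]
variable {ι : Type*} {v : ι → Valuation F ℤᵐ⁰} (hv : IsPlaceSystem k v)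

lemma boundedPoles_union (S T : Set ι) (d : ι → ℤ) :
    boundedPoles hv (S ∪ T) d = boundedPoles hv S d ⊓ boundedPoles hv T d := by
  ext f
  simp only [mem_boundedPoles, Submodule.mem_inf, Set.mem_union, or_imp, forall_and]

lemma boundedPoles_mono (S : Set ι) {d e : ι → ℤ} (h : ∀ P ∈ S, d P ≤ e P) :
    boundedPoles hv S d ≤ boundedPoles hv S e :=
  fun _ hf P hP => (hf P hP).trans (exp_le_exp.mpr (h P hP))

lemma boundedPoles_add_single_of_notMem (S : Set ι) (D : ι →₀ ℤ) {P : ι} (hP : P ∉ S) :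
    boundedPoles hv S (D + Finsupp.single P 1 : ι →₀ ℤ) = boundedPoles hv S D := by
  classical
  ext f
  refine forall₂_congr fun Q hQ => ?_
  rw [Finsupp.add_apply, Finsupp.single_apply, if_neg (by rintro rfl; exact hP hQ), add_zero]

/-- The residue field at `P` is k: subtracting c f from g, with c the residue of g/f, lowers the
pole of g at `P`. Hence one extra pole order costs one dimension. -/
lemma boundedPoles_add_single (S : Set ι) (D : ι →₀ ℤ) {P : ι} (hP : P ∈ S) {f : F}
    (hf : f ∈ boundedPoles hv S (D + Finsupp.single P 1 : ι →₀ ℤ))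
    (hf' : f ∉ boundedPoles hv S D) :
    boundedPoles hv S (D + Finsupp.single P 1 : ι →₀ ℤ) = boundedPoles hv S D ⊔ k ∙ f := by
  classical
  have hval : v P f = exp (D P + 1) := by
    have h1 := hf P hP
    simp only [Finsupp.add_apply, Finsupp.single_eq_same] at h1
    refine le_antisymm h1 (not_lt.mp fun hlt => hf' fun Q hQ => ?_)
    rcases eq_or_ne Q P with rfl | hne
    · rw [lt_exp_iff_le_exp_sub_one, add_sub_cancel_right] at hlt
      exact hlt
    · have := hf Q hQ
      rwa [Finsupp.add_apply, Finsupp.single_apply, if_neg hne.symm, add_zero] at this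
  have hf0 : f ≠ 0 := by rintro rfl; simp at hval
  apply le_antisymm
  · intro g hg
    have h1 := hg P hP
    simp only [Finsupp.add_apply, Finsupp.single_eq_same] at h1
    obtain ⟨c, hc⟩ := hv.exists_residue P (g / f) (by
      rw [map_div₀, hval]
      exact div_le_one_of_le₀ h1 zero_le)
    refine Submodule.mem_sup.mpr ⟨g - c • f, ?_, c • f,
      Submodule.mem_span_singleton.mpr ⟨c, rfl⟩, by abel⟩
    intro Q hQ
    rcases eq_or_ne Q P with rfl | hne
    · have h2 : g - c • f = (g / f - algebraMap k F c) * f := by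
        rw [Algebra.smul_def]; field_simp
      have h3 : v Q (g - c • f) < exp (D Q + 1) := by
        rw [h2, map_mul, hval]
        exact mul_lt_of_lt_one_left (exp_pos) hc
      rwa [lt_exp_iff_le_exp_sub_one, add_sub_cancel_right] at h3
    · have := (boundedPoles hv S _).sub_mem hg ((boundedPoles hv S _).smul_mem c hf) Q hQ
      rwa [Finsupp.add_apply, Finsupp.single_apply, if_neg hne.symm, add_zero] at this
  · refine sup_le (boundedPoles_mono hv S fun Q _ => ?_)
      ((Submodule.span_singleton_le_iff_mem _ _).mpr hf)
    rw [Finsupp.add_apply, Finsupp.single_apply]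
    split_ifs <;> simp

end RiemannRoch

end

section

open WithZero IsDedekindDomain Polynomial
open scoped nonZeroDivisors

/-! ### The residue pairing on the two halves of the curve. -/

section SerreDuality

set_option linter.unusedSectionVars false

variable (k F : Type*) [Field k] [Field F] [Algebra k F]
  [Algebra (RatFunc k) F] [IsScalarTower k (RatFunc k) F]

variable [Algebra k[X] F] [IsScalarTower k[X] (RatFunc k) F]

lemma isScalarTower_base_polynomial : IsScalarTower k k[X] F :=
  IsScalarTower.of_algebraMap_eq fun c => by
    rw [IsScalarTower.algebraMap_apply k[X] (RatFunc k) F,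
      ← IsScalarTower.algebraMap_apply k k[X] (RatFunc k),
      ← IsScalarTower.algebraMap_apply k (RatFunc k) F]

attribute [local instance] isScalarTower_base_polynomial

lemma isScalarTower_base_regularInfty : IsScalarTower k (RegularInfty k) F :=
  IsScalarTower.of_algebraMap_eq fun c => by
    rw [IsScalarTower.algebraMap_apply (RegularInfty k) (RatFunc k) F,
      ← IsScalarTower.algebraMap_apply k (RegularInfty k) (RatFunc k),
      ← IsScalarTower.algebraMap_apply k (RatFunc k) F]

attribute [local instance] isScalarTower_base_regularInfty

variable {k F}
variable {ι : Type*} {v : ι → Valuation F ℤᵐ⁰} (hv : IsPlaceSystem k v)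

/-- The order of the differential `dt` at a place, for a coordinate function `t`: one less than the
order of `t - a` if `t` has the value `a`, or than the order of `t` if `t` has a pole. -/
def IsDifferentialOrder (k : Type*) {F ι : Type*} [Field k] [Field F] [Algebra k F]
    (v : ι → Valuation F ℤᵐ⁰) (t : F) (K₀ : ι → ℤ) : Prop :=
  ∀ P, (∃ a : k, v P (t - algebraMap k F a) < 1 ∧
      v P (t - algebraMap k F a) = exp (-(K₀ P + 1))) ∨
    (1 < v P t ∧ v P t = exp (-(K₀ P + 1)))

include hv in
lemma mem_placesOver_polynomial_iff (P : ι) :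
    P ∈ placesOver k[X] v ↔ v P (algebraMap (RatFunc k) F RatFunc.X) ≤ 1 := by
  constructor
  · intro h
    have := h X
    rwa [IsScalarTower.algebraMap_apply k[X] (RatFunc k) F, RatFunc.algebraMap_X] at this
  · intro hP p
    induction p using Polynomial.induction_on' with
    | add p q hp hq =>
      rw [map_add]
      exact (Valuation.map_add _ _ _).trans (max_le hp hq)
    | monomial n a =>
      rw [← C_mul_X_pow_eq_monomial, map_mul, map_pow,
        IsScalarTower.algebraMap_apply k[X] (RatFunc k) F X, RatFunc.algebraMap_X, map_mul, map_pow]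
      have : algebraMap k[X] F (C a) = algebraMap k F a :=
        (IsScalarTower.algebraMap_apply k k[X] F a).symm
      rw [this]
      exact mul_le_one' (hv.algebraMap_le_one P a) (pow_le_one' hP n)

-- If X has residue a at `P`, then (X - a)⁻¹ is regular at infinity but has a pole at `P`.
-- Conversely, a valuation of k(X), trivial on k, at which X has a pole is equivalent to the one at
-- infinity.
include hv in
lemma mem_placesOver_regularInfty_iff (P : ι) :
    P ∈ placesOver (RegularInfty k) v ↔ 1 < v P (algebraMap (RatFunc k) F RatFunc.X) := by
  constructor
  · intro h
    by_contra! hle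
    obtain ⟨a, ha⟩ := hv.exists_residue P _ hle
    have hX : valInfty k (RatFunc.X - algebraMap k (RatFunc k) a) = exp 1 := by
      rw [← valInfty_X (k := k)]
      apply Valuation.map_sub_eq_of_lt_left
      rw [valInfty_X]
      refine (valInfty_algebraMap_le_one a).trans_lt ?_
      rw [← exp_zero, exp_lt_exp]; norm_num
    have h1 := h ⟨(RatFunc.X - algebraMap k (RatFunc k) a)⁻¹, by
      rw [Valuation.mem_valuationSubring_iff, map_inv₀, hX, ← exp_neg, ← exp_zero, exp_le_exp]
      norm_num⟩
    rw [IsScalarTower.algebraMap_apply (RegularInfty k) (RatFunc k) F] at h1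
    change v P (algebraMap (RatFunc k) F (RatFunc.X - algebraMap k (RatFunc k) a)⁻¹) ≤ 1 at h1
    rw [map_inv₀, map_inv₀, map_sub, ← IsScalarTower.algebraMap_apply] at h1
    have h0 : v P (algebraMap (RatFunc k) F RatFunc.X - algebraMap k F a) ≠ 0 := by
      rw [Valuation.ne_zero_iff, IsScalarTower.algebraMap_apply k (RatFunc k) F, ← map_sub]
      intro h0
      rw [map_eq_zero] at h0
      rw [h0, map_zero] at hX
      exact exp_ne_zero hX.symm
    exact absurd ha (not_lt.mpr ((inv_le_one₀ (zero_lt_iff.mpr h0)).mp h1))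
  · intro h r
    let w : Valuation (RatFunc k) ℤᵐ⁰ := (v P).comap (algebraMap (RatFunc k) F)
    have : w.IsTrivialOn k := isTrivialOn_of_le_one fun c => by
      change v P (algebraMap (RatFunc k) F (algebraMap k (RatFunc k) c)) ≤ 1
      rw [← IsScalarTower.algebraMap_apply]
      exact hv.algebraMap_le_one P c
    classical
    have h1 := RatFunc.valuation_isEquiv_inftyValuation_of_one_lt_valuation_X (v := w) h
    have h2 := RatFunc.valuation_isEquiv_inftyValuation_of_one_lt_valuation_X (v := valInfty k)
      (by rw [valInfty_X, ← exp_zero, exp_lt_exp]; norm_num)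
    have h3 := Valuation.isEquiv_iff_val_le_one.mp (h1.trans h2.symm) (x := (r : RatFunc k))
    exact h3.mpr r.2

include hv in
lemma placesOver_union : placesOver k[X] v ∪ placesOver (RegularInfty k) v = Set.univ := by
  ext P
  simp only [Set.mem_union, Set.mem_univ, iff_true]
  rw [mem_placesOver_polynomial_iff hv, mem_placesOver_regularInfty_iff hv]
  exact le_or_gt _ _

/-- Evaluation of the residue pairing on `F`. -/
noncomputable def residuePairing (f : F) : F →ₗ[k] k :=
  coeffInfty k 1 ∘ₗ ((Algebra.trace (RatFunc k) F).restrictScalars k) ∘ₗ LinearMap.mulLeft k f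

lemma residuePairing_apply (f g : F) :
    residuePairing f g = coeffInfty k 1 (Algebra.trace (RatFunc k) F (f * g)) := rfl

lemma smul_mem_boundedPoles (R : Type*) [CommRing R] [Algebra R F] {d : ι → ℤ} (r : R) {g : F}
    (hg : g ∈ boundedPoles hv (placesOver R v) d) :
    algebraMap R F r * g ∈ boundedPoles hv (placesOver R v) d := fun P hP => by
  rw [map_mul]
  exact mul_le_of_le_one_of_le (hP r) (hg P hP)

lemma valInfty_X_inv_le_one : valInfty k RatFunc.X⁻¹ ≤ 1 := by
  rw [map_inv₀, valInfty_X, ← exp_neg, ← exp_zero, exp_le_exp]; norm_num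

variable [CharZero k] [FiniteDimensional (RatFunc k) F]

instance : CharZero (RatFunc k) := charZero_of_injective_algebraMap (algebraMap k (RatFunc k)).injective

variable {K₀ : ι → ℤ} (hK : IsDifferentialOrder k v (algebraMap (RatFunc k) F RatFunc.X) K₀)

-- As k[X] is its own annihilator under the residue and the space of g is a k[X]-module, the pairing
-- vanishes exactly when all traces Tr(fg) are polynomials. Trace duality applies with different
-- exponent K₀, because the point of the line below `P` is cut out by X - a.
include hK in
lemma residuePairing_polynomial_iff (D : ι →₀ ℤ) (f : F) :
    (∀ g ∈ boundedPoles hv (placesOver k[X] v) D, residuePairing (k := k) f g = 0) ↔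
      f ∈ boundedPoles hv (placesOver k[X] v) (K₀ - D) := by
  rw [forall_trace_mem_range_iff hv k[X] (RatFunc k) (δ := K₀)]
  · constructor
    · intro h g hg
      apply mem_range_of_coeffInfty_mul
      intro p
      have := h _ (smul_mem_boundedPoles hv k[X] p hg)
      rw [residuePairing_apply, mul_left_comm,
        IsScalarTower.algebraMap_apply k[X] (RatFunc k) F, ← Algebra.smul_def, map_smul,
        smul_eq_mul, mul_comm] at this
      exact this
    · intro h g hg
      obtain ⟨p, hp⟩ := h g hg
      rw [residuePairing_apply, ← hp, coeffInfty_one_algebraMap]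
  · intro P hP
    rw [mem_placesOver_polynomial_iff hv] at hP
    rcases hK P with ⟨a, ha1, ha2⟩ | h
    · have hmap : algebraMap k[X] F (X - C a) =
          algebraMap (RatFunc k) F RatFunc.X - algebraMap k F a := by
        rw [map_sub, IsScalarTower.algebraMap_apply k[X] (RatFunc k) F, RatFunc.algebraMap_X,
          IsScalarTower.algebraMap_apply k k[X] F]
        rfl
      refine ⟨X - C a, X_sub_C_ne_zero a, ?_, ?_, ?_⟩
      · exact PrincipalIdealRing.isMaximal_of_irreducible (irreducible_X_sub_C a)
      · rw [hmap, ha2]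
      · rw [hmap]; exact ha1
    · exact absurd h.1 (not_lt.mpr hP)

lemma isMaximal_span_X_inv :
    (Ideal.span {(⟨RatFunc.X⁻¹, valInfty_X_inv_le_one⟩ : RegularInfty k)}).IsMaximal := by
  have h : (valInfty k).IsUniformizer RatFunc.X⁻¹ := by
    rw [Valuation.IsUniformizer.iff,
      Valuation.IsRankOneDiscrete.generator_eq_exp_neg_one_of_surjective valInfty_surjective,
      map_inv₀, valInfty_X, Units.val_mk0, exp_neg]
  rw [← Valuation.IsUniformizer.is_generator (v := valInfty k) (π := ⟨_, valInfty_X_inv_le_one⟩) h]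
  exact IsLocalRing.maximalIdeal.isMaximal _

-- The differential dX has a double pole at infinity, so the traces of fg must be regular after
-- multiplication by X². This explains the factor t² throughout.
include hK in
lemma residuePairing_regularInfty_iff (D : ι →₀ ℤ) (f : F) :
    (∀ g ∈ boundedPoles hv (placesOver (RegularInfty k) v) D, residuePairing (k := k) f g = 0) ↔
      f ∈ boundedPoles hv (placesOver (RegularInfty k) v) (K₀ - D) := by
  set t := algebraMap (RatFunc k) F RatFunc.X with ht
  have ht0 : t ≠ 0 := by rw [ht]; simp [RatFunc.X_ne_zero]
  have hvt : ∀ P ∈ placesOver (RegularInfty k) v, 1 < v P t ∧ v P t = exp (-(K₀ P + 1)) := by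
    intro P hP
    rw [mem_placesOver_regularInfty_iff hv] at hP
    rcases hK P with ⟨a, ha, -⟩ | h
    · exfalso
      have h1 : v P t ≤ 1 := by
        rw [← sub_add_cancel t (algebraMap k F a)]
        exact (Valuation.map_add _ _ _).trans (max_le ha.le (hv.algebraMap_le_one P a))
      exact absurd hP (not_lt.mpr h1)
    · exact h
  -- The uniformizer of the line is X⁻¹, of order -(K₀ + 1) at `P`... in terms of poles, its value
  -- is exp (K₀ + 1) = exp (-(δ + 1)), so δ = -K₀ - 2. The factor t² compensates this shift.
  have hdual := forall_trace_mem_range_iff hv (RegularInfty k) (RatFunc k) (δ := -K₀ - 2)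
    (fun P hP => ⟨⟨RatFunc.X⁻¹, valInfty_X_inv_le_one⟩, by
        rw [ne_eq, Subtype.ext_iff]; exact inv_ne_zero RatFunc.X_ne_zero,
      isMaximal_span_X_inv, by
        have h := (hvt P hP).2
        change v P (algebraMap (RatFunc k) F RatFunc.X⁻¹) = _
        rw [map_inv₀, map_inv₀, ← ht, h, ← exp_neg]
        congr 1
        simp only [Pi.sub_apply, Pi.neg_apply, Pi.ofNat_apply]
        ring, by
        have h := (hvt P hP).1
        change v P (algebraMap (RatFunc k) F RatFunc.X⁻¹) < 1
        rw [map_inv₀, map_inv₀, ← ht]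
        exact inv_lt_one_of_one_lt₀ h⟩) D (t ^ 2 * f)
  trans ∀ g ∈ boundedPoles hv (placesOver (RegularInfty k) v) D,
      Algebra.trace (RatFunc k) F (t ^ 2 * f * g) ∈ (algebraMap (RegularInfty k) (RatFunc k)).range
  · have htr : ∀ g, Algebra.trace (RatFunc k) F (t ^ 2 * f * g) =
        RatFunc.X ^ (2 : ℤ) * Algebra.trace (RatFunc k) F (f * g) := by
      intro g
      rw [mul_assoc, ht, ← map_pow, ← Algebra.smul_def, map_smul, smul_eq_mul]
      rfl
    simp_rw [htr]
    have hmem : ∀ y : RatFunc k, y ∈ (algebraMap (RegularInfty k) (RatFunc k)).range ↔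
        valInfty k y ≤ 1 := fun y =>
      ⟨by rintro ⟨x, rfl⟩; exact x.2, fun h => ⟨⟨y, h⟩, rfl⟩⟩
    simp_rw [hmem]
    constructor
    · intro h g hg
      apply valInfty_le_of_coeffInfty_mul
      intro r hr
      have := h _ (smul_mem_boundedPoles hv (RegularInfty k) ⟨r, hr⟩ hg)
      rw [residuePairing_apply, mul_left_comm,
        IsScalarTower.algebraMap_apply (RegularInfty k) (RatFunc k) F, ← Algebra.smul_def,
        map_smul, smul_eq_mul, mul_comm] at this
      exact this
    · intro h g hg
      exact coeffInfty_one_of_valInfty_le (h g hg)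
  · rw [← hdual]
    refine forall₂_congr fun P hP => ?_
    have h := (hvt P hP).2
    have h0 : (0 : ℤᵐ⁰) < exp (2 * -(K₀ P + 1)) := exp_pos
    rw [map_mul, map_pow, h, ← exp_nsmul, ← mul_le_mul_iff_right₀ h0 (b := v P f), ← exp_add]
    simp only [Pi.sub_apply, Pi.neg_apply, Pi.ofNat_apply, nsmul_eq_mul, Nat.cast_ofNat]
    rw [show 2 * -(K₀ P + 1) + (K₀ P - D P) = -K₀ P - 2 - D P by ring]

end SerreDuality

end

section

open WithZero IsDedekindDomain Polynomial
open scoped nonZeroDivisors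

/-! ### Serre duality. -/

section RiemannRochTheorem

set_option linter.unusedSectionVars false

variable {k F : Type*} [Field k] [Field F] [Algebra k F]
  [Algebra (RatFunc k) F] [IsScalarTower k (RatFunc k) F]
  [Algebra k[X] F] [IsScalarTower k[X] (RatFunc k) F]

attribute [local instance] isScalarTower_base_polynomial isScalarTower_base_regularInfty

variable {ι : Type*} {v : ι → Valuation F ℤᵐ⁰} (hv : IsPlaceSystem k v)
variable [CharZero k] [FiniteDimensional (RatFunc k) F]
variable {K₀ : ι → ℤ} (hK : IsDifferentialOrder k v (algebraMap (RatFunc k) F RatFunc.X) K₀)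

/-- Every element of `F` can be multiplied into the functions with bounded poles by a nonzero
element of `R`. -/
lemma exists_mul_mem_boundedPoles (R E : Type*) [CommRing R] [IsDedekindDomain R] [Algebra R F]
    [Algebra k R] [IsScalarTower k R F] [Field E] [Algebra R E] [IsFractionRing R E]
    [Algebra E F] [IsScalarTower R E F] [FiniteDimensional E F] [Algebra.IsSeparable E F]
    (D : ι →₀ ℤ) (f : F) :
    ∃ r : R, r ≠ 0 ∧ algebraMap R F r * f ∈ boundedPoles hv (placesOver R v) D := by
  have : IsDedekindDomain (integralClosure R F) := integralClosure.isDedekindDomain R E F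
  have : IsFractionRing (integralClosure R F) F :=
    integralClosure.isFractionRing_of_finite_extension E F
  have hRF : Function.Injective (algebraMap R F) := by
    rw [IsScalarTower.algebraMap_eq R E F]
    exact (algebraMap E F).injective.comp (IsFractionRing.injective R E)
  let B := integralClosure R F
  obtain ⟨b, hb, hbI⟩ : ∃ b : B, b ≠ 0 ∧ algebraMap B F b * f ∈ divisorIdeal hv R B D := by
    obtain ⟨x, hx0, hx⟩ := FractionalIdeal.exists_ne_zero_mem_isInteger
      (divisorIdeal_ne_zero hv R B D)
    obtain ⟨n, d, hd, rfl⟩ := IsFractionRing.div_surjective (A := B) f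
    have hd0 := nonZeroDivisors.ne_zero hd
    refine ⟨d * x, mul_ne_zero hd0 hx0, ?_⟩
    have hd' : algebraMap B F d ≠ 0 := by simpa using hd0
    have h1 : algebraMap B F (d * x) * (algebraMap B F n / algebraMap B F d) =
        n • algebraMap B F x := by
      rw [map_mul, Algebra.smul_def]; field_simp
    rw [h1]
    exact Submodule.smul_mem _ n hx
  have hRB : Function.Injective (algebraMap R B) := by
    rw [IsScalarTower.algebraMap_eq R B F, RingHom.coe_comp] at hRF
    exact Function.Injective.of_comp hRF
  have : Algebra.IsIntegral R B := inferInstance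
  have : Algebra.IsAlgebraic R B := inferInstance
  -- An algebraic nonzero element of `B` divides a nonzero element of `R`.
  obtain ⟨r, hr0, c, hc⟩ := (Algebra.IsAlgebraic.isAlgebraic (R := R) b).exists_nonzero_dvd
    (mem_nonZeroDivisors_of_ne_zero hb)
  refine ⟨r, hr0, ?_⟩
  rw [← mem_divisorIdeal hv R B, IsScalarTower.algebraMap_apply R B F, hc, mul_comm b c, map_mul,
    mul_assoc, ← Algebra.smul_def]
  exact Submodule.smul_mem _ c hbI

include hK in
lemma residuePairing_iff (D : ι →₀ ℤ) (f : F) :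
    (residuePairing (k := k) f ∈ (boundedPoles hv (placesOver k[X] v) D ⊔
      boundedPoles hv (placesOver (RegularInfty k) v) D).dualAnnihilator) ↔
      f ∈ boundedPoles hv Set.univ (K₀ - D) := by
  rw [Submodule.dualAnnihilator_sup_eq, Submodule.mem_inf, Submodule.mem_dualAnnihilator,
    Submodule.mem_dualAnnihilator, residuePairing_polynomial_iff hv hK,
    residuePairing_regularInfty_iff hv hK, ← placesOver_union hv, boundedPoles_union,
    Submodule.mem_inf]

/-- The trace of a separable extension is surjective, so some multiple of a nonzero f has trace X⁻¹,
whose residue is 1. -/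
lemma residuePairing_injective {f : F} (h : residuePairing (k := k) f = 0) : f = 0 := by
  by_contra hf
  obtain ⟨g, hg⟩ := Algebra.trace_surjective (RatFunc k) F RatFunc.X⁻¹
  have h1 := LinearMap.congr_fun h (f⁻¹ * g)
  rw [residuePairing_apply, mul_inv_cancel_left₀ hf, hg, LinearMap.zero_apply] at h1
  have h2 := coeffInfty_X_zpow_mul 1 (-1) (algebraMap k[X] (RatFunc k) 1)
  rw [map_one, mul_one, zpow_neg_one, h1, ← map_one (algebraMap k[X] (RatFunc k)),
    coeffInfty_algebraMap] at h2
  simp at h2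

/-- A continuity statement: it makes a functional that kills the bounded functions at infinity
vanish near infinity on each line k(X)·f. -/
lemma exists_valInfty_le_mul_mem_boundedPoles (D : ι →₀ ℤ) (f : F) :
    ∃ N : ℕ, ∀ r : RatFunc k, valInfty k r ≤ exp (-N : ℤ) →
      algebraMap (RatFunc k) F r * f ∈ boundedPoles hv (placesOver (RegularInfty k) v) D := by
  obtain ⟨r, hr0, hr⟩ := exists_mul_mem_boundedPoles hv (RegularInfty k) (RatFunc k) D f
  obtain ⟨N, hN⟩ := exists_valInfty_lt (r : RatFunc k)⁻¹
  have hr0' : (r : RatFunc k) ≠ 0 := by rw [ne_eq, Subtype.ext_iff] at hr0; exact hr0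
  refine ⟨N, fun y hy => ?_⟩
  have h1 : valInfty k (y * (r : RatFunc k)⁻¹) ≤ 1 := by
    rw [map_mul]
    calc _ ≤ exp (-N : ℤ) * exp (N : ℤ) := mul_le_mul' hy hN
      _ = 1 := by rw [← exp_add]; simp
  have := smul_mem_boundedPoles hv (RegularInfty k) ⟨_, h1⟩ hr
  convert! this using 1
  rw [IsScalarTower.algebraMap_apply (RegularInfty k) (RatFunc k) F,
    IsScalarTower.algebraMap_apply (RegularInfty k) (RatFunc k) F, ← mul_assoc, ← map_mul]
  congr 2
  exact (inv_mul_cancel_right₀ hr0' y).symm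

/-- On each line k(X)·b, after b is scaled by a polynomial r, the functional kills polynomials and a
neighbourhood of infinity, so it is a residue pairing with some p(b). The trace-dual basis b'
assembles these into the single element ∑ p(bᵢ) b'ᵢ. -/
lemma exists_residuePairing_eq (D : ι →₀ ℤ) (μ : F →ₗ[k] k)
    (h : μ ∈ (boundedPoles hv (placesOver k[X] v) D ⊔
      boundedPoles hv (placesOver (RegularInfty k) v) D).dualAnnihilator) :
    ∃ f : F, residuePairing (k := k) f = μ := by
  classical
  rw [Submodule.dualAnnihilator_sup_eq, Submodule.mem_inf, Submodule.mem_dualAnnihilator,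
    Submodule.mem_dualAnnihilator] at h
  have key : ∀ b : F, ∃ p : RatFunc k, ∀ y : RatFunc k,
      μ (algebraMap (RatFunc k) F y * b) = coeffInfty k 1 (p * y) := by
    intro b
    obtain ⟨r, hr0, hr⟩ := exists_mul_mem_boundedPoles hv k[X] (RatFunc k) D b
    obtain ⟨N, hN⟩ := exists_valInfty_le_mul_mem_boundedPoles hv D (algebraMap k[X] F r * b)
    obtain ⟨p, hp⟩ := exists_polynomial_of_functional
      (μ ∘ₗ (LinearMap.mulRight k (algebraMap k[X] F r * b)) ∘ₗ
        (IsScalarTower.toAlgHom k (RatFunc k) F).toLinearMap) N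
      (fun q => by
        have := h.1 _ (smul_mem_boundedPoles hv k[X] q hr)
        rw [IsScalarTower.algebraMap_apply k[X] (RatFunc k) F q] at this
        exact this)
      (fun f hf => h.2 _ (hN f hf))
    have hr0' : algebraMap k[X] (RatFunc k) r ≠ 0 := by simpa using hr0
    refine ⟨p / algebraMap k[X] (RatFunc k) r, fun y => ?_⟩
    have := hp (y / algebraMap k[X] (RatFunc k) r)
    rw [div_mul_eq_mul_div, mul_div_assoc, ← this]
    change _ = μ (algebraMap (RatFunc k) F _ * (algebraMap k[X] F r * b))
    rw [IsScalarTower.algebraMap_apply k[X] (RatFunc k) F, ← mul_assoc, ← map_mul,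
      div_mul_cancel₀ _ hr0']
  choose p hp using key
  let b := Module.finBasis (RatFunc k) F
  let b' := (Algebra.traceForm (RatFunc k) F).dualBasis (traceForm_nondegenerate (RatFunc k) F) b
  refine ⟨∑ i, p (b i) • b' i, ?_⟩
  ext g
  rw [residuePairing_apply]
  conv_rhs => rw [← b.sum_repr g, map_sum]
  have h1 : Algebra.trace (RatFunc k) F ((∑ i, p (b i) • b' i) * g) =
      ∑ i, p (b i) * b.repr g i := by
    rw [Finset.sum_mul, map_sum]
    refine Finset.sum_congr rfl fun i _ => ?_
    rw [smul_mul_assoc, map_smul, smul_eq_mul]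
    congr 1
    change Algebra.traceForm (RatFunc k) F (b' i) g = _
    conv_lhs => rw [← b.sum_repr g, map_sum]
    simp_rw [map_smul, b', LinearMap.BilinForm.apply_dualBasis_left, smul_eq_mul, mul_ite, mul_one, mul_zero]
    simp
  rw [h1, map_sum]
  refine Finset.sum_congr rfl fun i _ => ?_
  rw [Algebra.smul_def, hp]

/-- Serre duality. -/
noncomputable def serreDuality (D : ι →₀ ℤ) :
    boundedPoles hv Set.univ (K₀ - D) ≃ₗ[k]
      Module.Dual k (F ⧸ (boundedPoles hv (placesOver k[X] v) D ⊔
        boundedPoles hv (placesOver (RegularInfty k) v) D)) :=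
  (LinearEquiv.ofBijective
    ({ toFun := fun f => ⟨residuePairing (k := k) f.1, (residuePairing_iff hv hK D f.1).mpr f.2⟩
       map_add' := fun f g => by
        ext x
        simp [residuePairing_apply, add_mul]
       map_smul' := fun c f => by
        ext x
        simp only [Submodule.coe_smul, residuePairing_apply, smul_mul_assoc, RingHom.id_apply,
          LinearMap.smul_apply]
        rw [← IsScalarTower.algebraMap_smul (RatFunc k) c (f.1 * x), map_smul, algebraMap_smul,
          map_smul] } : boundedPoles hv Set.univ (K₀ - D) →ₗ[k]
        (boundedPoles hv (placesOver k[X] v) D ⊔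
          boundedPoles hv (placesOver (RegularInfty k) v) D).dualAnnihilator)
    ⟨by
      rw [injective_iff_map_eq_zero]
      intro f hf
      exact Subtype.ext (residuePairing_injective (k := k) (congrArg Subtype.val hf)), by
      rintro ⟨μ, hμ⟩
      obtain ⟨f, rfl⟩ := exists_residuePairing_eq hv D μ hμ
      exact ⟨⟨f, (residuePairing_iff hv hK D f).mp hμ⟩, rfl⟩⟩).trans
  (Submodule.dualQuotEquivDualAnnihilator _).symm

end RiemannRochTheorem

end

section

open WithZero IsDedekindDomain Polynomial
open scoped nonZeroDivisors

/-! ### Riemann–Roch and its consequences for principal divisors. -/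

section RiemannRochConsequences

set_option linter.unusedSectionVars false

variable {k F : Type*} [Field k] [Field F] [Algebra k F]
  [Algebra (RatFunc k) F] [IsScalarTower k (RatFunc k) F]
  [Algebra k[X] F] [IsScalarTower k[X] (RatFunc k) F]

attribute [local instance] isScalarTower_base_polynomial isScalarTower_base_regularInfty

variable {ι : Type*} {v : ι → Valuation F ℤᵐ⁰} (hv : IsPlaceSystem k v)
variable [CharZero k] [FiniteDimensional (RatFunc k) F]
variable {K₀ : ι → ℤ} (hK : IsDifferentialOrder k v (algebraMap (RatFunc k) F RatFunc.X) K₀)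

lemma isIntegral_of_mem_boundedPoles (R E : Type*) [CommRing R] [IsDedekindDomain R] [Algebra R F]
    [Algebra k R] [IsScalarTower k R F] [Field E] [Algebra R E] [IsFractionRing R E]
    [Algebra E F] [IsScalarTower R E F] [FiniteDimensional E F] [Algebra.IsSeparable E F]
    {f : F} (hf : f ∈ boundedPoles hv (placesOver R v) 0) : IsIntegral R f := by
  have : IsDedekindDomain (integralClosure R F) := integralClosure.isDedekindDomain R E F
  have : IsFractionRing (integralClosure R F) F :=
    integralClosure.isFractionRing_of_finite_extension E F
  let B := integralClosure R F
  rw [mem_boundedPoles_placesOver_iff hv R B] at hf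
  obtain ⟨b, hb⟩ := HeightOneSpectrum.mem_integers_of_valuation_le_one (R := B) F f
    (fun w => by simpa using hf w)
  rw [← hb]
  exact b.2

lemma mem_range_of_mem_range_of_valInfty_le_one {y : RatFunc k}
    (h1 : y ∈ (algebraMap k[X] (RatFunc k)).range) (h2 : valInfty k y ≤ 1) :
    y ∈ (algebraMap k (RatFunc k)).range := by
  obtain ⟨p, rfl⟩ := h1
  rw [← exp_zero, ← neg_zero, valInfty_le_exp_iff] at h2
  have : p = C (p.coeff 0) := by
    ext n
    rw [coeff_C]
    split_ifs with h
    · rw [h]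
    · have := h2 (-n) (by omega)
      rw [coeffInfty_algebraMap, if_pos (by omega)] at this
      simpa using this
  rw [this]
  exact ⟨p.coeff 0, by rw [IsScalarTower.algebraMap_apply k k[X] (RatFunc k)]; rfl⟩

variable [IsAlgClosed k]

/-- A function without poles is constant. -/
lemma mem_range_of_mem_boundedPoles_zero {f : F} (hf : f ∈ boundedPoles hv Set.univ 0) :
    f ∈ (algebraMap k F).range := by
  rw [← placesOver_union hv, boundedPoles_union, Submodule.mem_inf] at hf
  -- The minimal polynomial of f over k(X) has its coefficients in k[X] and in the local ring at
  -- infinity, hence in k. So f is algebraic over the algebraically closed field k.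
  have h1 := minpoly.isIntegrallyClosed_eq_field_fractions (RatFunc k) F
    (isIntegral_of_mem_boundedPoles hv k[X] (RatFunc k) hf.1)
  have h2 := minpoly.isIntegrallyClosed_eq_field_fractions (RatFunc k) F
    (isIntegral_of_mem_boundedPoles hv (RegularInfty k) (RatFunc k) hf.2)
  rw [Algebra.algebraMap_self, RingHom.id_apply] at h1 h2
  have h3 : minpoly (RatFunc k) f ∈ lifts (algebraMap k (RatFunc k)) := by
    rw [lifts_iff_coeff_lifts]
    intro n
    apply mem_range_of_mem_range_of_valInfty_le_one
    · rw [h1, coeff_map]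
      exact ⟨_, rfl⟩
    · rw [h2, coeff_map]
      exact ((minpoly (RegularInfty k) f).coeff n).2
  obtain ⟨q, hq⟩ := (mem_lifts _).mp h3
  have hint : IsIntegral (RatFunc k) f := Algebra.IsIntegral.isIntegral f
  have hq0 : q ≠ 0 := by
    rintro rfl
    rw [Polynomial.map_zero] at hq
    exact minpoly.ne_zero hint hq.symm
  have halg : IsAlgebraic k f := ⟨q, hq0, by
    rw [← aeval_map_algebraMap (RatFunc k), hq, minpoly.aeval]⟩
  exact minpoly.mem_range_of_degree_eq_one k f
    (IsAlgClosed.degree_eq_one_of_irreducible k (minpoly.irreducible halg.isIntegral))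

/-- Riemann-Roch spaces are finite-dimensional. -/
theorem finiteDimensional_boundedPoles (D : ι →₀ ℤ) :
    FiniteDimensional k (boundedPoles hv Set.univ D) := by
  classical
  induction D using Finsupp.int_induction with
  | h0 =>
    have hle : boundedPoles hv Set.univ (0 : ι →₀ ℤ) ≤ LinearMap.range (Algebra.linearMap k F) := by
      intro f hf
      exact mem_range_of_mem_boundedPoles_zero hv hf
    exact Submodule.finiteDimensional_of_le hle
  | hadd D P ih =>
    by_cases h : boundedPoles hv Set.univ (D + Finsupp.single P 1 : ι →₀ ℤ) ≤
        boundedPoles hv Set.univ D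
    · exact Submodule.finiteDimensional_of_le h
    · obtain ⟨f, hf, hf'⟩ := SetLike.not_le_iff_exists.mp h
      rw [boundedPoles_add_single hv Set.univ D (Set.mem_univ P) hf hf']
      infer_instance
  | hsub D P ih =>
    refine @Submodule.finiteDimensional_of_le _ _ _ _ _ _ _ ih
      (boundedPoles_mono hv _ fun Q _ => ?_)
    rw [Finsupp.add_apply, Finsupp.single_apply]
    split_ifs <;> simp

/-- Multiplication by a function `h` identifies spaces of functions with bounded poles. -/
noncomputable def boundedPolesEquiv (S : Set ι) {d e : ι → ℤ} (h : F)
    (hh : ∀ P, v P h = exp (d P - e P)) (h0 : h ≠ 0) :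
    boundedPoles hv S e ≃ₗ[k] boundedPoles hv S d :=
  LinearEquiv.ofSubmodules (LinearEquiv.smulOfNeZero F F h h0 |>.restrictScalars k) _ _ (by
    ext f
    rw [Submodule.mem_map]
    constructor
    · rintro ⟨g, hg, rfl⟩ P hP
      change v P (h * g) ≤ _
      rw [map_mul, hh]
      calc _ ≤ exp (d P - e P) * exp (e P) := mul_le_mul_right (hg P hP) _
        _ = exp (d P) := by rw [← exp_add]; simp
    · intro hf
      refine ⟨h⁻¹ * f, fun P hP => ?_, ?_⟩
      · rw [map_mul, map_inv₀, hh, ← exp_neg]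
        calc _ ≤ exp (-(d P - e P)) * exp (d P) := mul_le_mul_right (hf P hP) _
          _ = exp (e P) := by rw [← exp_add]; congr 1; ring
      · change h * (h⁻¹ * f) = f
        rw [mul_inv_cancel_left₀ h0])

variable {K : ι →₀ ℤ} {h : F} (h0 : h ≠ 0) (hh : ∀ P, v P h = exp (K₀ P - K P))

/-- The dimension of the Riemann-Roch space of a divisor. -/
noncomputable def ell (d : ι → ℤ) : ℤ := Module.finrank k (boundedPoles hv Set.univ d)

/-- The difference of the dimensions of the spaces for `D` and `K - D`. -/
noncomputable def eulerChar (K D : ι →₀ ℤ) : ℤ := ell hv D - ell hv (K - D : ι →₀ ℤ)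
-- Multiplication by h, whose divisor is K - K₀, carries L(K - D) onto L(K₀ - D), the dual of the
-- quotient. Finiteness of the quotient follows from that of its dual.
include hK in
lemma ell_canonical_sub_eq_finrank_quotient (h0 : h ≠ 0) (hh : ∀ P, v P h = exp (K₀ P - K P))
    (D : ι →₀ ℤ) :
    FiniteDimensional k (F ⧸ (boundedPoles hv (placesOver k[X] v) D ⊔
        boundedPoles hv (placesOver (RegularInfty k) v) D)) ∧
    ell hv (K - D : ι →₀ ℤ) = Module.finrank k (F ⧸ (boundedPoles hv (placesOver k[X] v) D ⊔
        boundedPoles hv (placesOver (RegularInfty k) v) D)) := by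
  have h1 := finiteDimensional_boundedPoles hv (K - D)
  have e := (boundedPolesEquiv hv Set.univ (d := K₀ - D) (e := (K - D : ι →₀ ℤ)) h
    (fun P => by rw [hh]; congr 1; simp) h0).trans (serreDuality hv hK D)
  have h2 := e.finiteDimensional
  refine ⟨Module.finite_dual_iff k |>.mp h2, ?_⟩
  rw [ell, e.finrank_eq, Subspace.dual_finrank_eq]

-- Here ell(D) and ell(K - D) are the dimensions of the intersection and of the cokernel of the two
-- half-spaces. Every place belongs to exactly one half, so adding P enlarges only one of them, by
-- one dimension.
include hK in
lemma eulerChar_add_single (h0 : h ≠ 0) (hh : ∀ P, v P h = exp (K₀ P - K P))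
    (D : ι →₀ ℤ) (P : ι) :
    eulerChar hv K (D + Finsupp.single P 1) = eulerChar hv K D + 1 := by
  have hfin := finiteDimensional_boundedPoles hv D
  obtain ⟨hq, hell⟩ := ell_canonical_sub_eq_finrank_quotient hv hK h0 hh D
  obtain ⟨-, hell'⟩ := ell_canonical_sub_eq_finrank_quotient hv hK h0 hh (D + Finsupp.single P 1)
  rw [eulerChar, eulerChar, hell, hell', ell, ell]
  rw [← placesOver_union hv, boundedPoles_union] at hfin
  rw [← placesOver_union hv, boundedPoles_union, boundedPoles_union]
  have hP : P ∈ placesOver k[X] v ∪ placesOver (RegularInfty k) v := by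
    rw [placesOver_union hv]; trivial
  have hdisj : ¬ (P ∈ placesOver k[X] v ∧ P ∈ placesOver (RegularInfty k) v) := by
    rw [mem_placesOver_polynomial_iff hv, mem_placesOver_regularInfty_iff hv]
    exact fun h => absurd h.2 (not_lt.mpr h.1)
  rcases hP with hP | hP
  · obtain ⟨f, hf, hf'⟩ := exists_mem_boundedPoles_single hv k[X] (RatFunc k) D hP
    rw [boundedPoles_add_single hv _ D hP hf hf',
      boundedPoles_add_single_of_notMem hv _ D (fun hP' => hdisj ⟨hP, hP'⟩)]
    have := Submodule.finrank_inf_add_finrank_quotient hf'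
      (B := boundedPoles hv (placesOver (RegularInfty k) v) D)
    omega
  · obtain ⟨f, hf, hf'⟩ := exists_mem_boundedPoles_single hv (RegularInfty k) (RatFunc k) D hP
    rw [boundedPoles_add_single hv _ D hP hf hf',
      boundedPoles_add_single_of_notMem hv _ D (fun hP' => hdisj ⟨hP', hP⟩)]
    rw [inf_comm] at hfin
    rw [sup_comm] at hq
    have := Submodule.finrank_inf_add_finrank_quotient hf'
      (B := boundedPoles hv (placesOver k[X] v) D)
    rw [inf_comm, inf_comm (boundedPoles hv (placesOver (RegularInfty k) v) D),
      sup_comm _ (boundedPoles hv (placesOver k[X] v) D),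
      sup_comm _ (boundedPoles hv (placesOver k[X] v) D)] at this
    omega

/-- The degree of a divisor. -/
def divisorDegree {ι : Type*} (D : ι →₀ ℤ) : ℤ := D.sum fun _ n => n

lemma divisorDegree_add {ι : Type*} (D E : ι →₀ ℤ) :
    divisorDegree (D + E) = divisorDegree D + divisorDegree E :=
  Finsupp.sum_add_index' (fun _ => rfl) (fun _ _ _ => rfl)

lemma divisorDegree_single {ι : Type*} (P : ι) (n : ℤ) :
    divisorDegree (Finsupp.single P n) = n := by simp [divisorDegree]

include hK in
/-- The Riemann-Roch theorem. -/
theorem eulerChar_eq (h0 : h ≠ 0) (hh : ∀ P, v P h = exp (K₀ P - K P)) (D : ι →₀ ℤ) :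
    eulerChar hv K D = divisorDegree D + eulerChar hv K 0 := by
  induction D using Finsupp.int_induction with
  | h0 => simp [divisorDegree]
  | hadd D P ih =>
    rw [eulerChar_add_single hv hK h0 hh, ih, divisorDegree_add, divisorDegree_single]
    ring
  | hsub D P ih =>
    rw [eulerChar_add_single hv hK h0 hh, divisorDegree_add, divisorDegree_single] at ih
    linarith

lemma ell_le_of_mem {D : ι →₀ ℤ} {f : F} (hf0 : f ≠ 0) (hf : f ∈ boundedPoles hv Set.univ D)
    (E : ι →₀ ℤ) : ell hv E ≤ ell hv (E + D : ι →₀ ℤ) := by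
  have := finiteDimensional_boundedPoles hv (E + D)
  rw [ell, ell, Nat.cast_le]
  let g : boundedPoles hv Set.univ E →ₗ[k] boundedPoles hv Set.univ (E + D : ι →₀ ℤ) :=
    (LinearMap.mulLeft k f).restrict fun x hx P hP => by
      rw [LinearMap.mulLeft_apply, map_mul, mul_comm]
      calc _ ≤ exp (E P) * exp (D P) := mul_le_mul' (hx P hP) (hf P hP)
        _ = _ := by rw [← exp_add]; rfl
  apply LinearMap.finrank_le_finrank_of_injective (f := g)
  intro x y hxy
  have : f * x.1 = f * y.1 := congrArg Subtype.val hxy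
  exact Subtype.ext (mul_left_cancel₀ hf0 this)

-- No degree of a principal divisor is computed. A nonzero f in L(D) gives ell(0) ≤ ell(D) and ell(K
-- - D) ≤ ell(K), so the Euler characteristic of D is at least that of 0, while Riemann–Roch makes
-- the difference deg D < 0.
include hK in
lemma eq_zero_of_divisorDegree_neg (h0 : h ≠ 0) (hh : ∀ P, v P h = exp (K₀ P - K P))
    {D : ι →₀ ℤ} (hD : divisorDegree D < 0) {f : F}
    (hf : f ∈ boundedPoles hv Set.univ D) : f = 0 := by
  by_contra hf0
  have h1 := ell_le_of_mem hv hf0 hf 0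
  have h2 := ell_le_of_mem hv hf0 hf (K - D)
  have h3 := eulerChar_eq hv hK h0 hh D
  rw [zero_add] at h1
  rw [sub_add_cancel] at h2
  rw [eulerChar, eulerChar, sub_zero] at h3
  linarith

include hK in
/-- A function in the Riemann-Roch space of a divisor of degree zero has exactly that divisor. -/
lemma valuation_eq_of_divisorDegree_eq_zero (h0 : h ≠ 0) (hh : ∀ P, v P h = exp (K₀ P - K P))
    {D : ι →₀ ℤ} (hD : divisorDegree D = 0) {f : F} (hf0 : f ≠ 0)
    (hf : f ∈ boundedPoles hv Set.univ D) (P : ι) : v P f = exp (D P) := by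
  classical
  refine le_antisymm (hf P (Set.mem_univ P)) (not_lt.mp fun hlt => hf0 ?_)
  -- A strict inequality at P would put f in the space of D - P, of degree -1.
  apply eq_zero_of_divisorDegree_neg hv hK h0 hh (D := D + Finsupp.single P (-1))
  · rw [divisorDegree_add, divisorDegree_single, hD]; norm_num
  · intro Q _
    rw [Finsupp.add_apply, Finsupp.single_apply]
    split_ifs with hQ
    · subst hQ
      rw [lt_exp_iff_le_exp_sub_one] at hlt
      exact hlt
    · rw [add_zero]
      exact hf Q (Set.mem_univ Q)

lemma exists_ne_zero_of_ell_pos {d : ι → ℤ} (h : 0 < ell hv d) :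
    ∃ f : F, f ≠ 0 ∧ f ∈ boundedPoles hv Set.univ d := by
  rw [ell, Nat.cast_pos] at h
  have := Module.nontrivial_of_finrank_pos h
  obtain ⟨x, hx⟩ := exists_ne (0 : boundedPoles hv Set.univ d)
  exact ⟨x.1, fun hx0 => hx (Subtype.ext hx0), x.2⟩

lemma ell_zero_pos : 0 < ell hv (0 : ι →₀ ℤ) := by
  have := finiteDimensional_boundedPoles hv (0 : ι →₀ ℤ)
  rw [ell, Nat.cast_pos]
  have : Nontrivial (boundedPoles hv Set.univ (0 : ι →₀ ℤ)) :=
    ⟨⟨⟨1, fun P _ => by simp⟩, 0, fun h => one_ne_zero (congrArg Subtype.val h)⟩⟩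
  exact Module.finrank_pos

include hv hK in
/-- On a curve with anticanonical divisor of positive degree, divisors of degree zero are
principal. -/
theorem exists_valuation_eq_of_canonical_neg (h0 : h ≠ 0) (hh : ∀ P, v P h = exp (K₀ P - K P))
    (hneg : divisorDegree K < 0) {D : ι →₀ ℤ} (hD : divisorDegree D = 0) :
    ∃ f : F, f ≠ 0 ∧ ∀ P, v P f = exp (D P) := by
  have h1 := eulerChar_eq hv hK h0 hh D
  have h2 : ell hv K = 0 := by
    rw [ell, Nat.cast_eq_zero]
    have := finiteDimensional_boundedPoles hv K
    rw [Submodule.finrank_eq_zero, eq_bot_iff]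
    intro f hf
    exact eq_zero_of_divisorDegree_neg hv hK h0 hh hneg hf
  -- Riemann–Roch becomes ell(D) = ell(0) + ell(K - D) > 0.
  rw [eulerChar, eulerChar, sub_zero, h2, hD] at h1
  have h3 := ell_zero_pos hv
  have h4 : 0 ≤ ell hv (K - D : ι →₀ ℤ) := Nat.cast_nonneg _
  obtain ⟨f, hf0, hf⟩ := exists_ne_zero_of_ell_pos hv (d := D) (by linarith)
  exact ⟨f, hf0, valuation_eq_of_divisorDegree_eq_zero hv hK h0 hh hD hf0 hf⟩

include hv hK in
/-- A canonical divisor of degree zero is principal. -/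
theorem exists_valuation_eq_canonical (h0 : h ≠ 0) (hh : ∀ P, v P h = exp (K₀ P - K P))
    (hdeg : divisorDegree K = 0) :
    ∃ f : F, f ≠ 0 ∧ ∀ P, v P f = exp (K P) := by
  have h1 := eulerChar_eq hv hK h0 hh K
  -- Riemann–Roch for D = K becomes 2 ell(K) = 2 ell(0).
  rw [eulerChar, eulerChar, sub_zero, sub_self, hdeg] at h1
  have h3 := ell_zero_pos hv
  obtain ⟨f, hf0, hf⟩ := exists_ne_zero_of_ell_pos hv (d := K) (by linarith)
  exact ⟨f, hf0, valuation_eq_of_divisorDegree_eq_zero hv hK h0 hh hdeg hf0 hf⟩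

end RiemannRochConsequences

end

section

open WithZero IsDedekindDomain Polynomial
open scoped nonZeroDivisors

/-! ### Triviality of extensions that are injective on primes. -/

section Bijective

attribute [local instance] FractionRing.liftAlgebra FractionRing.isScalarTower_liftAlgebra

/-- If the primes of an integral closure `B` are determined by their contractions and have trivial
residue extensions, and there are infinitely many of them, then the extension is trivial. -/
theorem finrank_eq_one_of_comap_injective (R B E F : Type*) [CommRing R] [IsDedekindDomain R]
    [CommRing B] [IsDedekindDomain B] [Field E] [Field F] [Algebra R E] [IsFractionRing R E]
    [Algebra B F] [IsFractionRing B F] [Algebra R B] [Algebra R F] [Algebra E F]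
    [IsScalarTower R E F] [IsScalarTower R B F] [Module.Finite R B] [Module.IsTorsionFree R B]
    [CharZero R] [Infinite (HeightOneSpectrum B)]
    (hinj : ∀ w w' : HeightOneSpectrum B, w.asIdeal.comap (algebraMap R B) =
      w'.asIdeal.comap (algebraMap R B) → w = w')
    (hres : ∀ (w : HeightOneSpectrum B) (b : B), ∃ r : R, b - algebraMap R B r ∈ w.asIdeal) :
    Module.finrank E F = 1 := by
  have : CharZero (FractionRing R) :=
    charZero_of_injective_algebraMap (IsFractionRing.injective R (FractionRing R))
  have : Algebra.IsSeparable (FractionRing R) (FractionRing B) := inferInstance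
  have hdiff : differentIdeal R B ≠ ⊥ := differentIdeal_ne_bot
  -- Only finitely many primes divide the different, so some w is unramified.
  obtain ⟨w, hw⟩ : ∃ w : HeightOneSpectrum B, ¬ w.asIdeal ∣ differentIdeal R B := by
    by_contra! h
    have := Ideal.finite_factors hdiff
    rw [Set.eq_univ_of_forall (s := {v : HeightOneSpectrum B | v.asIdeal ∣ differentIdeal R B}) h]
      at this
    exact Set.infinite_univ this
  set p := w.asIdeal.comap (algebraMap R B) with hp
  have hwmax : w.asIdeal.IsMaximal := w.isMaximal
  have : Algebra.IsIntegral R B := inferInstance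
  have hpmax : p.IsMaximal := Ideal.isMaximal_comap_of_isIntegral_of_isMaximal w.asIdeal
  have hp0 : p ≠ ⊥ := Ideal.comap_ne_bot_of_integral_mem
    (Submodule.exists_mem_ne_zero_of_ne_bot w.ne_bot).choose_spec.2
    (Submodule.exists_mem_ne_zero_of_ne_bot w.ne_bot).choose_spec.1
    (Algebra.IsIntegral.isIntegral _)
  have hmap0 : p.map (algebraMap R B) ≠ ⊥ := by
    rw [ne_eq, Ideal.map_eq_bot_iff_of_injective (FaithfulSMul.algebraMap_injective R B)]
    exact hp0
  obtain ⟨Q, hQ⟩ : w.asIdeal ∣ p.map (algebraMap R B) := Ideal.dvd_iff_le.mpr Ideal.map_comap_le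
  -- A prime containing Q also lies over p, so it is w by injectivity. Then w² divides pB, and w
  -- would divide the different.
  have hQtop : Q = ⊤ := by
    by_contra hne
    obtain ⟨M, hM, hQM⟩ := Ideal.exists_le_maximal Q hne
    have hpM : p.map (algebraMap R B) ≤ M := hQ ▸ Ideal.mul_le_right.trans hQM
    have hM0 : M ≠ ⊥ := fun h => hmap0 (le_bot_iff.mp (h ▸ hpM))
    have hwM : w = ⟨M, hM.isPrime, hM0⟩ := by
      apply hinj
      exact hpmax.eq_of_le (Ideal.comap_ne_top _ hM.ne_top) (Ideal.map_le_iff_le_comap.mp hpM)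
    have h2 : w.asIdeal ^ 2 ∣ p.map (algebraMap R B) := by
      rw [hQ, pow_two]
      refine mul_dvd_mul_left _ (Ideal.dvd_iff_le.mpr ?_)
      rw [hwM]
      exact hQM
    exact hw (by simpa using pow_sub_one_dvd_differentIdeal (A := R) w.asIdeal 2 hp0 h2)
  have hmap : p.map (algebraMap R B) = w.asIdeal := by rw [hQ, hQtop, Ideal.mul_top]
  have hpR : p.IsPrime := hpmax.isPrime
  -- The degree equals the dimension of B/pB = B/w over R/p, and that residue extension is trivial.
  rw [← Ideal.finrank_quotient_map (S := B) p E F]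
  let _ : Field (R ⧸ p) := Ideal.Quotient.field p
  refine finrank_eq_one (R := R ⧸ p) (1 : B ⧸ p.map (algebraMap R B)) ?_ ?_
  · rw [← map_one (Ideal.Quotient.mk _), ne_eq, Ideal.Quotient.eq_zero_iff_mem, hmap]
    exact fun h => hwmax.ne_top ((Ideal.eq_top_iff_one _).mpr h)
  · intro x
    obtain ⟨b, rfl⟩ := Ideal.Quotient.mk_surjective x
    obtain ⟨r, hr⟩ := hres w b
    refine ⟨Ideal.Quotient.mk p r, ?_⟩
    rw [← hmap, ← Ideal.Quotient.eq] at hr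
    rw [Algebra.smul_def, mul_one, hr]
    rfl

end Bijective

/-! ### Infinitely many primes. -/

section Places

variable {k : Type*} [Field k]

/-- Lying over gives a prime above each X - a, and no proper ideal contains both X - a and X - b for
a ≠ b. -/
lemma infinite_heightOneSpectrum_of_isIntegral [Infinite k] (B : Type*) [CommRing B] [IsDomain B]
    [Algebra k[X] B] [Algebra.IsIntegral k[X] B] (hinj : Function.Injective (algebraMap k[X] B)) :
    Infinite (HeightOneSpectrum B) := by
  have : FaithfulSMul k[X] B := (faithfulSMul_iff_algebraMap_injective _ _).mpr hinj
  have h : ∀ a : k, ∃ w : HeightOneSpectrum B, algebraMap k[X] B (X - C a) ∈ w.asIdeal := by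
    intro a
    have hmax : (Ideal.span {X - C a}).IsMaximal := by
      rw [← ker_evalRingHom]
      exact RingHom.ker_isMaximal_of_surjective _ fun c => ⟨C c, by simp⟩
    obtain ⟨Q, hQ, hQa⟩ := Ideal.exists_ideal_over_prime_of_isIntegral (Ideal.span {X - C a})
      (⊥ : Ideal B) (by
        intro x hx
        rw [Ideal.mem_comap, Ideal.mem_bot] at hx
        rw [(map_eq_zero_iff _ hinj).mp hx]
        exact zero_mem _)
    have hmem : algebraMap k[X] B (X - C a) ∈ Q := by
      rw [← Ideal.mem_comap, hQa.2]
      exact Ideal.mem_span_singleton_self _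
    refine ⟨⟨Q, hQa.1, fun h0 => ?_⟩, hmem⟩
    rw [h0, Ideal.mem_bot, map_eq_zero_iff _ hinj] at hmem
    exact X_sub_C_ne_zero a hmem
  choose f hf using h
  refine Infinite.of_injective f fun a b hab => ?_
  by_contra hne
  have h1 := hf a
  rw [hab] at h1
  have h2 := sub_mem h1 (hf b)
  rw [← map_sub, sub_sub_sub_cancel_left, ← C_sub] at h2
  refine (f b).isPrime.ne_top (Ideal.eq_top_of_isUnit_mem _ h2 (IsUnit.map _ ?_))
  exact isUnit_C.mpr (IsUnit.mk0 _ (sub_ne_zero.mpr (Ne.symm hne)))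

end Places

/-! ### Restriction of places to a subfield. -/

section Restriction

variable {k E F : Type*} [Field k] [Field E] [Field F] [Algebra k F] [Algebra E F]
  {ι : Type*} {v : ι → Valuation F ℤᵐ⁰}

lemma finrank_eq_one_of_comap_valuationSubring_injective (hv : IsPlaceSystem k v) [CharZero E]
    (hinj : ∀ P Q, (v P).valuationSubring.comap (algebraMap E F) =
      (v Q).valuationSubring.comap (algebraMap E F) → P = Q)
    (R B : Type*) [CommRing R] [IsDedekindDomain R] [Algebra R E] [IsFractionRing R E]
    [Algebra R F] [IsScalarTower R E F] [FiniteDimensional E F] [Algebra k R]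
    [IsScalarTower k R F] [CommRing B] [IsDedekindDomain B] [Algebra R B] [Algebra B F]
    [IsScalarTower R B F] [IsFractionRing B F] [IsIntegralClosure B R F]
    [Infinite (HeightOneSpectrum B)] : Module.finrank E F = 1 := by
  have : Module.Finite R B := IsIntegralClosure.finite R E F B
  have hRF : Function.Injective (algebraMap R F) := by
    rw [IsScalarTower.algebraMap_eq R E F]
    exact (algebraMap E F).injective.comp (IsFractionRing.injective R E)
  have hRB : Function.Injective (algebraMap R B) := by
    rw [IsScalarTower.algebraMap_eq R B F, RingHom.coe_comp] at hRF
    exact Function.Injective.of_comp hRF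
  have : Module.IsTorsionFree R B := Module.isTorsionFree_iff_algebraMap_injective.mpr hRB
  have : CharZero R := ⟨fun a b hab => by
    have := congrArg (algebraMap R E) hab
    simpa using this⟩
  refine finrank_eq_one_of_comap_injective R B E F (fun w w' h => ?_) fun w b => ?_
  · apply placeOfPrime_injective hv R B
    apply hinj
    have hwmax : w.asIdeal.IsMaximal := w.isMaximal
    let u : HeightOneSpectrum R := ⟨w.asIdeal.comap (algebraMap R B), inferInstance,
      Ideal.comap_ne_bot_of_integral_mem
        (Submodule.exists_mem_ne_zero_of_ne_bot w.ne_bot).choose_spec.2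
        (Submodule.exists_mem_ne_zero_of_ne_bot w.ne_bot).choose_spec.1
        (Algebra.IsIntegral.isIntegral _)⟩
    have h1 : w.asIdeal.LiesOver u.asIdeal := ⟨rfl⟩
    have h2 : w'.asIdeal.LiesOver u.asIdeal := ⟨h⟩
    -- If w and w' lie over the same u, their valuations restrict to `E` as positive powers of that
    -- of u. The exponents do not affect being at most 1, so the restricted valuation rings agree.
    ext x
    rw [ValuationSubring.mem_comap, ValuationSubring.mem_comap, Valuation.mem_valuationSubring_iff,
      Valuation.mem_valuationSubring_iff, valuation_placeOfPrime hv R B, valuation_placeOfPrime hv R B,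
      ← HeightOneSpectrum.valuation_liesOver F u w, ← HeightOneSpectrum.valuation_liesOver F u w',
      pow_le_one_iff (Ideal.IsDedekindDomain.ramificationIdx'_ne_zero_of_liesOver _ u.ne_bot),
      pow_le_one_iff (Ideal.IsDedekindDomain.ramificationIdx'_ne_zero_of_liesOver _ u.ne_bot)]
  · obtain ⟨c, hc⟩ := hv.exists_residue (placeOfPrime hv R B w) (algebraMap B F b) (by
      rw [valuation_placeOfPrime hv R B]
      exact w.valuation_le_one b)
    refine ⟨algebraMap k R c, ?_⟩
    rw [valuation_placeOfPrime hv R B, IsScalarTower.algebraMap_apply k R F,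
      IsScalarTower.algebraMap_apply R B F, ← map_sub,
      HeightOneSpectrum.valuation_lt_one_iff_mem] at hc
    exact hc

variable [Algebra (RatFunc k) F] [IsScalarTower k (RatFunc k) F]
  [Algebra k[X] F] [IsScalarTower k[X] (RatFunc k) F]
  [Algebra (RatFunc k) E] [Algebra k[X] E] [IsScalarTower k[X] (RatFunc k) E]
  [IsScalarTower (RatFunc k) E F]

/-- If distinct places of `F` restrict to distinct valuation rings of a subfield `E` containing a
separating variable, then `E = F`. -/
theorem surjective_algebraMap_of_comap_injective [CharZero k] (hv : IsPlaceSystem k v)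
    [FiniteDimensional (RatFunc k) F]
    (hinj : ∀ P Q, (v P).valuationSubring.comap (algebraMap E F) =
      (v Q).valuationSubring.comap (algebraMap E F) → P = Q) :
    Function.Surjective (algebraMap E F) := by
  have : FiniteDimensional (RatFunc k) E := FiniteDimensional.left _ E F
  have : FiniteDimensional E F := FiniteDimensional.right (RatFunc k) E F
  have : IsScalarTower k[X] E F := .of_algebraMap_eq fun p => by
    rw [IsScalarTower.algebraMap_apply k[X] (RatFunc k) F,
      IsScalarTower.algebraMap_apply k[X] (RatFunc k) E,
      ← IsScalarTower.algebraMap_apply (RatFunc k) E F]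
  let R := integralClosure k[X] E
  have : IsDedekindDomain R := integralClosure.isDedekindDomain k[X] (RatFunc k) E
  have : IsFractionRing R E := integralClosure.isFractionRing_of_finite_extension (RatFunc k) E
  have : CharZero E := charZero_of_injective_algebraMap (algebraMap (RatFunc k) E).injective
  have : IsDedekindDomain (integralClosure R F) := integralClosure.isDedekindDomain R E F
  have : IsFractionRing (integralClosure R F) F :=
    integralClosure.isFractionRing_of_finite_extension E F
  have hXF : Function.Injective (algebraMap k[X] F) := by
    rw [IsScalarTower.algebraMap_eq k[X] (RatFunc k) F]
    exact (algebraMap (RatFunc k) F).injective.comp (IsFractionRing.injective k[X] (RatFunc k))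
  have hint : Algebra.IsIntegral k[X] (integralClosure R F) := Algebra.IsIntegral.trans R
  have : Infinite (HeightOneSpectrum (integralClosure R F)) := by
    apply infinite_heightOneSpectrum_of_isIntegral (integralClosure R F) (k := k)
    rw [IsScalarTower.algebraMap_eq k[X] (integralClosure R F) F, RingHom.coe_comp] at hXF
    exact Function.Injective.of_comp hXF
  let i : k →+* R := (algebraMap k[X] R).comp C
  let _ : Algebra k R := i.toAlgebra
  have : IsScalarTower k R F := .of_algebraMap_eq fun c => by
    change _ = algebraMap R F (algebraMap k[X] R (C c))
    rw [← IsScalarTower.algebraMap_apply k[X] R F, IsScalarTower.algebraMap_apply k[X] (RatFunc k) F,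
      IsScalarTower.algebraMap_apply k (RatFunc k) F]
    congr 1
  have hone : Module.finrank E F = 1 :=
    finrank_eq_one_of_comap_valuationSubring_injective hv hinj R (integralClosure R F)
  have h1 := Subalgebra.bot_eq_top_of_finrank_eq_one hone
  intro x
  have : x ∈ (⊥ : Subalgebra E F) := h1 ▸ Algebra.mem_top
  exact Algebra.mem_bot.mp this

end Restriction

end

section

open IsLocalRing

/-! ### Projective morphisms are proper. -/

section Proper

namespace CurvePair

variable {k : Type u} [Field k]

-- Proj is proper over the spectrum of the degree-zero part, which for a polynomial ring is k
-- itself.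
attribute [local instance] MvPolynomial.gradedAlgebra in
lemma isProper_projectiveSpaceStr (n : ℕ) : IsProper (projectiveSpaceStr k n) := by
  have hinj : Function.Injective
      (algebraMap k (MvPolynomial.homogeneousSubmodule (Fin (n + 1)) k 0)) := fun a b hab =>
    MvPolynomial.C_injective (Fin (n + 1)) k (congrArg Subtype.val hab)
  have hsurj : Function.Surjective
      (algebraMap k (MvPolynomial.homogeneousSubmodule (Fin (n + 1)) k 0)) := by
    rintro ⟨p, hp⟩
    obtain ⟨c, rfl⟩ : ∃ c, p = MvPolynomial.C c :=
      ⟨_, MvPolynomial.totalDegree_eq_zero_iff_eq_C.mp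
        (Nat.le_zero.mp (MvPolynomial.IsHomogeneous.totalDegree_le hp))⟩
    exact ⟨c, rfl⟩
  have : IsScalarTower k (MvPolynomial.homogeneousSubmodule (Fin (n + 1)) k 0)
      (MvPolynomial (Fin (n + 1)) k) := 
    ⟨fun a b c => smul_mul_assoc a (b : MvPolynomial (Fin (n + 1)) k) c⟩
  have : Algebra.FiniteType (MvPolynomial.homogeneousSubmodule (Fin (n + 1)) k 0)
      (MvPolynomial (Fin (n + 1)) k) :=
    Algebra.FiniteType.of_restrictScalars_finiteType k _ _
  have : IsIso (CommRingCat.ofHom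
      (algebraMap k (MvPolynomial.homogeneousSubmodule (Fin (n + 1)) k 0))) :=
    (ConcreteCategory.isIso_iff_bijective _).mpr ⟨hinj, hsurj⟩
  have h1 : IsProper (Proj.toSpecZero (MvPolynomial.homogeneousSubmodule (Fin (n + 1)) k)) :=
    inferInstance
  exact MorphismProperty.comp_mem @IsProper _ _ h1 inferInstance

lemma IsProjectiveMorphism.isProper {X S : Scheme.{u}} {f : X ⟶ S} {s : S ⟶ Spec (.of k)}
    (h : IsProjectiveMorphism f s) : IsProper f := by
  obtain ⟨n, i, hi, rfl⟩ := h
  have := isProper_projectiveSpaceStr (k := k) n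
  infer_instance

end CurvePair

end Proper

/-! ### Valuation rings and their centres on a scheme. -/

section Domination

variable {X : Scheme.{u}} [AlgebraicGeometry.IsIntegral X]

/-- A valuation ring of the function field dominates the local ring at a point. -/
def Dominates (A : ValuationSubring X.functionField) (x : X) : Prop :=
  ∀ a : X.presheaf.stalk x, algebraMap (X.presheaf.stalk x) X.functionField a ∈ A ∧
    (a ∈ maximalIdeal (X.presheaf.stalk x) →
      A.valuation (algebraMap (X.presheaf.stalk x) X.functionField a) < 1)

/-- The map from the spectrum of the function field to `X`. -/
noncomputable def fromSpecFunctionField (X : Scheme.{u}) [AlgebraicGeometry.IsIntegral X] :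
    Spec (.of X.functionField) ⟶ X :=
  X.fromSpecStalk (genericPoint X)

lemma SpecMap_algebraMap_fromSpecStalk (x : X) :
    Spec.map (CommRingCat.ofHom (algebraMap (X.presheaf.stalk x) X.functionField)) ≫
      X.fromSpecStalk x = fromSpecFunctionField X :=
  Scheme.SpecMap_stalkSpecializes_fromSpecStalk ((genericPoint_spec X).specializes trivial)

/-- The inclusion of a local ring into a dominating valuation ring. -/
noncomputable def Dominates.ringHom {A : ValuationSubring X.functionField} {x : X}
    (h : Dominates A x) : X.presheaf.stalk x →+* A :=
  (algebraMap (X.presheaf.stalk x) X.functionField).codRestrict A.toSubring fun a => (h a).1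

lemma Dominates.isLocalHom_ringHom {A : ValuationSubring X.functionField} {x : X}
    (h : Dominates A x) : IsLocalHom h.ringHom := by
  refine ⟨fun a ha => ?_⟩
  by_contra hna
  have h1 := (h a).2 ((mem_maximalIdeal a).mpr hna)
  exact absurd ((A.valuation_eq_one_iff _).mp ha) h1.ne

/-- The map from the spectrum of a valuation ring dominating a local ring. -/
noncomputable def Dominates.hom {A : ValuationSubring X.functionField} {x : X}
    (h : Dominates A x) : Spec (.of A) ⟶ X :=
  Spec.map (CommRingCat.ofHom h.ringHom) ≫ X.fromSpecStalk x

lemma Dominates.SpecMap_hom {A : ValuationSubring X.functionField} {x : X}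
    (h : Dominates A x) :
    Spec.map (CommRingCat.ofHom (algebraMap A X.functionField)) ≫ h.hom =
      fromSpecFunctionField X := by
  rw [Dominates.hom, ← Spec.map_comp_assoc, ← SpecMap_algebraMap_fromSpecStalk x]
  rfl

lemma Dominates.hom_closedPoint {A : ValuationSubring X.functionField} {x : X}
    (h : Dominates A x) : h.hom (closedPoint A) = x := by
  have := h.isLocalHom_ringHom
  exact (congrArg _ (comap_closedPoint h.ringHom)).trans Scheme.fromSpecStalk_closedPoint

/-- On a separated scheme a valuation ring of the function field dominates at most one local
ring. -/
theorem Dominates.eq {R : Type u} [CommRing R] (f : X ⟶ Spec (.of R)) [IsSeparated f]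
    {A : ValuationSubring X.functionField} {x y : X}
    (hx : Dominates A x) (hy : Dominates A y) : x = y := by
  -- The two maps agree at the generic point of Spec A; as the base is affine and A embeds in its
  -- fraction field, they agree over the base and are lifts in one valuative square.
  have hcomp : hx.hom ≫ f = hy.hom ≫ f := by
    obtain ⟨φ, hφ⟩ := Spec.map_surjective (hx.hom ≫ f)
    obtain ⟨ψ, hψ⟩ := Spec.map_surjective (hy.hom ≫ f)
    rw [← hφ, ← hψ]
    congr 1
    have h1 : Spec.map (CommRingCat.ofHom (algebraMap A X.functionField)) ≫ Spec.map φ =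
        Spec.map (CommRingCat.ofHom (algebraMap A X.functionField)) ≫ Spec.map ψ := by
      rw [hφ, hψ, ← Category.assoc, ← Category.assoc, hx.SpecMap_hom, hy.SpecMap_hom]
    rw [← Spec.map_comp, ← Spec.map_comp] at h1
    have h2 := Spec.map_injective h1
    refine CommRingCat.hom_ext (RingHom.ext fun r => ?_)
    have h3 := congrArg (fun g => g.hom r) h2
    exact Subtype.val_injective h3
  let S : ValuativeCommSq f :=
    { R := A
      K := X.functionField
      i₁ := fromSpecFunctionField X
      i₂ := hx.hom ≫ f
      commSq := ⟨by rw [← hx.SpecMap_hom, Category.assoc]⟩ }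
  have := IsSeparated.valuativeCriterion f S
  let l₁ : S.commSq.LiftStruct := ⟨hx.hom, hx.SpecMap_hom, rfl⟩
  let l₂ : S.commSq.LiftStruct := ⟨hy.hom, hy.SpecMap_hom, hcomp.symm⟩
  have h : hx.hom = hy.hom := congrArg CommSq.LiftStruct.l (Subsingleton.elim l₁ l₂)
  rw [← hx.hom_closedPoint, ← hy.hom_closedPoint, h]

/-- On a scheme proper over a ring `R` every valuation ring of the function field containing `R`
dominates a local ring. -/
theorem exists_dominates {R : Type u} [CommRing R] (f : X ⟶ Spec (.of R)) [IsProper f]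
    (A : ValuationSubring X.functionField) (φ : R →+* A)
    (hφ : fromSpecFunctionField X ≫ f =
      Spec.map (CommRingCat.ofHom ((algebraMap A X.functionField).comp φ))) :
    ∃ x : X, Dominates A x := by
  have hval : ValuativeCriterion.Existence f := by
    have : UniversallyClosed f := inferInstance
    rw [UniversallyClosed.eq_valuativeCriterion] at this
    exact this.1
  let S : ValuativeCommSq f :=
    { R := A
      K := X.functionField
      i₁ := fromSpecFunctionField X
      i₂ := Spec.map (CommRingCat.ofHom φ)
      commSq := ⟨by rw [hφ, ← Spec.map_comp]; rfl⟩ }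
  obtain ⟨⟨l⟩⟩ := hval S
  obtain ⟨l, hl, -⟩ := l
  have : IsLocalRing (CommRingCat.of A) := inferInstanceAs (IsLocalRing A)
  let l' : Spec (.of A) ⟶ X := l
  let x := l' (closedPoint (CommRingCat.of A))
  let ψ : X.presheaf.stalk x ⟶ .of A := Scheme.stalkClosedPointTo l'
  have hψ : ψ ≫ CommRingCat.ofHom (algebraMap A X.functionField) =
      CommRingCat.ofHom (algebraMap (X.presheaf.stalk x) X.functionField) := by
    apply Spec.map_injective
    rw [← cancel_mono (X.fromSpecStalk x), SpecMap_algebraMap_fromSpecStalk, Spec.map_comp,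
      Category.assoc, Scheme.Spec_stalkClosedPointTo_fromSpecStalk]
    exact hl
  have key : ∀ a, algebraMap (X.presheaf.stalk x) X.functionField a = (ψ.hom a : A) := fun a =>
    (congrArg (fun g => g.hom a) hψ).symm
  refine ⟨x, fun a => ?_⟩
  rw [key]
  refine ⟨(ψ.hom a).2, fun ha => ?_⟩
  have hloc : IsLocalHom ψ.hom := inferInstanceAs (IsLocalHom (Scheme.stalkClosedPointTo l').hom)
  exact (A.valuation_lt_one_iff _).mp (map_nonunit ψ.hom a ha)

end Domination

end

section

open IsLocalRing

/-! ### Points of one-dimensional schemes. -/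

section Topology

variable {X : Scheme.{u}} [AlgebraicGeometry.IsIntegral X]

/-- Dimension is computed in the specialization order. A non-generic point has coheight at least 1,
and a proper specialization of it would have coheight at least 2. -/
lemma isClosed_singleton_of_topologicalKrullDim_eq_one (hdim : topologicalKrullDim X = 1) {x : X}
    (hx : x ≠ genericPoint X) : IsClosed {x} ∧ Order.coheight x = 1 := by
  have hkrull : Order.krullDim X = 1 := by
    rw [← hdim, topologicalKrullDim]
    exact (Order.krullDim_eq_of_orderIso
      (irreducibleSetEquivPoints : TopologicalSpace.IrreducibleCloseds X ≃o X)).symm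
  have hle : ∀ y : X, Order.coheight y ≤ 1 := fun y => by
    have := Order.coheight_le_krullDim y
    rw [hkrull] at this
    exact_mod_cast this
  have hlt : ∀ {y z : X}, z ⤳ y → y ≠ z → Order.coheight z + 1 ≤ Order.coheight y := by
    intro y z h hne
    refine Order.coheight_add_one_le (lt_iff_le_not_ge.mpr ⟨h, fun h' => hne ?_⟩)
    exact (Specializes.antisymm h h').eq.symm
  have h1 : 1 ≤ Order.coheight x :=
    le_trans (by simp) (hlt (genericPoint_specializes x) hx)
  refine ⟨?_, le_antisymm (hle x) h1⟩
  rw [← closure_eq_iff_isClosed]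
  refine Set.Subset.antisymm (fun y hy => ?_) subset_closure
  by_contra hne
  have h2 := hlt (specializes_iff_mem_closure.mpr hy) hne
  have h3 := (add_le_add h1 le_rfl).trans (h2.trans (hle y))
  exact absurd h3 (by norm_num)

lemma ne_genericPoint_of_coheight_eq_one {x : X} (hx : Order.coheight x = 1) :
    x ≠ genericPoint X := by
  rintro rfl
  rw [Order.IsMax.coheight_eq_zero (fun y _ => genericPoint_specializes y)] at hx
  exact zero_ne_one hx

/-- Proper closed subsets of a one-dimensional scheme are finite. -/
lemma IsClosed.finite_of_topologicalKrullDim_eq_one [TopologicalSpace.NoetherianSpace X]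
    (hdim : topologicalKrullDim X = 1) {S : Set X} (hS : IsClosed S)
    (hgen : genericPoint X ∉ S) : S.Finite := by
  obtain ⟨T, hT, hclosed, hirr, rfl⟩ :=
    TopologicalSpace.NoetherianSpace.exists_finite_set_isClosed_irreducible hS
  refine hT.sUnion fun t ht => ?_
  have h1 := (hirr t ht).isGenericPoint_genericPoint (hclosed t ht)
  have h2 : (hirr t ht).genericPoint ≠ genericPoint X := fun h =>
    hgen (Set.mem_sUnion_of_mem (h ▸ h1.mem) ht)
  rw [← h1.def, (isClosed_singleton_of_topologicalKrullDim_eq_one hdim h2).1.closure_eq]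
  exact Set.finite_singleton _

end Topology

namespace CurvePair

/-! ### Valuations at the points of a normal curve. -/

section Curve

variable {k : Type u} [Field k] {X : Variety k}

lemma isDiscreteValuationRing_stalk (hX : X.IsNormal) (P : PrimeDivisor X) :
    IsDiscreteValuationRing (X.scheme.presheaf.stalk P.1) := by
  have h1 : ringKrullDim (X.scheme.presheaf.stalk P.1) = 1 := by
    rw [ringKrullDim_stalk_eq_coheight, P.2]; rfl
  have h2 : Ring.KrullDimLE 1 (X.scheme.presheaf.stalk P.1) := krullDimLE_of_coheight_le P.2.le
  have h3 : ¬ IsField (X.scheme.presheaf.stalk P.1) := fun h => by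
    rw [ringKrullDim_eq_zero_of_isField h] at h1
    exact zero_ne_one h1
  have h4 := (IsDiscreteValuationRing.TFAE _ h3).out 3 0
  refine h4.mp ⟨hX P.1, maximalIdeal _, ⟨isField_iff_maximalIdeal_eq.not.mp h3, inferInstance⟩, ?_⟩
  rintro I ⟨hI, hI'⟩
  exact eq_maximalIdeal (Ring.krullDimLE_one_iff_of_isPrime_bot.mp h2 I hI hI')

open WithZero

/-- The valuation of the function field at a point of codimension one. -/
noncomputable def placeValuation (hX : X.IsNormal) (P : PrimeDivisor X) :
    Valuation X.functionField ℤᵐ⁰ :=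
  have := isDiscreteValuationRing_stalk hX P
  (IsDiscreteValuationRing.maximalIdeal (X.scheme.presheaf.stalk P.1)).valuation X.functionField

lemma placeValuation_eq_exp (hX : X.IsNormal) (P : PrimeDivisor X) {f : X.functionField}
    (hf : f ≠ 0) : placeValuation hX P f = exp (-(ordAt f P)) := by
  have := isDiscreteValuationRing_stalk hX P
  have : Ring.KrullDimLE 1 (X.scheme.presheaf.stalk P.1) := krullDimLE_of_coheight_le P.2.le
  have h1 : Scheme.ordHom P.1 P.2 f = (placeValuation hX P f)⁻¹ :=
    Ring.ordFrac_eq_valuation_inv (R := X.scheme.presheaf.stalk P.1) f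
  have h2 := (Scheme.ord_eq_iff P.2 hf (n := ordAt f P)).mp rfl
  rw [h1] at h2
  rw [exp_neg, ← inv_inv (placeValuation hX P f), h2]
  rfl

lemma placeValuation_surjective (hX : X.IsNormal) (P : PrimeDivisor X) :
    Function.Surjective (placeValuation hX P) := by
  have := isDiscreteValuationRing_stalk hX P
  exact IsDedekindDomain.HeightOneSpectrum.valuation_surjective _ _

lemma placeValuation_algebraMap_le_one (hX : X.IsNormal) (P : PrimeDivisor X)
    (a : X.scheme.presheaf.stalk P.1) :
    placeValuation hX P (algebraMap (X.scheme.presheaf.stalk P.1) X.functionField a) ≤ 1 := by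
  have := isDiscreteValuationRing_stalk hX P
  exact IsDedekindDomain.HeightOneSpectrum.valuation_le_one _ _

lemma placeValuation_algebraMap_lt_one_iff (hX : X.IsNormal) (P : PrimeDivisor X)
    (a : X.scheme.presheaf.stalk P.1) :
    placeValuation hX P (algebraMap (X.scheme.presheaf.stalk P.1) X.functionField a) < 1 ↔
      a ∈ maximalIdeal (X.scheme.presheaf.stalk P.1) := by
  have := isDiscreteValuationRing_stalk hX P
  exact IsDedekindDomain.HeightOneSpectrum.valuation_lt_one_iff_mem _ _

lemma exists_of_placeValuation_le_one (hX : X.IsNormal) (P : PrimeDivisor X)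
    {f : X.functionField} (hf : placeValuation hX P f ≤ 1) :
    ∃ a, algebraMap (X.scheme.presheaf.stalk P.1) X.functionField a = f := by
  have := isDiscreteValuationRing_stalk hX P
  refine IsDedekindDomain.HeightOneSpectrum.mem_integers_of_valuation_le_one _ f fun w => ?_
  have : w = IsDiscreteValuationRing.maximalIdeal (X.scheme.presheaf.stalk P.1) := by
    ext1
    exact IsLocalRing.eq_maximalIdeal w.isMaximal
  rw [this]
  exact hf

lemma placeValuation_irreducible (hX : X.IsNormal) (P : PrimeDivisor X)
    {t : X.scheme.presheaf.stalk P.1} (ht : Irreducible t) :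
    placeValuation hX P (algebraMap (X.scheme.presheaf.stalk P.1) X.functionField t) =
      exp (-1) := by
  have := isDiscreteValuationRing_stalk hX P
  have h := Ring.ordFrac_irreducible (K := X.functionField) ht
  rw [Ring.ordFrac_eq_valuation_inv] at h
  rw [exp_neg, ← h, inv_inv]
  rfl

lemma dominates_valuationSubring (hX : X.IsNormal) (P : PrimeDivisor X) :
    Dominates (placeValuation hX P).valuationSubring P.1 := by
  intro a
  refine ⟨placeValuation_algebraMap_le_one hX P a, fun ha => ?_⟩
  rw [← (Valuation.isEquiv_valuation_valuationSubring (placeValuation hX P)).lt_one_iff_lt_one]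
  exact (placeValuation_algebraMap_lt_one_iff hX P a).mpr ha

end Curve

end CurvePair

end

section

open IsLocalRing WithZero

namespace CurvePair

/-! ### Closed points as a complete system of places. -/

section StalkAlgebra

variable {k : Type u} [Field k] (X : Variety k)

/-- The structure of a `k`-algebra on the local rings of a variety. -/
noncomputable abbrev stalkAlgebra (x : X.scheme) : Algebra k (X.scheme.presheaf.stalk x) :=
  RingHom.toAlgebra ((Scheme.ΓSpecIso (.of k)).inv ≫ X.str.appTop ≫
    X.scheme.presheaf.germ ⊤ x trivial).hom

attribute [local instance] stalkAlgebra

lemma isScalarTower_stalkAlgebra (x : X.scheme) :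
    IsScalarTower k (X.scheme.presheaf.stalk x) X.functionField := by
  refine .of_algebraMap_eq fun c => ?_
  exact (DFunLike.congr_fun (CommRingCat.hom_ext_iff.mp
    (X.scheme.presheaf.germ_stalkSpecializes (U := ⊤) trivial (genericPoint_specializes x)))
    ((X.str.appTop.hom ((Scheme.ΓSpecIso (.of k)).inv.hom c)))).symm

lemma fromSpecStalk_str (x : X.scheme) : X.scheme.fromSpecStalk x ≫ X.str =
    Spec.map (CommRingCat.ofHom (algebraMap k (X.scheme.presheaf.stalk x))) := by
  have h : CommRingCat.ofHom (algebraMap k (X.scheme.presheaf.stalk x)) =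
    (Scheme.ΓSpecIso (.of k)).inv ≫ X.str.appTop ≫ X.scheme.presheaf.germ ⊤ x trivial := rfl
  have h2 : X.str = X.scheme.toSpecΓ ≫ Spec.map X.str.appTop ≫
      Spec.map (Scheme.ΓSpecIso (.of k)).inv := by
    rw [← Category.assoc, ← Scheme.toSpecΓ_naturality]
    simp
  rw [h, Spec.map_comp, Spec.map_comp, ← Scheme.fromSpecStalk_toSpecΓ, Category.assoc,
    Category.assoc, ← h2]

variable {X}

/-- By the Nullstellensatz the residue field at a closed point is k. The point to check, in `h1`, is
that this isomorphism is compatible with the k-algebra structure of the stalk. -/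
lemma exists_sub_algebraMap_mem_maximalIdeal [IsAlgClosed k] {x : X.scheme} (hx : IsClosed {x})
    (a : X.scheme.presheaf.stalk x) :
    ∃ c : k, a - algebraMap k (X.scheme.presheaf.stalk x) c ∈
      maximalIdeal (X.scheme.presheaf.stalk x) := by
  have := X.locallyOfFiniteType
  have h1 : (residueFieldIsoBase X.str x hx).inv =
      CommRingCat.ofHom (algebraMap k (X.scheme.presheaf.stalk x)) ≫ X.scheme.residue x := by
    apply Spec.map_injective
    rw [SpecMap_residueFieldIsoBase_inv, Spec.map_comp, ← fromSpecStalk_str]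
    rfl
  refine ⟨(residueFieldIsoBase X.str x hx).hom (X.scheme.residue x a), ?_⟩
  have h2 : (X.scheme.residue x).hom (algebraMap k (X.scheme.presheaf.stalk x)
      ((residueFieldIsoBase X.str x hx).hom (X.scheme.residue x a))) = X.scheme.residue x a := by
    have := congrArg (fun g => g.hom ((residueFieldIsoBase X.str x hx).hom
      (X.scheme.residue x a))) h1
    refine this.symm.trans ?_
    simp
  rw [← residue_eq_zero_iff, map_sub, sub_eq_zero]
  exact h2.symm

lemma exists_dominates_of_isProjective (hproj : X.IsProjective)
    (A : ValuationSubring X.functionField) (hA : ∀ c, algebraMap k X.functionField c ∈ A) :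
    ∃ x : X.scheme, Dominates A x := by
  have : IsProper X.str := IsProjectiveMorphism.isProper hproj
  exact exists_dominates X.str A ((algebraMap k X.functionField).codRestrict A.toSubring hA)
    (fromSpecStalk_str X _)

lemma eq_of_dominates {A : ValuationSubring X.functionField} {x y : X.scheme}
    (hx : Dominates A x) (hy : Dominates A y) : x = y := by
  have := X.separated
  exact hx.eq X.str hy

lemma eq_top_of_dominates_genericPoint {A : ValuationSubring X.functionField}
    (h : Dominates A (genericPoint X.scheme)) : A = ⊤ := by
  rw [eq_top_iff]
  intro f _
  have h1 := (h f).1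
  change (X.scheme.presheaf.stalkSpecializes _).hom f ∈ A at h1
  rw [TopCat.Presheaf.stalkSpecializes_refl] at h1
  exact h1

lemma dominates_top_genericPoint :
    Dominates (⊤ : ValuationSubring X.functionField) (genericPoint X.scheme) := by
  intro a
  refine ⟨trivial, fun ha => ?_⟩
  have hf : IsField (X.scheme.presheaf.stalk (genericPoint X.scheme)) :=
    Field.toIsField X.functionField
  rw [isField_iff_maximalIdeal_eq.mp hf, Ideal.mem_bot] at ha
  rw [ha, map_zero, map_zero]
  exact zero_lt_one

/-- The valuations at the closed points of a normal projective curve are its places. -/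
theorem isPlaceSystem_placeValuation [IsAlgClosed k] (hX : X.IsNormal) (hproj : X.IsProjective)
    (hdim : topologicalKrullDim X.scheme = 1) : IsPlaceSystem k (placeValuation hX) where
  surjective := placeValuation_surjective hX
  algebraMap_le_one P c := by
    have := isScalarTower_stalkAlgebra X P.1
    rw [IsScalarTower.algebraMap_apply k (X.scheme.presheaf.stalk P.1) X.functionField]
    exact placeValuation_algebraMap_le_one hX P _
  exists_residue P f hf := by
    have := isScalarTower_stalkAlgebra X P.1
    obtain ⟨a, rfl⟩ := exists_of_placeValuation_le_one hX P hf
    obtain ⟨c, hc⟩ := exists_sub_algebraMap_mem_maximalIdeal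
      (isClosed_singleton_of_topologicalKrullDim_eq_one hdim
        (ne_genericPoint_of_coheight_eq_one P.2)).1 a
    refine ⟨c, ?_⟩
    rw [IsScalarTower.algebraMap_apply k (X.scheme.presheaf.stalk P.1) X.functionField, ← map_sub]
    exact (placeValuation_algebraMap_lt_one_iff hX P _).mpr hc
  exists_eq A hA hk := by
    -- Properness provides a centre x of `A`, not generic since `A` is not the whole field. An
    -- element of `A` with a pole at x would have its inverse in the maximal ideal of the stalk,
    -- hence a non-unit of `A`.
    obtain ⟨x, hx⟩ := exists_dominates_of_isProjective hproj A hk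
    have hgen : x ≠ genericPoint X.scheme := by
      rintro rfl
      exact hA (eq_top_of_dominates_genericPoint hx)
    let P : PrimeDivisor X :=
      ⟨x, (isClosed_singleton_of_topologicalKrullDim_eq_one hdim hgen).2⟩
    refine ⟨P, ?_⟩
    ext f
    rw [Valuation.mem_valuationSubring_iff]
    constructor
    · intro hf
      obtain ⟨a, rfl⟩ := exists_of_placeValuation_le_one hX P hf
      exact (hx a).1
    · intro hf
      by_contra! hlt
      have h0 : f ≠ 0 := by
        rintro rfl
        simp at hlt
      have h1 : placeValuation hX P f⁻¹ < 1 := by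
        rw [map_inv₀]
        exact inv_lt_one_of_one_lt₀ hlt
      obtain ⟨a, ha⟩ := exists_of_placeValuation_le_one hX P h1.le
      have h2 := (hx a).2 ((placeValuation_algebraMap_lt_one_iff hX P a).mp (ha ▸ h1))
      have h3 : algebraMap (X.scheme.presheaf.stalk x) X.functionField a = f⁻¹ := ha
      rw [h3, map_inv₀] at h2
      rw [← ValuationSubring.valuation_le_one_iff] at hf
      have h4 : A.valuation f ≠ 0 := (map_ne_zero _).mpr h0
      exact absurd ((inv_lt_one₀ (zero_lt_iff.mpr h4)).mp h2) hf.not_gt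
  injective P Q h := Subtype.ext (eq_of_dominates (dominates_valuationSubring hX P)
    (h ▸ dominates_valuationSubring hX Q))

end StalkAlgebra

end CurvePair

end

section

open Polynomial

/-! ### Transcendence degree of the function field of a curve. -/

section Dimension

variable {k : Type u} [Field k]

/-- The chain consists of the ideal of a line through the origin in a coordinate hyperplane and the
ideal of the origin. -/
lemma exists_chain_mvPolynomial (k : Type u) [Field k] {s : ℕ} (hs : 2 ≤ s) :
    ∃ p q : Ideal (MvPolynomial (Fin s) k), p.IsPrime ∧ q.IsPrime ∧ p ≠ ⊥ ∧ p < q := by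
  let i : Fin s := ⟨0, by omega⟩
  let j : Fin s := ⟨1, by omega⟩
  have hij : j ≠ i := by simp [i, j, Fin.ext_iff]
  let f : MvPolynomial (Fin s) k →ₐ[k] k[X] :=
    MvPolynomial.aeval fun l => if l = i then 0 else X
  let g : MvPolynomial (Fin s) k →ₐ[k] k := (aeval (0 : k)).comp f
  have hlt : RingHom.ker f < RingHom.ker g := by
    rw [lt_iff_le_not_ge]
    refine ⟨fun a ha => ?_, fun h => ?_⟩
    · rw [RingHom.mem_ker] at ha ⊢
      rw [AlgHom.comp_apply, ha, map_zero]
    · have h1 : MvPolynomial.X j ∈ RingHom.ker g := by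
        simp [g, f, hij]
      have h2 := h h1
      rw [RingHom.mem_ker] at h2
      simp [f, hij] at h2
  refine ⟨RingHom.ker f, RingHom.ker g, RingHom.ker_isPrime f, RingHom.ker_isPrime g,
    fun h => ?_, hlt⟩
  have h1 : MvPolynomial.X i ∈ RingHom.ker f := by simp [f]
  rw [h, Ideal.mem_bot] at h1
  exact MvPolynomial.X_ne_zero i h1

/-- The transcendence degree of a finitely generated domain in which nonzero primes are maximal. -/
theorem trdeg_le_one_of_forall_isPrime (A : Type u) [CommRing A] [IsDomain A] [Algebra k A]
    [Algebra.FiniteType k A]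
    (hA : ∀ p q : Ideal A, p.IsPrime → q.IsPrime → p ≠ ⊥ → p ≤ q → p = q) :
    Algebra.trdeg k A ≤ 1 := by
  obtain ⟨s, g, hg, hint⟩ := exists_integral_inj_algHom_of_fg k A
  let _ : Algebra (MvPolynomial (Fin s) k) A := g.toRingHom.toAlgebra
  have : IsScalarTower k (MvPolynomial (Fin s) k) A := .of_algebraMap_eq fun c => (g.commutes c).symm
  have : FaithfulSMul (MvPolynomial (Fin s) k) A :=
    (faithfulSMul_iff_algebraMap_injective _ _).mpr hg
  have : Algebra.IsIntegral (MvPolynomial (Fin s) k) A := ⟨hint⟩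
  rw [← trdeg_add_eq k (MvPolynomial (Fin s) k) (A := A),
    trdeg_eq_zero (R := MvPolynomial (Fin s) k) (A := A), add_zero,
    MvPolynomial.trdeg_of_isDomain]
  by_contra! hlt
  have hs : 2 ≤ s := by
    simp only [Cardinal.mk_fin, Cardinal.lift_natCast, Nat.one_lt_cast] at hlt
    exact hlt
  -- In the Noether normalization a chain 0 < p < q exists as soon as there are two variables. It
  -- lifts along the integral extension to a chain that `hA` forbids.
  obtain ⟨p, q, hp, hq, hp0, hpq⟩ := exists_chain_mvPolynomial k hs
  obtain ⟨P, -, hP, hPp⟩ := Ideal.exists_ideal_over_prime_of_isIntegral p (⊥ : Ideal A) (by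
    intro x hx
    rw [Ideal.mem_comap, Ideal.mem_bot] at hx
    rw [(map_eq_zero_iff _ hg).mp hx]
    exact zero_mem _)
  obtain ⟨Q, hPQ, hQ, hQq⟩ := Ideal.exists_ideal_over_prime_of_isIntegral q P (hPp ▸ hpq.le)
  have hP0 : P ≠ ⊥ := by
    rintro rfl
    refine hp0 (le_bot_iff.mp fun x hx => ?_)
    rw [← hPp, Ideal.mem_comap, Ideal.mem_bot] at hx
    exact (map_eq_zero_iff _ hg).mp hx
  have := hA P Q hP hQ hP0 hPQ
  rw [← hPp, ← hQq, this] at hpq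
  exact lt_irrefl _ hpq

/-- A function field of transcendence degree at most one is finite over any rational function
subfield. -/
theorem finiteDimensional_ratFunc (A F : Type u) [CommRing A] [IsDomain A] [Algebra k A]
    [Algebra.FiniteType k A] [Field F] [Algebra A F] [IsFractionRing A F] [Algebra k F]
    [IsScalarTower k A F]
    (hA : ∀ p q : Ideal A, p.IsPrime → q.IsPrime → p ≠ ⊥ → p ≤ q → p = q)
    [Algebra (RatFunc k) F] [IsScalarTower k (RatFunc k) F] :
    FiniteDimensional (RatFunc k) F := by
  have h1 : Algebra.trdeg k F ≤ 1 := by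
    have : FaithfulSMul k A := inferInstance
    have : FaithfulSMul A F := inferInstance
    have : Algebra.IsAlgebraic A F := IsLocalization.isAlgebraic (S := F) (nonZeroDivisors A)
    rw [← trdeg_add_eq k A (A := F), trdeg_eq_zero (R := A) (A := F), add_zero]
    exact trdeg_le_one_of_forall_isPrime A hA
  -- The subfield k(X) already accounts for one, so nothing transcendental is left above it.
  have h2 : Algebra.trdeg (RatFunc k) F = 0 := by
    rw [← trdeg_add_eq k (RatFunc k) (A := F)] at h1
    have h3 := trdeg_pos k (RatFunc k)
    by_contra h4
    have h5 := add_le_add (Cardinal.one_le_iff_pos.mpr h3)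
      (Cardinal.one_le_iff_pos.mpr (pos_iff_ne_zero.mpr h4))
    have h6 := h5.trans h1
    norm_num at h6
  have : FaithfulSMul (RatFunc k) F := inferInstance
  have : Algebra.IsAlgebraic (RatFunc k) F := trdeg_eq_zero_iff.mp h2
  have : Algebra.EssFiniteType A F := .of_isLocalization F (nonZeroDivisors A)
  have : Algebra.EssFiniteType k F := .comp k A F
  have : Algebra.EssFiniteType (RatFunc k) F := .of_comp k (RatFunc k) F
  exact Algebra.finite_of_essFiniteType_of_isAlgebraic

end Dimension

namespace CurvePair

variable {k : Type u} [Field k] (X : Variety k)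

/-- The `k`-algebra of functions on an open subset of a variety. -/
noncomputable abbrev sectionsAlgebra (U : X.scheme.Opens) : Algebra k Γ(X.scheme, U) :=
  RingHom.toAlgebra ((Scheme.ΓSpecIso (.of k)).inv ≫ X.str.appLE ⊤ U le_top).hom

attribute [local instance] sectionsAlgebra stalkAlgebra

lemma finiteType_sectionsAlgebra {U : X.scheme.Opens} (hU : IsAffineOpen U) :
    Algebra.FiniteType k Γ(X.scheme, U) := by
  have := X.locallyOfFiniteType
  have h1 := Scheme.Hom.finiteType_appLE X.str (isAffineOpen_top (Spec (.of k))) hU le_top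
  have h2 : ((Scheme.ΓSpecIso (.of k)).inv ≫ X.str.appLE ⊤ U le_top).hom.FiniteType :=
    h1.comp (RingHom.FiniteType.of_surjective _
      (ConcreteCategory.bijective_of_isIso (Scheme.ΓSpecIso (.of k)).inv).2)
  exact h2

lemma isScalarTower_sections_stalk (U : X.scheme.Opens) (x : U) :
    IsScalarTower k Γ(X.scheme, U) (X.scheme.presheaf.stalk x.1) := by
  refine .of_algebraMap_eq fun c => ?_
  have h : X.str.appLE ⊤ U le_top ≫ X.scheme.presheaf.germ U x.1 x.2 =
      X.str.appTop ≫ X.scheme.presheaf.germ ⊤ x.1 trivial :=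
    (Category.assoc _ _ _).trans
      (congrArg (X.str.appTop ≫ ·) (X.scheme.presheaf.germ_res _ _ _))
  exact (DFunLike.congr_fun (CommRingCat.hom_ext_iff.mp h)
    ((Scheme.ΓSpecIso (.of k)).inv.hom c)).symm

lemma isScalarTower_sections_functionField (U : X.scheme.Opens) [Nonempty U] :
    IsScalarTower k Γ(X.scheme, U) X.functionField := by
  refine .of_algebraMap_eq fun c => ?_
  have h : X.str.appLE ⊤ U le_top ≫ X.scheme.germToFunctionField U =
      X.str.appTop ≫ X.scheme.presheaf.germ ⊤ (genericPoint X.scheme) trivial :=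
    (Category.assoc _ _ _).trans
      (congrArg (X.str.appTop ≫ ·) (X.scheme.presheaf.germ_res _ _ _))
  exact (DFunLike.congr_fun (CommRingCat.hom_ext_iff.mp h)
    ((Scheme.ΓSpecIso (.of k)).inv.hom c)).symm

lemma essFiniteType_stalk (x : X.scheme) :
    Algebra.EssFiniteType k (X.scheme.presheaf.stalk x) := by
  obtain ⟨U, hU, hxU, -⟩ := exists_isAffineOpen_mem_and_subset (x := x) (U := ⊤) trivial
  obtain ⟨x, rfl⟩ : ∃ y : U, y.1 = x := ⟨⟨x, hxU⟩, rfl⟩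
  have := finiteType_sectionsAlgebra X hU
  have := isScalarTower_sections_stalk X U x
  have h1 := hU.isLocalization_stalk x
  have : Algebra.EssFiniteType Γ(X.scheme, U) (X.scheme.presheaf.stalk x.1) :=
    .of_isLocalization _ (hU.primeIdealOf x).asIdeal.primeCompl
  exact .comp k Γ(X.scheme, U) _

variable {X}

/-- A nonzero prime is a non-generic point of the curve, hence closed, hence without proper
specializations. -/
lemma eq_of_le_of_topologicalKrullDim_eq_one (hdim : topologicalKrullDim X.scheme = 1)
    {U : X.scheme.Opens} (hU : IsAffineOpen U) (p q : Ideal Γ(X.scheme, U))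
    (hp : p.IsPrime) (hq : q.IsPrime) (hp0 : p ≠ ⊥) (hpq : p ≤ q) : p = q := by
  let p' : Spec Γ(X.scheme, U) := ⟨p, hp⟩
  let q' : Spec Γ(X.scheme, U) := ⟨q, hq⟩
  have hinj := hU.fromSpec.isOpenEmbedding.injective
  have hne : Nonempty U := by
    have : Nontrivial Γ(X.scheme, U) := 
      nontrivial_of_ne (0 : Γ(X.scheme, U)) 1 fun h => hp.ne_top
        ((Ideal.eq_top_iff_one p).mpr (h ▸ zero_mem p))
    by_contra hemp
    rw [not_nonempty_iff] at hemp
    have : U = ⊥ := by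
      ext x
      exact ⟨fun hx => hemp.elim ⟨x, hx⟩, fun hx => hx.elim⟩
    subst this
    exact not_subsingleton Γ(X.scheme, ⊥) inferInstance
  have : IsDomain Γ(X.scheme, U) := inferInstance
  have hgen : hU.fromSpec p' ≠ genericPoint X.scheme := by
    rw [← genericPoint_eq_of_isOpenImmersion hU.fromSpec]
    intro h
    have h1 := hinj h
    rw [genericPoint_eq_bot_of_affine] at h1
    exact hp0 (congrArg PrimeSpectrum.asIdeal h1)
  have hspec : p' ⤳ q' := (PrimeSpectrum.le_iff_specializes p' q').mp hpq
  have h2 := hspec.map hU.fromSpec.continuous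
  have h3 := specializes_iff_mem_closure.mp h2
  rw [(isClosed_singleton_of_topologicalKrullDim_eq_one hdim hgen).1.closure_eq] at h3
  exact (congrArg PrimeSpectrum.asIdeal (hinj h3)).symm

/-- The function field of a curve is finite over any rational function subfield. -/
theorem finiteDimensional_functionField (hdim : topologicalKrullDim X.scheme = 1)
    [Algebra (RatFunc k) X.functionField] [IsScalarTower k (RatFunc k) X.functionField] :
    FiniteDimensional (RatFunc k) X.functionField := by
  obtain ⟨U, hU, hxU, -⟩ :=
    exists_isAffineOpen_mem_and_subset (x := genericPoint X.scheme) (U := ⊤) trivial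
  have : Nonempty U := ⟨⟨_, hxU⟩⟩
  have := finiteType_sectionsAlgebra X hU
  have := isScalarTower_sections_functionField X U
  have := functionField_isFractionRing_of_isAffineOpen X.scheme U hU
  exact finiteDimensional_ratFunc Γ(X.scheme, U) X.functionField
    (eq_of_le_of_topologicalKrullDim_eq_one hdim hU)

end CurvePair

end

section

open WithZero IsDedekindDomain Polynomial
open IsLocalRing KaehlerDifferential

/-! ### Differentials of function fields and their orders. -/

section Differentials

/-- On a local ring with residue field `k` the differentials are generated by the differential of a
generator of the maximal ideal. -/
theorem exists_D_eq_smul_of_maximalIdeal_eq_span {k O : Type*} [Field k] [CommRing O]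
    [IsLocalRing O] [Algebra k O] [Algebra.EssFiniteType k O]
    (hres : ∀ a : O, ∃ c : k, a - algebraMap k O c ∈ maximalIdeal O) {t : O}
    (ht : maximalIdeal O = Ideal.span {t}) (u : O) : ∃ w : O, D k O u = w • D k O t := by
  have hle : (⊤ : Submodule O Ω[O⁄k]) ≤ Submodule.span O {D k O t} := by
    -- Nakayama: writing a = c + bt with c constant gives da = b dt + t db, so dt spans the
    -- differentials modulo the maximal ideal.
    apply Submodule.le_of_le_smul_of_le_jacobson_bot (I := maximalIdeal O)
      Module.Finite.fg_top (IsLocalRing.maximalIdeal_le_jacobson _)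
    rw [← KaehlerDifferential.span_range_derivation k O, Submodule.span_le]
    rintro _ ⟨a, rfl⟩
    obtain ⟨c, hc⟩ := hres a
    have hc' := hc
    rw [ht, Ideal.mem_span_singleton'] at hc'
    obtain ⟨b, hb⟩ := hc'
    have h1 : D k O a = b • D k O t + t • D k O b := by
      rw [← Derivation.leibniz, hb, map_sub, Derivation.map_algebraMap, sub_zero]
    rw [h1]
    refine Submodule.add_mem_sup (Submodule.smul_mem _ _ (Submodule.mem_span_singleton_self _)) ?_
    refine Submodule.smul_mem_smul ?_ (Submodule.subset_span ⟨b, rfl⟩)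
    rw [ht]
    exact Ideal.mem_span_singleton_self t
  obtain ⟨w, hw⟩ := Submodule.mem_span_singleton.mp (hle (Submodule.mem_top (x := D k O u)))
  exact ⟨w, hw.symm⟩

variable {k F : Type*} [Field k] [Field F] [Algebra k F]
  [Algebra (RatFunc k) F] [IsScalarTower k (RatFunc k) F]

lemma D_algebraMap_ratFunc_mem_span (f : RatFunc k) :
    D k F (algebraMap (RatFunc k) F f) ∈
      Submodule.span F {D k F (algebraMap (RatFunc k) F RatFunc.X)} := by
  have hp : ∀ p : k[X], D k F (algebraMap (RatFunc k) F (algebraMap k[X] (RatFunc k) p)) ∈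
      Submodule.span F {D k F (algebraMap (RatFunc k) F RatFunc.X)} := by
    intro p
    have : algebraMap (RatFunc k) F (algebraMap k[X] (RatFunc k) p) =
        aeval (algebraMap (RatFunc k) F RatFunc.X) p := by
      rw [aeval_algebraMap_apply, RatFunc.aeval_X_left_eq_algebraMap]
    rw [this, Derivation.map_aeval]
    exact Submodule.smul_mem _ _ (Submodule.mem_span_singleton_self _)
  obtain ⟨p, q, -, rfl⟩ := IsFractionRing.div_surjective (A := k[X]) f
  rw [map_div₀, Derivation.leibniz_div]
  exact Submodule.smul_mem _ _ (Submodule.sub_mem _ (Submodule.smul_mem _ _ (hp p))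
    (Submodule.smul_mem _ _ (hp q)))

/-- The differentials of a function field are generated by that of a separating variable. -/
theorem exists_eq_smul_D_ratFunc_X [CharZero k] [FiniteDimensional (RatFunc k) F] (ω : Ω[F⁄k]) :
    ∃ h : F, ω = h • D k F (algebraMap (RatFunc k) F RatFunc.X) := by
  -- Separability kills the relative differentials, so every differential of `F` comes from k(X) by
  -- base change.
  have : Algebra.FormallyUnramified (RatFunc k) F := .of_isSeparable (RatFunc k) F
  have h1 := KaehlerDifferential.exact_mapBaseChange_map k (RatFunc k) F
  obtain ⟨z, rfl⟩ := (h1 ω).mp (Subsingleton.elim _ _)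
  have h2 : KaehlerDifferential.mapBaseChange k (RatFunc k) F z ∈
      Submodule.span F {D k F (algebraMap (RatFunc k) F RatFunc.X)} := by
    induction z with
    | zero => rw [map_zero]; exact zero_mem _
    | add x y hx hy => rw [map_add]; exact add_mem hx hy
    | tmul a b =>
      rw [KaehlerDifferential.mapBaseChange_tmul]
      refine Submodule.smul_mem _ _ ?_
      have hb : b ∈ Submodule.span (RatFunc k) (Set.range (D k (RatFunc k))) := by
        rw [KaehlerDifferential.span_range_derivation]; trivial
      induction hb using Submodule.span_induction with
      | mem x hx =>
        obtain ⟨f, rfl⟩ := hx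
        rw [KaehlerDifferential.map_D]
        exact D_algebraMap_ratFunc_mem_span f
      | zero => rw [map_zero]; exact zero_mem _
      | add x y _ _ hx hy => rw [map_add]; exact add_mem hx hy
      | smul c x _ hx =>
        rw [map_smul, ← algebraMap_smul F c]
        exact Submodule.smul_mem _ _ hx
  obtain ⟨h, hh⟩ := Submodule.mem_span_singleton.mp h2
  exact ⟨h, hh.symm⟩

variable {ι : Type*} {v : ι → Valuation F ℤᵐ⁰} (hv : IsPlaceSystem k v)

omit [Algebra (RatFunc k) F] [IsScalarTower k (RatFunc k) F] in
include hv in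
lemma IsPlaceSystem.valuation_algebraMap (P : ι) {c : k} (hc : c ≠ 0) :
    v P (algebraMap k F c) = 1 := by
  refine le_antisymm (hv.algebraMap_le_one P c) ?_
  have h := hv.algebraMap_le_one P c⁻¹
  rw [map_inv₀, map_inv₀] at h
  have h0 : v P (algebraMap k F c) ≠ 0 := by simpa using hc
  exact (inv_le_one₀ (zero_lt_iff.mpr h0)).mp h

omit [Algebra (RatFunc k) F] [IsScalarTower k (RatFunc k) F] in
include hv in
/-- The order of the differential of a function. -/
lemma IsPlaceSystem.exists_D_eq_smul [CharZero k] {P : ι} {t : F} (ht : v P t = exp (-1))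
    (hgen : ∀ u, v P u ≤ 1 → ∃ w, v P w ≤ 1 ∧ D k F u = w • D k F t)
    {y : F} {N : ℤ} (hN : N ≠ 0) (hy : v P y = exp (-N)) :
    ∃ g, v P g = exp (-(N - 1)) ∧ D k F y = g • D k F t := by
  have ht0 : t ≠ 0 := by
    rintro rfl
    rw [map_zero] at ht
    exact exp_ne_zero ht.symm
  have hzpow : ∀ n : ℤ, v P (t ^ n) = exp (-n) := fun n => by
    rw [map_zpow₀, ht, ← exp_zsmul]
    simp
  have hu : v P (y * t ^ (-N)) = 1 := by
    rw [map_mul, hy, hzpow, ← exp_add]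
    simp
  obtain ⟨w, hw, hDw⟩ := hgen _ hu.le
  set u := y * t ^ (-N) with hudef
  have hyu : y = u * t ^ N := by
    rw [hudef, mul_assoc, ← zpow_add₀ ht0]
    simp
  -- This is the product rule for y = u t^N with u a unit and du = w dt. The bracket is a unit since
  -- N is invertible in characteristic zero.
  refine ⟨t ^ (N - 1) * ((N : F) * u + t * w), ?_, ?_⟩
  · have hNF : (N : F) = algebraMap k F (N : k) := by simp
    have h1 : v P ((N : F) * u) = 1 := by
      rw [map_mul, hu, mul_one, hNF, hv.valuation_algebraMap P (by exact_mod_cast hN)]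
    have h2 : v P (t * w) < 1 := by
      rw [map_mul, ht]
      calc exp (-1) * v P w ≤ exp (-1 : ℤ) * 1 := mul_le_mul_right hw _
        _ < 1 := by rw [mul_one, ← exp_zero, exp_lt_exp]; norm_num
    rw [map_mul, hzpow, Valuation.map_add_eq_of_lt_left _ (h1 ▸ h2), h1, mul_one]
  · rw [hyu, Derivation.leibniz, hDw, Derivation.leibniz_zpow, ← Int.cast_smul_eq_zsmul F,
      smul_smul, smul_smul, smul_smul, ← add_smul]
    congr 1
    have h3 : t ^ N = t ^ (N - 1) * t := by
      rw [← zpow_add_one₀ ht0]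
      simp
    rw [h3]
    ring

include hv in
/-- The divisor of a nonzero differential, compared with that of a separating variable. -/
theorem exists_isDifferentialOrder [CharZero k] [FiniteDimensional (RatFunc k) F]
    {K : ι → ℤ} {ω : Ω[F⁄k]} (hω : ω ≠ 0)
    (hK : ∀ P, ∃ t φ, v P t = exp (-1) ∧
      (∀ u, v P u ≤ 1 → ∃ w, v P w ≤ 1 ∧ D k F u = w • D k F t) ∧
      ω = φ • D k F t ∧ v P φ = exp (-K P)) :
    ∃ (K₀ : ι → ℤ) (h : F), IsDifferentialOrder k v (algebraMap (RatFunc k) F RatFunc.X) K₀ ∧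
      h ≠ 0 ∧ ∀ P, v P h = exp (K₀ P - K P) := by
  obtain ⟨h, hh⟩ := exists_eq_smul_D_ratFunc_X ω
  set x := algebraMap (RatFunc k) F RatFunc.X with hx
  have hxc : ∀ a : k, x - algebraMap k F a ≠ 0 := by
    intro a h0
    rw [sub_eq_zero, hx, IsScalarTower.algebraMap_apply k (RatFunc k) F] at h0
    have h1 := (algebraMap (RatFunc k) F).injective h0
    exact RatFunc.transcendental_X (h1 ▸ isAlgebraic_algebraMap a)
  have hx0 : x ≠ 0 := by simpa using hxc 0
  -- N is the order of x - a, or of x at a pole; it is nonzero, so dx = g dt with g of order N - 1.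
  -- Comparing ω = h dx = φ dt gives h the order K P - (N - 1).
  have key : ∀ P, ∃ N : ℤ, ((∃ a : k, v P (x - algebraMap k F a) < 1 ∧
      v P (x - algebraMap k F a) = exp (-N)) ∨ (1 < v P x ∧ v P x = exp (-N))) ∧
      v P h = exp (N - 1 - K P) := by
    intro P
    obtain ⟨t, φ, ht, hgen, hφ, hφK⟩ := hK P
    have main : ∀ {y : F} {N : ℤ}, N ≠ 0 → v P y = exp (-N) → D k F y = D k F x →
        v P h = exp (N - 1 - K P) := by
      intro y N hN hy hyx
      obtain ⟨g, hg, hDg⟩ := hv.exists_D_eq_smul ht hgen hN hy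
      rw [← hyx, hDg, smul_smul] at hh
      have hDt : D k F t ≠ 0 := by
        intro h0
        rw [h0, smul_zero] at hφ
        exact hω hφ
      have h1 : h * g = φ := smul_left_injective F hDt (hh.symm.trans hφ)
      rw [← h1, map_mul, hg] at hφK
      calc v P h = v P h * exp (-(N - 1)) * exp (N - 1) := by
            rw [mul_assoc, ← exp_add]; simp
        _ = _ := by rw [hφK, ← exp_add]; congr 1; ring
    have hlog : ∀ {y : F}, y ≠ 0 → v P y = exp (-(-log (v P y))) := fun {y} hy => by
      rw [neg_neg, exp_log ((_root_.map_ne_zero _).mpr hy)]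
    rcases le_or_gt (v P x) 1 with hle | hlt
    · obtain ⟨a, ha⟩ := hv.exists_residue P x hle
      refine ⟨-log (v P (x - algebraMap k F a)), Or.inl ⟨a, ha, hlog (hxc a)⟩,
        main ?_ (hlog (hxc a)) (by simp)⟩
      intro h0
      rw [hlog (hxc a), h0, neg_zero, exp_zero] at ha
      exact lt_irrefl _ ha
    · refine ⟨-log (v P x), Or.inr ⟨hlt, hlog hx0⟩, main ?_ (hlog hx0) rfl⟩
      intro h0
      rw [hlog hx0, h0, neg_zero, exp_zero] at hlt
      exact lt_irrefl _ hlt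
  choose N hN hNh using key
  refine ⟨fun P => N P - 1, h, fun P => ?_, ?_, hNh⟩
  · rw [sub_add_cancel]
    exact hN P
  · rintro rfl
    rw [zero_smul] at hh
    exact hω hh

end Differentials

end

section

open WithZero Polynomial
open IsLocalRing KaehlerDifferential

/-! ### Rational subfields generated by a transcendental element. -/

section RationalSubfield

variable {k F : Type*} [Field k] [Field F] [Algebra k F]

/-- The embedding of a rational function field given by a transcendental element. -/
noncomputable abbrev ratFuncAlgebra {t : F} (ht : Transcendental k t) : Algebra (RatFunc k) F :=
  (IsFractionRing.lift (A := k[X]) (g := (aeval (R := k) t).toRingHom)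
    (transcendental_iff_injective.mp ht)).toAlgebra

/-- The algebra structure over the polynomial ring given by an element. -/
noncomputable abbrev polynomialAlgebra (k : Type*) {F : Type*} [Field k] [Field F] [Algebra k F]
    (t : F) : Algebra k[X] F :=
  (aeval (R := k) t).toRingHom.toAlgebra

lemma isScalarTower_polynomial_ratFuncAlgebra {t : F} (ht : Transcendental k t) :
    letI := ratFuncAlgebra ht
    letI := polynomialAlgebra k t
    IsScalarTower k[X] (RatFunc k) F := by
  let _ := ratFuncAlgebra ht
  let _ := polynomialAlgebra k t
  refine .of_algebraMap_eq fun p => ?_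
  exact (IsFractionRing.lift_algebraMap (transcendental_iff_injective.mp ht) p).symm

lemma isScalarTower_ratFuncAlgebra {t : F} (ht : Transcendental k t) :
    letI := ratFuncAlgebra ht
    IsScalarTower k (RatFunc k) F := by
  let _ := ratFuncAlgebra ht
  refine .of_algebraMap_eq fun c => ?_
  rw [IsScalarTower.algebraMap_apply k k[X] (RatFunc k)]
  exact ((IsFractionRing.lift_algebraMap (transcendental_iff_injective.mp ht) _).trans
    (aeval_C t c)).symm

lemma transcendental_of_notMem_range [IsAlgClosed k] {t : F} (ht : t ∉ (algebraMap k F).range) :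
    Transcendental k t := fun h => ht <| minpoly.mem_range_of_degree_eq_one k t
  (IsAlgClosed.degree_eq_one_of_irreducible k (minpoly.irreducible h.isIntegral))

end RationalSubfield

/-! ### Riemann–Roch consequences on the curve. -/

namespace CurvePair

variable {k : Type u} [Field k] {X : Variety k}

attribute [local instance] stalkAlgebra

lemma exists_D_eq_smul_of_irreducible [IsAlgClosed k] (hX : X.IsNormal)
    (hdim : topologicalKrullDim X.scheme = 1) (P : PrimeDivisor X)
    {t : X.scheme.presheaf.stalk P.1} (ht : Irreducible t) {u : X.functionField}
    (hu : placeValuation hX P u ≤ 1) :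
    ∃ w, placeValuation hX P w ≤ 1 ∧ D k X.functionField u =
      w • D k X.functionField (algebraMap (X.scheme.presheaf.stalk P.1) X.functionField t) := by
  have := isScalarTower_stalkAlgebra X P.1
  have := isDiscreteValuationRing_stalk hX P
  have := essFiniteType_stalk X P.1
  obtain ⟨a, rfl⟩ := exists_of_placeValuation_le_one hX P hu
  obtain ⟨w, hw⟩ := exists_D_eq_smul_of_maximalIdeal_eq_span
    (exists_sub_algebraMap_mem_maximalIdeal
      (isClosed_singleton_of_topologicalKrullDim_eq_one hdim
        (ne_genericPoint_of_coheight_eq_one P.2)).1) ht.maximalIdeal_eq a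
  refine ⟨algebraMap (X.scheme.presheaf.stalk P.1) X.functionField w,
    placeValuation_algebraMap_le_one hX P w, ?_⟩
  have h := congrArg (KaehlerDifferential.map k k (X.scheme.presheaf.stalk P.1)
    X.functionField) hw
  rw [map_smul, KaehlerDifferential.map_D, KaehlerDifferential.map_D] at h
  rw [h, algebraMap_smul]

lemma exists_placeValuation_of_isCanonicalDivisor [IsAlgClosed k] (hX : X.IsNormal)
    (hdim : topologicalKrullDim X.scheme = 1) {K : Divisor X} (hK : IsCanonicalDivisor K) :
    ∃ ω : Ω[X.functionField⁄k], ω ≠ 0 ∧ ∀ P, ∃ t φ, placeValuation hX P t = exp (-1) ∧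
      (∀ u, placeValuation hX P u ≤ 1 → ∃ w, placeValuation hX P w ≤ 1 ∧
        D k X.functionField u = w • D k X.functionField t) ∧
      ω = φ • D k X.functionField t ∧ placeValuation hX P φ = exp (-K P) := by
  obtain ⟨ω, hω, hK⟩ := hK
  refine ⟨ω, hω, fun P => ?_⟩
  obtain ⟨t, ht, φ, hφ, hKP⟩ := hK P
  refine ⟨_, φ, placeValuation_irreducible hX P ht,
    fun u hu => exists_D_eq_smul_of_irreducible hX hdim P ht hu, hφ, ?_⟩
  rw [hKP, placeValuation_eq_exp]
  rintro rfl
  rw [zero_smul] at hφ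
  exact hω hφ

lemma notMem_range_of_placeValuation_eq {hX : X.IsNormal}
    (hv : IsPlaceSystem k (placeValuation hX)) {P : PrimeDivisor X} {t : X.functionField} (ht : placeValuation hX P t = exp (-1)) :
    t ∉ (algebraMap k X.functionField).range := by
  rintro ⟨c, rfl⟩
  rcases eq_or_ne c 0 with rfl | hc
  · rw [map_zero, map_zero] at ht
    exact exp_ne_zero ht.symm
  · rw [hv.valuation_algebraMap P hc, ← exp_zero, exp_inj] at ht
    norm_num at ht

lemma ordAt_eq_of_placeValuation_eq (hX : X.IsNormal) {P : PrimeDivisor X} {f : X.functionField}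
    {n : ℤ} (h : placeValuation hX P f = exp (-n)) : ordAt f P = n := by
  have hf : f ≠ 0 := by
    rintro rfl
    rw [map_zero] at h
    exact exp_ne_zero h.symm
  rw [placeValuation_eq_exp hX P hf, exp_inj] at h
  linarith

/-- On a rational curve divisors of degree zero are principal; on an elliptic curve canonical
divisors are. -/
theorem exists_ordAt_eq [IsAlgClosed k] [CharZero k] (hX : X.IsNormal) (hproj : X.IsProjective)
    (hdim : topologicalKrullDim X.scheme = 1) {K : Divisor X} (hK : IsCanonicalDivisor K)
    [Nonempty (PrimeDivisor X)] :
    (divisorDegree K < 0 → ∀ D : Divisor X, divisorDegree D = 0 →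
      ∃ f : X.functionField, f ≠ 0 ∧ ∀ P, ordAt f P = D P) ∧
    (divisorDegree K = 0 → ∃ f : X.functionField, f ≠ 0 ∧ ∀ P, ordAt f P = K P) := by
  have hv := isPlaceSystem_placeValuation hX hproj hdim
  -- A uniformizer at any point is non-constant, hence transcendental over the algebraically closed
  -- k, and serves as the variable of k(X).
  obtain ⟨t, ht⟩ := placeValuation_surjective hX (Classical.arbitrary (PrimeDivisor X)) (exp (-1))
  have htr := transcendental_of_notMem_range (notMem_range_of_placeValuation_eq hv ht)
  let _ := ratFuncAlgebra htr
  let _ := polynomialAlgebra k t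
  have := isScalarTower_ratFuncAlgebra htr
  have := isScalarTower_polynomial_ratFuncAlgebra htr
  have := finiteDimensional_functionField hdim
  obtain ⟨ω, hω, hKω⟩ := exists_placeValuation_of_isCanonicalDivisor hX hdim hK
  obtain ⟨K₀, h, hK₀, h0, hh⟩ := exists_isDifferentialOrder hv hω hKω
  constructor
  · intro hneg D hD
    obtain ⟨f, hf0, hf⟩ := exists_valuation_eq_of_canonical_neg hv hK₀ h0 hh hneg hD
    -- A value exp (D P) means order -D P, so the inverse is taken.
    refine ⟨f⁻¹, inv_ne_zero hf0, fun P => ordAt_eq_of_placeValuation_eq hX ?_⟩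
    rw [map_inv₀, hf, exp_neg]
  · intro hdeg
    obtain ⟨f, hf0, hf⟩ := exists_valuation_eq_canonical hv hK₀ h0 hh hdeg
    refine ⟨f⁻¹, inv_ne_zero hf0, fun P => ordAt_eq_of_placeValuation_eq hX ?_⟩
    rw [map_inv₀, hf, exp_neg]

end CurvePair

end

/-! ### Non-constant contractions of a curve. -/

section

open WithZero Polynomial
open IsLocalRing

namespace CurvePair

variable {k : Type u} [Field k] {X Z : Variety k}

lemma Variety.noetherianSpace (X : Variety k) : TopologicalSpace.NoetherianSpace X.scheme := by
  have := X.quasiCompact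
  have : CompactSpace X.scheme := QuasiCompact.compactSpace_of_compactSpace X.str
  have : IsNoetherian X.scheme := {}
  infer_instance

section Contraction

variable (π : Contraction X Z)

lemma Contraction.isClosedMap : IsClosedMap π.hom := by
  have : IsProper π.hom := IsProjectiveMorphism.isProper π.projective
  exact π.hom.isClosedMap

attribute [local instance] stalkAlgebra in
lemma Contraction.functionFieldMap_algebraMap_base (c : k) :
    π.functionFieldMap (algebraMap k Z.functionField c) = algebraMap k X.functionField c := by
  obtain ⟨x⟩ : Nonempty X.scheme := inferInstance
  have := isScalarTower_stalkAlgebra X x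
  have := isScalarTower_stalkAlgebra Z (π.hom x)
  have h1 : X.str.appTop = Z.str.appTop ≫ π.hom.appTop := by
    rw [← π.comm]; rfl
  have h2 : π.hom.stalkMap x (algebraMap k (Z.scheme.presheaf.stalk (π.hom x)) c) =
      algebraMap k (X.scheme.presheaf.stalk x) c := by
    refine (DFunLike.congr_fun (CommRingCat.hom_ext_iff.mp
      (Scheme.Hom.germ_stalkMap π.hom ⊤ x trivial))
      (Z.str.appTop.hom ((Scheme.ΓSpecIso (.of k)).inv.hom c))).trans ?_
    change _ = X.scheme.presheaf.germ ⊤ x trivial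
      (X.str.appTop.hom ((Scheme.ΓSpecIso (.of k)).inv.hom c))
    rw [h1]
    rfl
  rw [IsScalarTower.algebraMap_apply k (Z.scheme.presheaf.stalk (π.hom x)) Z.functionField,
    π.functionFieldMap_algebraMap, h2, ← IsScalarTower.algebraMap_apply]

lemma Contraction.dominates_comap {A : ValuationSubring X.functionField} {x : X.scheme}
    (h : Dominates A x) : Dominates (A.comap π.functionFieldMap) (π.hom x) := by
  intro a
  have h1 := h (π.hom.stalkMap x a)
  rw [← π.functionFieldMap_algebraMap] at h1
  refine ⟨h1.1, fun ha => ?_⟩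
  have hm : π.hom.stalkMap x a ∈ maximalIdeal (X.scheme.presheaf.stalk x) := by
    rw [mem_maximalIdeal, mem_nonunits_iff] at ha ⊢
    exact fun hu => ha (isUnit_of_map_unit (π.hom.stalkMap x).hom a hu)
  have h2 := h1.2 hm
  set b := algebraMap (Z.scheme.presheaf.stalk (π.hom x)) Z.scheme.functionField a
  by_contra! hle
  rcases eq_or_ne b 0 with hb | hb
  · rw [hb, map_zero] at hle
    exact absurd hle (by simp)
  have h3 : b⁻¹ ∈ A.comap π.functionFieldMap := by
    rw [← ValuationSubring.valuation_le_one_iff, map_inv₀]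
    exact inv_le_one_of_one_le₀ hle
  rw [ValuationSubring.mem_comap, ← ValuationSubring.valuation_le_one_iff, map_inv₀, map_inv₀] at h3
  have h4 : A.valuation (π.functionFieldMap b) ≠ 0 :=
    (_root_.map_ne_zero _).mpr ((_root_.map_ne_zero _).mpr hb)
  exact absurd ((inv_le_one₀ (zero_lt_iff.mpr h4)).mp h3) (not_le.mpr h2)

variable (hdim : topologicalKrullDim X.scheme = 1) (hne : ¬ ∃ z, ∀ x, π.hom x = z)

include hdim hne

/-- The image of a closed point is closed. Were it the generic point, it would be closed and dense,
so everything would map to it. -/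
lemma Contraction.isClosed_singleton_map {x : X.scheme} (hx : x ≠ genericPoint X.scheme) :
    IsClosed {π.hom x} ∧ π.hom x ≠ genericPoint Z.scheme := by
  have h1 := π.isClosedMap _ (isClosed_singleton_of_topologicalKrullDim_eq_one hdim hx).1
  rw [Set.image_singleton] at h1
  refine ⟨h1, fun h => hne ⟨π.hom x, fun y => ?_⟩⟩
  have h2 : π.hom y ∈ closure {π.hom x} := by
    rw [h, genericPoint_closure]; trivial
  rwa [h1.closure_eq] at h2

/-- The fibre is a proper closed subset of the curve, hence a finite set of closed points, hence
discrete; being connected, it is a single point. -/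
lemma Contraction.injOn {x y : X.scheme} (hx : x ≠ genericPoint X.scheme)
    (hxy : π.hom x = π.hom y) : x = y := by
  have := X.noetherianSpace
  obtain ⟨h1, h2⟩ := π.isClosed_singleton_map hdim hne hx
  set S := π.hom ⁻¹' {π.hom x} with hS
  have hclosed : IsClosed S := h1.preimage π.hom.continuous
  have hgen : genericPoint X.scheme ∉ S := fun h => by
    rw [hS, Set.mem_preimage, Set.mem_singleton_iff, π.map_genericPoint] at h
    exact h2 h.symm
  have hfin : Finite S := IsClosed.finite_of_topologicalKrullDim_eq_one hdim hclosed hgen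
  have hT1 : T1Space S := ⟨fun s => by
    have h3 : s.1 ≠ genericPoint X.scheme := fun h => hgen (h ▸ s.2)
    have h4 := (isClosed_singleton_of_topologicalKrullDim_eq_one hdim h3).1.preimage
      continuous_subtype_val (X := S)
    convert h4
    ext a
    simp [Subtype.ext_iff]⟩
  have hconn : PreconnectedSpace S :=
    isPreconnected_iff_preconnectedSpace.mp (π.connected_fibres (π.hom x)).isPreconnected
  have hsub := (PreconnectedSpace.isPreconnected_univ (α := S)).subsingleton
  have := hsub (Set.mem_univ ⟨x, rfl⟩) (Set.mem_univ ⟨y, hxy.symm⟩)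
  exact congrArg Subtype.val this

/-- The contraction of a curve onto a curve is birational. -/
theorem Contraction.functionFieldMap_surjective [IsAlgClosed k] [CharZero k] (hX : X.IsNormal)
    (hproj : X.IsProjective) : Function.Surjective π.functionFieldMap := by
  have hv := isPlaceSystem_placeValuation hX hproj hdim
  have hdom := fun P => π.dominates_comap (dominates_valuationSubring hX P)
  -- If k(Z) were k, valuations of `X` would restrict trivially to it, with centre the generic point
  -- of `Z`; but closed points do not map there.
  obtain ⟨t, ht⟩ : ∃ t : Z.functionField, t ∉ (algebraMap k Z.functionField).range := by
    by_contra! hall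
    obtain ⟨x, hx⟩ : ∃ x, x ≠ genericPoint X.scheme := by
      by_contra! hx
      exact hne ⟨π.hom (genericPoint X.scheme), fun x => by rw [hx x]⟩
    let P : PrimeDivisor X := ⟨x, (isClosed_singleton_of_topologicalKrullDim_eq_one hdim hx).2⟩
    have htop : (placeValuation hX P).valuationSubring.comap π.functionFieldMap = ⊤ := by
      rw [eq_top_iff]
      intro f _
      obtain ⟨c, rfl⟩ := hall f
      rw [ValuationSubring.mem_comap, π.functionFieldMap_algebraMap_base]
      exact hv.algebraMap_le_one P c
    exact (π.isClosed_singleton_map hdim hne hx).2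
      (eq_of_dominates (htop ▸ hdom P) dominates_top_genericPoint)
  have htr := transcendental_of_notMem_range ht
  let _ : Algebra Z.functionField X.functionField := π.functionFieldMap.toAlgebra
  let _ := ratFuncAlgebra htr
  let _ := polynomialAlgebra k t
  have := isScalarTower_ratFuncAlgebra htr
  have := isScalarTower_polynomial_ratFuncAlgebra htr
  let _ : Algebra (RatFunc k) X.functionField :=
    (π.functionFieldMap.comp (algebraMap (RatFunc k) Z.functionField)).toAlgebra
  let _ : Algebra k[X] X.functionField :=
    (π.functionFieldMap.comp (algebraMap k[X] Z.functionField)).toAlgebra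
  have : IsScalarTower (RatFunc k) Z.functionField X.functionField := .of_algebraMap_eq' rfl
  have : IsScalarTower k (RatFunc k) X.functionField := .of_algebraMap_eq fun c => by
    rw [← π.functionFieldMap_algebraMap_base,
      IsScalarTower.algebraMap_apply k (RatFunc k) Z.functionField]
    rfl
  have : IsScalarTower k[X] (RatFunc k) X.functionField := .of_algebraMap_eq fun p => by
    change π.functionFieldMap (algebraMap k[X] Z.functionField p) = _
    rw [IsScalarTower.algebraMap_apply k[X] (RatFunc k) Z.functionField]
    rfl
  have := finiteDimensional_functionField hdim
  -- Places with equal restrictions to k(Z) have the same centre on the separated `Z`, so their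
  -- points have the same image and coincide.
  refine surjective_algebraMap_of_comap_injective (E := Z.functionField) hv fun P Q h => ?_
  apply Subtype.ext
  apply π.injOn hdim hne (ne_genericPoint_of_coheight_eq_one P.2)
  have h' : (placeValuation hX P).valuationSubring.comap π.functionFieldMap =
    (placeValuation hX Q).valuationSubring.comap π.functionFieldMap := h
  exact eq_of_dominates (hdom P) (h' ▸ hdom Q)

end Contraction

end CurvePair

end

/-! ### Degrees, principal divisors and pull-backs. -/

section

open WithZero

namespace CurvePair

variable {k : Type u} [Field k] {X Z : Variety k}

lemma ordAt_one (P : PrimeDivisor X) : ordAt (1 : X.functionField) P = 0 := by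
  have h := Scheme.ord_mul (x := P.1) (one_ne_zero (α := X.functionField)) one_ne_zero
  rw [mul_one] at h
  have h' : Scheme.ord (1 : X.functionField) P.1 = 0 := by linarith
  exact h'

lemma ordAt_pow {f : X.functionField} (hf : f ≠ 0) (n : ℕ) (P : PrimeDivisor X) :
    ordAt (f ^ n) P = n * ordAt f P := by
  induction n with
  | zero => rw [pow_zero, ordAt_one]; simp
  | succ n ih =>
    have h := Scheme.ord_mul (x := P.1) (pow_ne_zero n hf) hf
    rw [ordAt, pow_succ, h]
    rw [ordAt, ordAt] at ih
    rw [ih, ordAt]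
    push_cast
    ring

/-- The trivial Cartier divisor. -/
noncomputable def trivialCartierDivisor (Z : Variety k) : CartierDivisor Z where
  eqn _ := 1
  eqn_ne_zero _ := one_ne_zero
  locally_eq _ := ⟨⊤, trivial, fun _ _ => ⟨1, by simp⟩⟩

lemma linearlyEquivalent_trivialCartierDivisor_pullback (π : Contraction X Z) {E : RDivisor X}
    {f : X.functionField} (hf : f ≠ 0) (h : ∀ P, E P = ordAt f P) :
    LinearlyEquivalent E ((trivialCartierDivisor Z).pullback π) := by
  refine ⟨f, hf, fun P => ?_⟩
  have h1 : ((trivialCartierDivisor Z).pullback π).coeff P = 0 := by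
    change ordAt (π.functionFieldMap 1) P = 0
    rw [map_one, ordAt_one]
  rw [h1, h, Int.cast_zero, zero_add]

lemma RDivisor.IsCartier.exists_toReal_eq {E : RDivisor X} (hE : E.IsCartier) :
    ∃ D : Divisor X, D.toReal = E := by
  refine ⟨E.mapRange (fun r => ⌊r⌋) Int.floor_zero, ?_⟩
  ext P
  obtain ⟨U, hPU, φ, -, hφ⟩ := hE P.1
  rw [Divisor.toReal, Finsupp.mapRange_apply, Finsupp.mapRange_apply, hφ P hPU, Int.floor_intCast]

lemma Divisor.degree_toReal (D : Divisor X) : D.toReal.degree = divisorDegree D := by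
  rw [RDivisor.degree, Divisor.toReal, Finsupp.sum_mapRange_index (fun _ => rfl), divisorDegree,
    Finsupp.sum, Finsupp.sum, Int.cast_sum]

lemma RDivisor.degree_add (D E : RDivisor X) : (D + E).degree = D.degree + E.degree :=
  Finsupp.sum_add_index' (fun _ => rfl) (fun _ _ _ => rfl)

lemma RDivisor.degree_nsmul (n : ℕ) (D : RDivisor X) : (n • D).degree = n * D.degree := by
  induction n with
  | zero => simp [RDivisor.degree]
  | succ n ih => rw [succ_nsmul, RDivisor.degree_add, ih]; push_cast; ring

lemma RDivisor.degree_nonneg {B : RDivisor X} (hB : 0 ≤ B) : 0 ≤ B.degree :=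
  Finset.sum_nonneg fun P _ => hB P

lemma RDivisor.eq_zero_of_degree_eq_zero {B : RDivisor X} (hB : 0 ≤ B) (h : B.degree = 0) :
    B = 0 := by
  ext P
  by_contra hP
  exact hP ((Finset.sum_eq_zero_iff_of_nonneg fun P _ => hB P).mp h P
    (Finsupp.mem_support_iff.mpr hP))

/-- On a normal projective curve with `deg (K + B) = 0` and `B` effective, the divisor
`m (K + B)` is principal if it is Cartier. -/
theorem exists_ordAt_eq_of_degree_eq_zero [IsAlgClosed k] [CharZero k] (hX : X.IsNormal)
    (hproj : X.IsProjective) (hdim : topologicalKrullDim X.scheme = 1) {K : Divisor X}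
    (hK : IsCanonicalDivisor K) {B : RDivisor X} (hB : 0 ≤ B) (m : ℕ)
    (hCartier : RDivisor.IsCartier (m • (K.toReal + B)))
    (hdeg : (K.toReal + B).degree = 0) :
    ∃ f : X.functionField, f ≠ 0 ∧ ∀ P, (m • (K.toReal + B)) P = ordAt f P := by
  rcases isEmpty_or_nonempty (PrimeDivisor X) with hemp | hne
  · exact ⟨1, one_ne_zero, fun P => hemp.elim P⟩
  obtain ⟨h1, h2⟩ := exists_ordAt_eq hX hproj hdim hK
  have hsum := hdeg
  rw [RDivisor.degree_add, Divisor.degree_toReal] at hsum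
  have hBdeg := RDivisor.degree_nonneg hB
  -- Effectivity of B leaves only the rational case deg K < 0 and the elliptic case deg K = 0, where
  -- moreover B = 0.
  have hKdeg : divisorDegree K ≤ 0 := by
    have : (divisorDegree K : ℝ) ≤ 0 := by linarith
    exact_mod_cast this
  rcases hKdeg.lt_or_eq with hlt | heq
  · obtain ⟨D, hD⟩ := hCartier.exists_toReal_eq
    have hD0 : divisorDegree D = 0 := by
      have := Divisor.degree_toReal D
      rw [hD, RDivisor.degree_nsmul, hdeg, mul_zero] at this
      exact_mod_cast this.symm
    obtain ⟨f, hf0, hf⟩ := h1 hlt D hD0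
    refine ⟨f, hf0, fun P => ?_⟩
    rw [← hD, hf]
    rfl
  · obtain ⟨f, hf0, hf⟩ := h2 heq
    rw [heq, Int.cast_zero, zero_add] at hsum
    have hB0 := RDivisor.eq_zero_of_degree_eq_zero hB hsum
    refine ⟨f ^ m, pow_ne_zero m hf0, fun P => ?_⟩
    rw [ordAt_pow hf0, hf, hB0, add_zero, Finsupp.smul_apply, nsmul_eq_mul, Int.cast_mul,
      Int.cast_natCast]
    rfl

/-- On a normal curve every divisor is the pull-back of a Cartier divisor along a non-constant
contraction. -/
theorem exists_coeff_pullback_eq [IsAlgClosed k] [CharZero k] (hX : X.IsNormal)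
    (hproj : X.IsProjective) (hdim : topologicalKrullDim X.scheme = 1) (π : Contraction X Z)
    (hne : ¬ ∃ z, ∀ x, π.hom x = z) (D : Divisor X) :
    ∃ E : CartierDivisor Z, ∀ P, (E.pullback π).coeff P = D P := by
  classical
  have := X.noetherianSpace
  -- Birationality lets a function on `X` with the prescribed order at P be taken from k(Z).
  have hg : ∀ P : PrimeDivisor X, ∃ g : Z.functionField, g ≠ 0 ∧
      ordAt (π.functionFieldMap g) P = D P := by
    intro P
    obtain ⟨f, hf⟩ := placeValuation_surjective hX P (exp (-D P))
    obtain ⟨g, rfl⟩ := π.functionFieldMap_surjective hdim hne hX hproj f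
    refine ⟨g, ?_, ordAt_eq_of_placeValuation_eq hX hf⟩
    rintro rfl
    rw [map_zero, map_zero] at hf
    exact exp_ne_zero hf.symm
  choose g hg0 hg using hg
  have hinj : ∀ {P Q : PrimeDivisor X}, π.hom P.1 = π.hom Q.1 → P = Q := fun {P Q} h =>
    Subtype.ext (π.injOn hdim hne (ne_genericPoint_of_coheight_eq_one P.2) h)
  -- By injectivity of `π` at most one point of the support lies over z, so the choice is harmless.
  let eqn : Z.scheme → Z.functionField := fun z =>
    if h : ∃ P ∈ D.support, π.hom P.1 = z then g h.choose else 1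
  have eqn_of_mem : ∀ P ∈ D.support, eqn (π.hom P.1) = g P := by
    intro P hP
    have h : ∃ Q ∈ D.support, π.hom Q.1 = π.hom P.1 := ⟨P, hP, rfl⟩
    simp only [eqn, dif_pos h]
    rw [hinj h.choose_spec.2]
  have eqn_of_notMem : ∀ z, (¬ ∃ P ∈ D.support, π.hom P.1 = z) → eqn z = 1 := fun z h =>
    dif_neg h
  have eqn_ne_zero : ∀ z, eqn z ≠ 0 := by
    intro z
    by_cases h : ∃ P ∈ D.support, π.hom P.1 = z
    · obtain ⟨P, hP, rfl⟩ := h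
      rw [eqn_of_mem P hP]
      exact hg0 P
    · rw [eqn_of_notMem z h]
      exact one_ne_zero
  refine ⟨⟨eqn, eqn_ne_zero, fun z => ?_⟩, fun P => ?_⟩
  · obtain ⟨V, -, a, hV, ha, hunit⟩ := exists_isUnit_germ_eq Z.scheme (eqn z) (eqn_ne_zero z)
    -- T collects the points other than z where the equation is not 1 or where `eqn z` may fail to
    -- be a unit. It is a finite set of closed points, so its complement is the required
    -- neighbourhood of z.
    set T : Set Z.scheme :=
      ((fun P : PrimeDivisor X => π.hom P.1) '' D.support ∪ (V : Set Z.scheme)ᶜ) \ {z} with hT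
    have hgenV : genericPoint Z.scheme ∈ V :=
      (genericPoint_spec Z.scheme).mem_open_set_iff V.isOpen |>.mpr (by simpa using hV)
    have hVfin : ((V : Set Z.scheme)ᶜ).Finite := by
      have h1 : (π.hom ⁻¹' (V : Set Z.scheme)ᶜ).Finite :=
        IsClosed.finite_of_topologicalKrullDim_eq_one hdim
          (V.isOpen.isClosed_compl.preimage π.hom.continuous) (fun h => by
            rw [Set.mem_preimage, π.map_genericPoint] at h
            exact h hgenV)
      rw [← Set.image_preimage_eq (V : Set Z.scheme)ᶜ π.surjective]
      exact h1.image _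
    have hTfin : T.Finite := (((Finset.finite_toSet _).image _).union hVfin).sdiff
    have hTgen : ∀ y ∈ T, y ≠ genericPoint Z.scheme := by
      rintro y ⟨⟨P, -, rfl⟩ | hy, -⟩
      · exact (π.isClosed_singleton_map hdim hne (ne_genericPoint_of_coheight_eq_one P.2)).2
      · rintro rfl
        exact hy hgenV
    have hTclosed : IsClosed T := by
      rw [← Set.biUnion_of_singleton T]
      refine hTfin.isClosed_biUnion fun y hy => ?_
      obtain ⟨x, rfl⟩ := π.surjective y
      refine (π.isClosed_singleton_map hdim hne fun h => ?_).1
      exact hTgen _ hy (h ▸ π.map_genericPoint)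
    refine ⟨⟨Tᶜ, hTclosed.isOpen_compl⟩, fun h => h.2 rfl, fun y hy => ?_⟩
    rcases eq_or_ne y z with rfl | hyz
    · exact ⟨1, by simp⟩
    have hyT : ¬ (y ∈ (fun P : PrimeDivisor X => π.hom P.1) '' D.support ∪
      (V : Set Z.scheme)ᶜ) := fun h => hy ⟨h, hyz⟩
    rw [Set.mem_union, not_or, Set.notMem_compl_iff] at hyT
    have h1 : eqn y = 1 := eqn_of_notMem y hyT.1
    have h2 : IsUnit (Z.scheme.presheaf.germ V y hyT.2 a) :=
      hunit.map (Z.scheme.presheaf.germ V y hyT.2).hom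
    refine ⟨h2.unit⁻¹, ?_⟩
    have h3 : algebraMap (Z.scheme.presheaf.stalk y) Z.scheme.functionField h2.unit = eqn z := by
      rw [← ha, ← Scheme.algebraMap_germ_eq_germToFunctionField _ hyT.2]
      rfl
    rw [h1, ← h3, ← map_mul, Units.inv_mul, map_one]
  · change ordAt (π.functionFieldMap (eqn (π.hom P.1))) P = D P
    by_cases hP : P ∈ D.support
    · rw [eqn_of_mem P hP, hg]
    · rw [eqn_of_notMem, map_one, ordAt_one, Finsupp.notMem_support_iff.mp hP]
      rintro ⟨Q, hQ, hQP⟩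
      exact hP (hinj hQP ▸ hQ)

end CurvePair

end

/-- Let `(X, B)` be a projective pair of dimension one over an algebraically closed field of
characteristic zero, and let `π : X → Z` be a contraction such that `m (K_X + B)` is Cartier for a
positive integer `m` and `K_X + B ≡_Z 0`. Then `m (K_X + B) ∼ π^* D_Z` for some Cartier
divisor `D_Z` on `Z`. -/
theorem proposition3p1 {k : Type u} [Field k] [IsAlgClosed k] [CharZero k]
    (X Z : CurvePair.Variety k)
    (hX : X.IsNormal) (hproj : X.IsProjective) (hdim : topologicalKrullDim X.scheme = 1)
    (K : CurvePair.Divisor X) (hK : CurvePair.IsCanonicalDivisor K)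
    (B : CurvePair.RDivisor X) (hB : 0 ≤ B)
    (π : CurvePair.Contraction X Z)
    (m : ℕ) (hm : 0 < m)
    (hCartier : CurvePair.RDivisor.IsCartier (m • (K.toReal + B)))
    (hnum : CurvePair.NumericallyTrivialOver π (K.toReal + B)) :
    ∃ D : CurvePair.CartierDivisor Z,
      CurvePair.LinearlyEquivalent (m • (K.toReal + B)) (D.pullback π) := by
  by_cases hconst : ∃ z, ∀ x, π.hom x = z
  · obtain ⟨z, hz⟩ := hconst
    -- The curve tested against is `X` itself, which `π` contracts.
    have hdeg : (K.toReal + B).degree = 0 := by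
      refine hnum Set.univ isClosed_univ (IrreducibleSpace.isIrreducible_univ _) ?_
        ⟨z, fun x _ => hz x⟩
      rw [← hdim]
      exact IsHomeomorph.topologicalKrullDim_eq _ (Homeomorph.Set.univ X.scheme).isHomeomorph
    obtain ⟨f, hf0, hf⟩ := CurvePair.exists_ordAt_eq_of_degree_eq_zero hX hproj hdim hK hB m
      hCartier hdeg
    exact ⟨_, CurvePair.linearlyEquivalent_trivialCartierDivisor_pullback π hf0 hf⟩
  · obtain ⟨D, hD⟩ := hCartier.exists_toReal_eq
    obtain ⟨E, hE⟩ := CurvePair.exists_coeff_pullback_eq hX hproj hdim π hconst D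
    -- The pull-back equals the divisor exactly, so the linear equivalence is witnessed by the
    -- constant 1.
    refine ⟨E, 1, one_ne_zero, fun P => ?_⟩
    rw [hE, CurvePair.ordAt_one, Int.cast_zero, add_zero, ← hD]
    rfl
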